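/- Let $M=\mathbb{Z}^6$ with the even symmetric bilinear form with Gram matrix $$Q=\begin{bmatrix}0&1\\1&0\end{bmatrix}\oplus\begin{bmatrix}0&2\\2&0\end{bmatrix}\oplus\begin{bmatrix}-4&2\\2&-4\end{bmatrix}$$ (that is, $M=\mathrm{U}\oplus\mathrm{U}(2)\oplus\mathrm{A}_2(2)$), and let $$\mathbb{D}_M=\{z\in M\otimes\mathbb{C}\mid {}^tzQz=0,\ {}^tzQ\bar z>0\}/\mathbb{C}^\times\subset\mathbb{P}(M\otimes\mathbb{C}).$$ Every point of $\mathbb{D}_M$ can be written $[1:z_2:\cdots:z_6]$; let $\mathbb{D}_M^+$ be the set of those with $\mathrm{Im}\,z_3>0$. Let $\mathrm{O}(M)=\{g\in\mathrm{GL}_6(\mathbb{Z})\mid {}^tgQg=Q\}$ and $\mathrm{O}^+(M)=\{g\in\mathrm{O}(M)\mid g(\mathbb{D}_M^+)=\mathbb{D}_M^+\}$. Let $\check M\subset M\otimes\mathbb{Q}$ be the dual lattice and $q_M:\check M/M\to\mathbb{Q}/2\mathbb{Z}$, $x\mapsto {}^txQx$, the discriminant form. The elements $v\in\check M/M$ of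 order $2$ with $q_M(v)=0$ are permuted by $\mathrm{O}(q_M)$; there are exactly five of them, whence a homomorphism $\mathrm{O}^+(M)\to\mathrm{O}(q_M)\to\mathrm{S}_5$. Let $\mathrm{O}^+_{Enr}(M)$ be the kernel of this homomorphism and $\mathrm{SO}^+_{Enr}(M)=\mathrm{O}^+_{Enr}(M)\cap\mathrm{SL}_6(\mathbb{Z})$. Let $\omega=e^{2\pi i/3}$, let $\mathbb{H}_2=\{\tau\in\mathrm{GL}_2(\mathbb{C})\mid \frac{1}{2i}(\tau-\tau^*)>0\}$ be the Hermitian upper half space, and identify $\mathbb{D}_M^+$ with $\mathbb{H}_2$ by the bijection $$\Psi([1:z_2:\cdots:z_6])=\begin{bmatrix}z_3&z_5+\omega z_6\\ z_5+\omega^2z_6&z_4\end{bmatrix}.$$ Let $J=\begin{bmatrix}0&\mathrm{I}_2\\-\mathrm{I}_2&0\end{bmatrix}$, $\mathrm{H}\Gamma=\{g\in\mathrm{GL}_4(\mathbb{Z}[\omega])\mid g^*Jg=J\}$ and $$\mathrm{H}\Gamma_1(2)=\left\{\begin{bmatrix}A&B\\C&D\end{bmatrix}\in\mathrm{H}\Gamma\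 \middle|\ C\equiv0,\ A\equiv\mathrm{I}_2\bmod 2\right\},$$ acting on $\mathbb{H}_2$ by $\tau\mapsto(A\tau+B)(C\tau+D)^{-1}$. Put $T\cdot\tau={}^t\tau$, $W\cdot\tau=-\frac12\tau^{-1}$ (the action of $\begin{bmatrix}0&-\mathrm{I}_2\\2\mathrm{I}_2&0\end{bmatrix}$), $[A]\cdot\tau=A\tau A^*$ with $A=\begin{bmatrix}0&1\\1&0\end{bmatrix}$, and $W'=T\cdot[A]\cdot W$. Then an element of $\mathrm{O}^+(M)$ lies in $\mathrm{O}^+_{Enr}(M)$ if and only if it acts trivially on the $2$-torsion of $\check M/M$. The groups $\mathrm{O}^+_{Enr}(M)/\{\pm1\}$ and $\mathrm{H}\Gamma_1(2)/\{\pm1\}$ act faithfully on $\mathbb{D}_M^+\cong\mathbb{H}_2$, $W'$ normalizes $\mathrm{H}\Gamma_1(2)/\{\pm1\}$, and, as automorphisms of $\mathbb{D}_M^+\cong\mathbb{H}_2$ (i.e. by isomorphisms compatible with the actions), one has $$\mathrm{SO}^+_{Enr}(M)/\{\pm1\}\cong\mathrm{H}\Gamma_1(2)/\{\pm1\},\qquad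 \mathrm{O}^+_{Enr}(M)/\{\pm1\}\cong\mathrm{H}\Gamma_1(2)/\{\pm1\}\rtimes\langle W'\rangle,$$ where $\langle W'\rangle$ acts on $\mathrm{H}\Gamma_1(2)/\{\pm1\}$ by conjugation. -/

import Mathlib

open scoped Matrix ComplexOrder LinearAlgebra.Projectivization

noncomputable section

namespace HessianK3

/-! ### Integral matrix groups modulo `±1` -/

/-- The subgroup `{1, -1}` of `GL_n(R)`. -/
def pmOne (n R : Type*) [Fintype n] [DecidableEq n] [CommRing R] : Subgroup (GL n R) where
  carrier := {1, -1}
  one_mem' := Or.inl rfl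
  mul_mem' := by
    rintro a b (rfl | rfl) (rfl | rfl) <;> simp
  inv_mem' := by
    rintro a (rfl | rfl) <;> simp

instance pmOne_normal (n R : Type*) [Fintype n] [DecidableEq n] [CommRing R] :
    (pmOne n R).Normal := by
  refine ⟨?_⟩
  rintro a (rfl | rfl) g
  · exact Or.inl (by simp)
  · exact Or.inr (by simp)

/-- `G / {±1}` for a subgroup `G` of `GL_n(R)` (which contains `-1` in all cases of interest). -/
abbrev ModPm {n R : Type*} [Fintype n] [DecidableEq n] [CommRing R] (G : Subgroup (GL n R)) :
    Type _ :=
  G ⧸ (pmOne n R).subgroupOf G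

/-! ### The lattice `M = U ⊕ U(2) ⊕ A₂(2)` and its period domain -/

/-- The Gram matrix of `M = ℤ⁶ = U ⊕ U(2) ⊕ A₂(2)` (with `A₂` negative definite). -/
def Q : Matrix (Fin 6) (Fin 6) ℤ :=
  !![0, 1, 0, 0,  0,  0;
     1, 0, 0, 0,  0,  0;
     0, 0, 0, 2,  0,  0;
     0, 0, 2, 0,  0,  0;
     0, 0, 0, 0, -4,  2;
     0, 0, 0, 0,  2, -4]

/-- The bilinear form of `M`, extended to a commutative ring `R`. -/
def bil (R : Type*) [CommRing R] (x y : Fin 6 → R) : R :=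
  x ⬝ᵥ ((Q.map (Int.cast : ℤ → R)) *ᵥ y)

/-- The integral orthogonal group `O(M)`. -/
def OM : Subgroup (GL (Fin 6) ℤ) where
  carrier := {g | g.1ᵀ * Q * g.1 = Q}
  one_mem' := by simp
  mul_mem' := by
    intro a b ha hb
    change a.1ᵀ * Q * a.1 = Q at ha
    change b.1ᵀ * Q * b.1 = Q at hb
    change (a * b).1ᵀ * Q * (a * b).1 = Q
    calc (a * b).1ᵀ * Q * (a * b).1 = b.1ᵀ * (a.1ᵀ * Q * a.1) * b.1 := by
          simp only [Units.val_mul, Matrix.transpose_mul, Matrix.mul_assoc]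
      _ = Q := by rw [ha, hb]
  inv_mem' := by
    intro a ha
    change a.1ᵀ * Q * a.1 = Q at ha
    change (a⁻¹).1ᵀ * Q * (a⁻¹).1 = Q
    have h1 : a.1 * (a⁻¹).1 = 1 := by rw [← Units.val_mul]; simp
    have h2 : (a⁻¹).1ᵀ * a.1ᵀ = 1 := by rw [← Matrix.transpose_mul, h1]; simp
    calc (a⁻¹).1ᵀ * Q * (a⁻¹).1 = (a⁻¹).1ᵀ * (a.1ᵀ * Q * a.1) * (a⁻¹).1 := by rw [ha]
      _ = ((a⁻¹).1ᵀ * a.1ᵀ) * Q * (a.1 * (a⁻¹).1) := by simp only [Matrix.mul_assoc]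
      _ = Q := by rw [h1, h2]; simp

/-- The projective space `ℙ(M ⊗ ℂ)`. -/
abbrev PM : Type := ℙ ℂ (Fin 6 → ℂ)

/-- The action of `GL_6(ℤ)` on `ℙ(M ⊗ ℂ)`. -/
def projAct : GL (Fin 6) ℤ →* Equiv.Perm PM :=
  (MulAction.toPermHom (LinearMap.GeneralLinearGroup ℂ (Fin 6 → ℂ)) PM).comp
    ((Matrix.GeneralLinearGroup.toLin (n := Fin 6) (R := ℂ)).toMonoidHom.comp
      (Matrix.GeneralLinearGroup.map (Int.castRingHom ℂ)))

/-- The domain `𝔻_M = {z | ᵗz Q z = 0, ᵗz Q z̄ > 0} / ℂˣ`. The number `ᵗz Q z̄` is real, and the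
conditions do not depend on the representative. -/
def DM : Set PM :=
  {p | bil ℂ p.rep p.rep = 0 ∧ 0 < (bil ℂ p.rep (star p.rep)).re}

/-- The normalized coordinates `z_i / z_1` of a point of `ℙ(M ⊗ ℂ)`. -/
def coord (p : PM) (i : Fin 6) : ℂ := p.rep i / p.rep 0

/-- The component `𝔻_M⁺` of `𝔻_M`, where `Im z₃ > 0` for `z = [1 : z₂ : ⋯ : z₆]`. -/
def DMPlus : Set PM := {p | p ∈ DM ∧ 0 < (coord p 2).im}

/-- The group `O⁺(M)` of the isometries of `M` that map `𝔻_M⁺` onto itself. -/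
def OPlus : Subgroup (GL (Fin 6) ℤ) where
  carrier := {g | g ∈ OM ∧ projAct g '' DMPlus = DMPlus}
  one_mem' := ⟨one_mem _, by simp⟩
  mul_mem' := by
    rintro a b ⟨ha, ha'⟩ ⟨hb, hb'⟩
    refine ⟨mul_mem ha hb, ?_⟩
    rw [map_mul, Equiv.Perm.coe_mul, Set.image_comp, hb', ha']
  inv_mem' := by
    rintro a ⟨ha, ha'⟩
    refine ⟨inv_mem ha, ?_⟩
    rw [map_inv]
    conv_lhs => rw [← ha']
    rw [← Set.image_comp, ← Equiv.Perm.coe_mul]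
    simp

theorem projAct_mem_iff (g : OPlus) (p : PM) : projAct g.1 p ∈ DMPlus ↔ p ∈ DMPlus := by
  conv_lhs => rw [← g.2.2]
  exact (projAct g.1).injective.mem_set_image

/-- The action of `O⁺(M)` on `𝔻_M⁺`. -/
def actDPlus : OPlus →* Equiv.Perm DMPlus where
  toFun g := (projAct g.1).subtypePerm (projAct_mem_iff g)
  map_one' := by ext; simp
  map_mul' a b := by
    ext p : 2
    change projAct (a.1 * b.1) p.1 = projAct a.1 (projAct b.1 p.1)
    rw [map_mul, Equiv.Perm.mul_apply]

/-! ### The discriminant form -/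

/-- The lattice `M` inside `M ⊗ ℚ`. -/
def latM : Submodule ℤ (Fin 6 → ℚ) where
  carrier := {x | ∃ m : Fin 6 → ℤ, x = fun i => (m i : ℚ)}
  zero_mem' := ⟨0, by ext; simp⟩
  add_mem' := by
    rintro _ _ ⟨a, rfl⟩ ⟨b, rfl⟩
    exact ⟨a + b, by ext; simp⟩
  smul_mem' := by
    rintro c _ ⟨a, rfl⟩
    exact ⟨c • a, by ext; simp⟩

/-- The dual lattice of `M` inside `M ⊗ ℚ`. -/
def dualM : Submodule ℤ (Fin 6 → ℚ) where
  carrier := {x | ∀ y ∈ latM, ∃ k : ℤ, bil ℚ x y = k}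
  zero_mem' := fun y _ => ⟨0, by simp [bil]⟩
  add_mem' := by
    intro a b ha hb y hy
    obtain ⟨k, hk⟩ := ha y hy
    obtain ⟨l, hl⟩ := hb y hy
    exact ⟨k + l, by simp only [bil, add_dotProduct] at *; rw [hk, hl]; push_cast; rfl⟩
  smul_mem' := by
    intro c a ha y hy
    obtain ⟨k, hk⟩ := ha y hy
    exact ⟨c * k, by simp only [bil, smul_dotProduct] at *; rw [hk]; simp⟩

/-- The discriminant group `M^∨ / M`. -/
abbrev Discr : Type := dualM ⧸ latM.comap dualM.subtype

theorem bil_comm (x y : Fin 6 → ℚ) : bil ℚ x y = bil ℚ y x := by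
  simp [bil, Q, Matrix.mulVec, dotProduct, Fin.sum_univ_succ]
  ring

theorem bil_add_left (x y z : Fin 6 → ℚ) : bil ℚ (x + y) z = bil ℚ x z + bil ℚ y z := by
  simp [bil, add_dotProduct]

theorem bil_add_right (x y z : Fin 6 → ℚ) : bil ℚ x (y + z) = bil ℚ x y + bil ℚ x z := by
  simp [bil, Matrix.mulVec_add, dotProduct_add]

theorem bil_self_even {x : Fin 6 → ℚ} (hx : x ∈ latM) : ∃ k : ℤ, bil ℚ x x = 2 * k := by
  obtain ⟨m, rfl⟩ := hx
  refine ⟨m 0 * m 1 + 2 * m 2 * m 3 - 2 * m 4 ^ 2 + 2 * m 4 * m 5 - 2 * m 5 ^ 2, ?_⟩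
  simp [bil, Q, Matrix.mulVec, dotProduct, Fin.sum_univ_succ]
  ring

/-- The discriminant form `q_M : M^∨ / M → ℚ / 2ℤ`, `x ↦ ᵗx Q x`. -/
def qM : Discr → ℚ ⧸ AddSubgroup.zmultiples (2 : ℚ) :=
  Quotient.lift (fun x : dualM => ((bil ℚ x.1 x.1 : ℚ) : ℚ ⧸ AddSubgroup.zmultiples (2 : ℚ))) <| by
    intro a b hab
    have h : -a + b ∈ latM.comap dualM.subtype := QuotientAddGroup.leftRel_apply.mp hab
    have h' : -a.1 + b.1 ∈ latM := h
    obtain ⟨k, hk⟩ := bil_self_even h'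
    obtain ⟨l, hl⟩ := a.2 _ h'
    have hb : b.1 = a.1 + (-a.1 + b.1) := by abel
    refine (QuotientAddGroup.eq).2 ?_
    refine AddSubgroup.mem_zmultiples_iff.2 ⟨l + k, ?_⟩
    have : bil ℚ b.1 b.1 = bil ℚ a.1 a.1 + 2 * l + 2 * k := by
      generalize -a.1 + b.1 = c at *
      rw [hb, bil_add_left, bil_add_right, bil_add_right, bil_comm c a.1, hl, hk]
      ring
    rw [this]
    simp
    ring

/-- The linear action of `g ∈ GL_6(ℤ)` on `M ⊗ ℚ`. -/
def linQ (g : GL (Fin 6) ℤ) : (Fin 6 → ℚ) →ₗ[ℤ] (Fin 6 → ℚ) :=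
  (Matrix.mulVecLin (g.1.map (Int.cast : ℤ → ℚ))).restrictScalars ℤ

theorem linQ_one : linQ 1 = LinearMap.id := by
  ext1 x
  simp [linQ]

theorem linQ_mul (g h : GL (Fin 6) ℤ) : linQ (g * h) = linQ g ∘ₗ linQ h := by
  apply LinearMap.ext
  intro x
  have : (g.1 * h.1).map (Int.cast : ℤ → ℚ)
      = g.1.map (Int.cast : ℤ → ℚ) * h.1.map (Int.cast : ℤ → ℚ) :=
    Matrix.map_mul (f := Int.castRingHom ℚ)
  simp [linQ, this]

theorem linQ_latM (g : GL (Fin 6) ℤ) {x : Fin 6 → ℚ} (hx : x ∈ latM) : linQ g x ∈ latM := by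
  obtain ⟨m, rfl⟩ := hx
  refine ⟨g.1 *ᵥ m, ?_⟩
  ext i
  simp [linQ, Matrix.mulVec, dotProduct]

theorem bil_linQ (g : OM) (x y : Fin 6 → ℚ) : bil ℚ (linQ g.1 x) (linQ g.1 y) = bil ℚ x y := by
  have h : (g.1.1.map (Int.cast : ℤ → ℚ))ᵀ * Q.map (Int.cast : ℤ → ℚ)
      * g.1.1.map (Int.cast : ℤ → ℚ) = Q.map (Int.cast : ℤ → ℚ) := by
    have h1 : g.1.1ᵀ * Q * g.1.1 = Q := g.2
    have h2 := congrArg (fun A : Matrix (Fin 6) (Fin 6) ℤ => A.map (Int.castRingHom ℚ)) h1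
    simp only [Matrix.map_mul] at h2
    exact h2
  conv_rhs => rw [bil, ← h]
  simp only [bil, linQ, LinearMap.restrictScalars_apply, Matrix.mulVecLin_apply]
  rw [← Matrix.vecMul_transpose, ← Matrix.dotProduct_mulVec, Matrix.mulVec_mulVec,
    Matrix.mulVec_mulVec]

theorem linQ_dualM (g : OM) {x : Fin 6 → ℚ} (hx : x ∈ dualM) : linQ g.1 x ∈ dualM := by
  intro y hy
  obtain ⟨k, hk⟩ := hx _ (linQ_latM g.1⁻¹ hy)
  refine ⟨k, ?_⟩
  rw [← hk, ← bil_linQ g x]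
  have : linQ g.1 (linQ g.1⁻¹ y) = y := by
    rw [← LinearMap.comp_apply, ← linQ_mul, mul_inv_cancel, linQ_one]
    rfl
  rw [this]

/-- The endomorphism of `M^∨ / M` induced by `g ∈ O(M)`. -/
def discrEnd (g : OM) : Module.End ℤ Discr :=
  Submodule.mapQ _ _ ((linQ g.1).restrict fun _ hx => linQ_dualM g hx)
    (fun _ hx => linQ_latM g.1 hx)

/-- The homomorphism `O(M) → Aut(M^∨ / M)`. -/
def discrAct : OM →* LinearMap.GeneralLinearGroup ℤ Discr :=
  MonoidHom.toHomUnits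
    { toFun := discrEnd
      map_one' := by
        apply LinearMap.ext
        intro x
        induction x using Submodule.Quotient.induction_on with
        | H x =>
          refine congrArg (Submodule.Quotient.mk (p := latM.comap dualM.subtype))
            (Subtype.ext ?_ : (⟨linQ 1 x.1, linQ_dualM 1 x.2⟩ : dualM) = x)
          simp [linQ_one]
      map_mul' := by
        intro g h
        apply LinearMap.ext
        intro x
        induction x using Submodule.Quotient.induction_on with
        | H x =>
          refine congrArg (Submodule.Quotient.mk (p := latM.comap dualM.subtype))
            (Subtype.ext ?_ : (⟨linQ (g * h).1 x.1, linQ_dualM (g * h) x.2⟩ : dualM)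
              = ⟨linQ g.1 (linQ h.1 x.1), linQ_dualM g (linQ_dualM h x.2)⟩)
          simp [linQ_mul] }

/-- The orthogonal group `O(q_M)` of the discriminant form. -/
def OqM : Subgroup (LinearMap.GeneralLinearGroup ℤ Discr) where
  carrier := {f | ∀ x, qM (f.1 x) = qM x}
  one_mem' := fun x => rfl
  mul_mem' := by
    intro a b ha hb x
    exact (ha (b.1 x)).trans (hb x)
  inv_mem' := by
    intro a ha x
    have h := ha ((a⁻¹).1 x)
    have h2 : a.1 ((a⁻¹).1 x) = x := by
      rw [← Module.End.mul_apply, ← Units.val_mul]; simp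
    rw [h2] at h
    exact h.symm

theorem discrAct_mem (g : OM) : discrAct g ∈ OqM := by
  intro x
  induction x using Submodule.Quotient.induction_on with
  | H x =>
    exact congrArg (QuotientAddGroup.mk (s := AddSubgroup.zmultiples (2 : ℚ)))
      (bil_linQ g x.1 x.1)

/-- The natural homomorphism `O⁺(M) → O(q_M)`. -/
def discrPlus : OPlus →* OqM :=
  (discrAct.codRestrict OqM discrAct_mem).comp (Subgroup.inclusion fun _ hg => hg.1)

/-- The elements `v` of order `2` of `M^∨ / M` with `q_M(v) = 0`. -/
def isoTwo : Set Discr := {v | v ≠ 0 ∧ (2 : ℤ) • v = 0 ∧ qM v = 0}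

theorem isoTwo_stable (f : OqM) (v : Discr) (hv : v ∈ isoTwo) : f.1.1 v ∈ isoTwo := by
  obtain ⟨h0, h2, hq⟩ := hv
  refine ⟨?_, ?_, ?_⟩
  · intro h
    apply h0
    have : (f.1⁻¹).1 (f.1.1 v) = v := by
      rw [← Module.End.mul_apply, ← Units.val_mul]; simp
    rw [← this, h, map_zero]
  · rw [← map_smul, h2, map_zero]
  · rw [f.2, hq]

/-- The homomorphism from `O(q_M)` to the symmetric group of the set of the elements `v` of order
`2` with `q_M(v) = 0`. -/
def permTwo : OqM →* Equiv.Perm isoTwo :=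
  MonoidHom.toHomPerm
    { toFun := fun f v => ⟨f.1.1 v.1, isoTwo_stable f v.1 v.2⟩
      map_one' := rfl
      map_mul' := fun _ _ => rfl }

/-- The homomorphism `O⁺(M) → O(q_M) → S₅`, where `S₅` is the symmetric group of the set of the
elements `v` of order `2` of `M^∨ / M` with `q_M(v) = 0`. -/
def toS5 : OPlus →* Equiv.Perm isoTwo := permTwo.comp discrPlus

/-- The group `O⁺_Enr(M)`, the kernel of `O⁺(M) → S₅`. -/
def OEnr : Subgroup (GL (Fin 6) ℤ) := toS5.ker.map OPlus.subtype

/-- The group `SO⁺_Enr(M) = O⁺_Enr(M) ∩ SL_6(ℤ)`. -/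
def SOEnr : Subgroup (GL (Fin 6) ℤ) := OEnr ⊓ (Matrix.GeneralLinearGroup.det).ker

theorem OEnr_le : OEnr ≤ OPlus := Subgroup.map_subtype_le _

theorem SOEnr_le : SOEnr ≤ OPlus := inf_le_left.trans OEnr_le

theorem projAct_neg_one : projAct (-1) = 1 := by
  ext p
  induction p using Projectivization.ind with
  | h v hv =>
    simp only [projAct, MonoidHom.comp_apply, MulAction.toPermHom_apply, MulAction.toPerm_apply,
      Equiv.Perm.one_apply]
    rw [Projectivization.smul_mk, Projectivization.mk_eq_mk_iff']
    refine ⟨-1, ?_⟩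
    have h : Matrix.GeneralLinearGroup.map (Int.castRingHom ℂ) (-1 : GL (Fin 6) ℤ) = -1 := by
      ext i j
      simp [Matrix.GeneralLinearGroup.map_apply, Matrix.one_apply, apply_ite]
    rw [h]
    change _ = (Matrix.mulVecLin (-1 : Matrix (Fin 6) (Fin 6) ℂ)) v
    simp

/-- The action of `G / {±1}` on `𝔻_M⁺` for a subgroup `G` of `O⁺(M)`. -/
def actDPlusModPm (G : Subgroup (GL (Fin 6) ℤ)) (hG : G ≤ OPlus) :
    ModPm G →* Equiv.Perm DMPlus :=
  QuotientGroup.lift _ (actDPlus.comp (Subgroup.inclusion hG)) <| by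
    rintro ⟨g, hg⟩ (h | h)
    · have : g = 1 := h
      subst this
      exact map_one _
    · have : g = -1 := h
      subst this
      ext p : 2
      exact congrArg (fun e : Equiv.Perm PM => e p.1) projAct_neg_one

/-! ### The Hermitian upper half space and the Hermitian modular group -/

/-- The cube root of unity `ω = exp(2πi/3)`. -/
def omega : ℂ := Complex.exp (2 * Real.pi * Complex.I / 3)

/-- The ring `ℤ[ω]` of Eisenstein integers. -/
abbrev Eis : Type := Algebra.adjoin ℤ ({omega} : Set ℂ)

/-- The Hermitian upper half space `ℍ₂` of degree `2`. Its elements are invertible matrices. -/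
def H2 : Set (Matrix (Fin 2) (Fin 2) ℂ) :=
  {τ | ((1 / (2 * Complex.I)) • (τ - τᴴ)).PosDef}

/-- The matrix `J`. -/
def J : Matrix (Fin 2 ⊕ Fin 2) (Fin 2 ⊕ Fin 2) ℂ := Matrix.fromBlocks 0 1 (-1) 0

/-- The group of the matrices `g` with `g* J g = ν J` for some real `ν > 0`. -/
def GUPlus : Subgroup (GL (Fin 2 ⊕ Fin 2) ℂ) where
  carrier := {g | ∃ ν : ℝ, 0 < ν ∧ g.1ᴴ * J * g.1 = (ν : ℂ) • J}
  one_mem' := ⟨1, one_pos, by simp⟩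
  mul_mem' := by
    rintro a b ⟨ν, hν, ha⟩ ⟨ξ, hξ, hb⟩
    refine ⟨ν * ξ, mul_pos hν hξ, ?_⟩
    calc (a * b).1ᴴ * J * (a * b).1 = b.1ᴴ * (a.1ᴴ * J * a.1) * b.1 := by
          simp only [Units.val_mul, Matrix.conjTranspose_mul, Matrix.mul_assoc]
      _ = _ := by
          rw [ha, Matrix.mul_smul, Matrix.smul_mul, hb, smul_smul]
          push_cast
          rfl
  inv_mem' := by
    rintro a ⟨ν, hν, ha⟩
    refine ⟨ν⁻¹, inv_pos.2 hν, ?_⟩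
    have h1 : a.1 * (a⁻¹).1 = 1 := by rw [← Units.val_mul]; simp
    have h2 : (a⁻¹).1ᴴ * a.1ᴴ = 1 := by rw [← Matrix.conjTranspose_mul, h1]; simp
    have hν' : (ν : ℂ) ≠ 0 := by exact_mod_cast hν.ne'
    have h3 : (ν : ℂ) • ((a⁻¹).1ᴴ * J * (a⁻¹).1) = J := by
      calc (ν : ℂ) • ((a⁻¹).1ᴴ * J * (a⁻¹).1) = (a⁻¹).1ᴴ * ((ν : ℂ) • J) * (a⁻¹).1 := by
            rw [Matrix.mul_smul, Matrix.smul_mul]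
        _ = (a⁻¹).1ᴴ * (a.1ᴴ * J * a.1) * (a⁻¹).1 := by rw [ha]
        _ = ((a⁻¹).1ᴴ * a.1ᴴ) * J * (a.1 * (a⁻¹).1) := by simp only [Matrix.mul_assoc]
        _ = J := by rw [h1, h2]; simp
    calc (a⁻¹).1ᴴ * J * (a⁻¹).1 = (ν : ℂ)⁻¹ • ((ν : ℂ) • ((a⁻¹).1ᴴ * J * (a⁻¹).1)) := by
          rw [smul_smul, inv_mul_cancel₀ hν', one_smul]
      _ = _ := by rw [h3, Complex.ofReal_inv]

/-- The numerator `A τ + B`. -/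
def num (g : Matrix (Fin 2 ⊕ Fin 2) (Fin 2 ⊕ Fin 2) ℂ) (τ : Matrix (Fin 2) (Fin 2) ℂ) :
    Matrix (Fin 2) (Fin 2) ℂ :=
  g.toBlocks₁₁ * τ + g.toBlocks₁₂

/-- The denominator `C τ + D`. -/
def den (g : Matrix (Fin 2 ⊕ Fin 2) (Fin 2 ⊕ Fin 2) ℂ) (τ : Matrix (Fin 2) (Fin 2) ℂ) :
    Matrix (Fin 2) (Fin 2) ℂ :=
  g.toBlocks₂₁ * τ + g.toBlocks₂₂

/-- The fractional linear transformation `τ ↦ (A τ + B) (C τ + D)⁻¹`. -/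
def mob (g : Matrix (Fin 2 ⊕ Fin 2) (Fin 2 ⊕ Fin 2) ℂ) (τ : Matrix (Fin 2) (Fin 2) ℂ) :
    Matrix (Fin 2) (Fin 2) ℂ :=
  num g τ * (den g τ)⁻¹

theorem mul_fromRows (g : Matrix (Fin 2 ⊕ Fin 2) (Fin 2 ⊕ Fin 2) ℂ)
    (τ : Matrix (Fin 2) (Fin 2) ℂ) :
    g * Matrix.fromRows τ (1 : Matrix (Fin 2) (Fin 2) ℂ) = Matrix.fromRows (num g τ) (den g τ) := by
  conv_lhs => rw [← Matrix.fromBlocks_toBlocks g]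
  rw [Matrix.fromBlocks_mul_fromRows]
  simp [num, den]

theorem fromRows_J (X Y : Matrix (Fin 2) (Fin 2) ℂ) :
    (Matrix.fromRows X Y)ᴴ * J * Matrix.fromRows X Y = Xᴴ * Y - Yᴴ * X := by
  rw [Matrix.conjTranspose_fromRows_eq_fromCols_conjTranspose, Matrix.mul_assoc, J,
    Matrix.fromBlocks_mul_fromRows, Matrix.fromCols_mul_fromRows]
  simp [sub_eq_add_neg]

theorem num_den (g : GUPlus) : ∃ ν : ℝ, 0 < ν ∧ ∀ τ : Matrix (Fin 2) (Fin 2) ℂ,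
    (den g.1.1 τ)ᴴ * num g.1.1 τ - (num g.1.1 τ)ᴴ * den g.1.1 τ = (ν : ℂ) • (τ - τᴴ) := by
  obtain ⟨ν, hν, hg⟩ := g.2
  refine ⟨ν, hν, fun τ => ?_⟩
  have h : (g.1.1 * Matrix.fromRows τ (1 : Matrix (Fin 2) (Fin 2) ℂ))ᴴ * J * (g.1.1 * Matrix.fromRows τ (1 : Matrix (Fin 2) (Fin 2) ℂ))
      = (ν : ℂ) • (τᴴ - τ) := by
    calc _ = (Matrix.fromRows τ (1 : Matrix (Fin 2) (Fin 2) ℂ))ᴴ * (g.1.1ᴴ * J * g.1.1) * Matrix.fromRows τ (1 : Matrix (Fin 2) (Fin 2) ℂ) := by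
          simp only [Matrix.conjTranspose_mul, Matrix.mul_assoc]
      _ = _ := by
          rw [hg, Matrix.mul_smul, Matrix.smul_mul, fromRows_J]
          simp
  rw [mul_fromRows, fromRows_J] at h
  rw [← neg_sub, h, ← smul_neg, neg_sub]

theorem den_isUnit (g : GUPlus) {τ : Matrix (Fin 2) (Fin 2) ℂ} (hτ : τ ∈ H2) :
    IsUnit (den g.1.1 τ) := by
  obtain ⟨ν, hν, h⟩ := num_den g
  rw [← Matrix.mulVec_injective_iff_isUnit]
  refine (injective_iff_map_eq_zero (Matrix.mulVecLin (den g.1.1 τ))).2 fun v hv => ?_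
  by_contra hne
  have hp := hτ.dotProduct_mulVec_pos hne
  have hv' : den g.1.1 τ *ᵥ v = 0 := hv
  have h0 : star v ⬝ᵥ (((ν : ℂ) • (τ - τᴴ)) *ᵥ v) = 0 := by
    rw [← h τ, Matrix.sub_mulVec, ← Matrix.mulVec_mulVec, ← Matrix.mulVec_mulVec, hv',
      Matrix.mulVec_zero, sub_zero, Matrix.dotProduct_mulVec, ← Matrix.star_mulVec, hv']
    simp
  have hν' : (ν : ℂ) ≠ 0 := by exact_mod_cast hν.ne'
  rw [Matrix.smul_mulVec, dotProduct_smul, smul_eq_mul, mul_eq_zero] at h0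
  rw [Matrix.smul_mulVec, dotProduct_smul, h0.resolve_left hν'] at hp
  simp at hp

theorem mob_mem (g : GUPlus) {τ : Matrix (Fin 2) (Fin 2) ℂ} (hτ : τ ∈ H2) :
    mob g.1.1 τ ∈ H2 := by
  obtain ⟨ν, hν, h⟩ := num_den g
  have hu := den_isUnit g hτ
  have hd : IsUnit (den g.1.1 τ).det := (Matrix.isUnit_iff_isUnit_det _).1 hu
  have hν' : (0 : ℂ) < ν := by exact_mod_cast hν
  have hi : IsUnit (den g.1.1 τ)⁻¹ := (Matrix.isUnit_nonsing_inv_iff).2 hu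
  have hp : ((ν : ℂ) • ((1 / (2 * Complex.I)) • (τ - τᴴ))).PosDef :=
    Matrix.PosDef.smul hτ hν'
  have := hp.conjTranspose_mul_mul_same (Matrix.mulVec_injective_of_isUnit hi)
  change ((1 / (2 * Complex.I)) • (mob g.1.1 τ - (mob g.1.1 τ)ᴴ)).PosDef
  convert this using 1
  rw [smul_comm, ← h τ, Matrix.mul_smul, Matrix.smul_mul]
  congr 1
  have e1 : den g.1.1 τ * (den g.1.1 τ)⁻¹ = 1 := Matrix.mul_nonsing_inv _ hd
  have e2 : (den g.1.1 τ)⁻¹ᴴ * (den g.1.1 τ)ᴴ = 1 := by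
    rw [← Matrix.conjTranspose_mul, e1, Matrix.conjTranspose_one]
  rw [Matrix.mul_sub, Matrix.sub_mul, ← Matrix.mul_assoc, e2, Matrix.one_mul,
    Matrix.mul_assoc, Matrix.mul_assoc, e1, Matrix.mul_one, mob, Matrix.conjTranspose_mul]

theorem mob_one (τ : Matrix (Fin 2) (Fin 2) ℂ) : mob 1 τ = τ := by
  have h := Matrix.fromBlocks_one (l := Fin 2) (m := Fin 2) (α := ℂ)
  rw [← h]
  simp only [mob, num, den, Matrix.toBlocks_fromBlocks₁₁, Matrix.toBlocks_fromBlocks₁₂,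
    Matrix.toBlocks_fromBlocks₂₁, Matrix.toBlocks_fromBlocks₂₂]
  simp

theorem mob_neg (g : Matrix (Fin 2 ⊕ Fin 2) (Fin 2 ⊕ Fin 2) ℂ) (τ : Matrix (Fin 2) (Fin 2) ℂ) :
    mob (-g) τ = mob g τ := by
  have h1 : num (-g) τ = -num g τ := by
    rw [num, num, neg_add, ← Matrix.neg_mul]
    rfl
  have h2 : den (-g) τ = -den g τ := by
    rw [den, den, neg_add, ← Matrix.neg_mul]
    rfl
  have h3 : (-den g τ)⁻¹ = -(den g τ)⁻¹ := by
    rw [Matrix.inv_def, Matrix.inv_def, Matrix.adjugate_fin_two, Matrix.adjugate_fin_two]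
    have : (-den g τ).det = (den g τ).det := by simp [Matrix.det_neg]
    rw [this]
    ext i j
    fin_cases i <;> fin_cases j <;> simp
  rw [mob, h1, h2, h3, neg_mul_neg, mob]

theorem mob_mul (g h : GUPlus) {τ : Matrix (Fin 2) (Fin 2) ℂ} (hτ : τ ∈ H2) :
    mob (g * h).1.1 τ = mob g.1.1 (mob h.1.1 τ) := by
  have hd : IsUnit (den h.1.1 τ).det := (Matrix.isUnit_iff_isUnit_det _).1 (den_isUnit h hτ)
  have e1 : (den h.1.1 τ)⁻¹ * den h.1.1 τ = 1 := Matrix.nonsing_inv_mul _ hd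
  have key : Matrix.fromRows (num (g * h).1.1 τ) (den (g * h).1.1 τ)
      = Matrix.fromRows (num g.1.1 (mob h.1.1 τ) * den h.1.1 τ)
        (den g.1.1 (mob h.1.1 τ) * den h.1.1 τ) := by
    have e2 : Matrix.fromRows (num h.1.1 τ) (den h.1.1 τ)
        = Matrix.fromRows (mob h.1.1 τ) (1 : Matrix (Fin 2) (Fin 2) ℂ) * den h.1.1 τ := by
      rw [Matrix.fromRows_mul, mob, Matrix.mul_assoc, e1, Matrix.mul_one, Matrix.one_mul]
    rw [← mul_fromRows]
    rw [Subgroup.coe_mul, Units.val_mul]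
    rw [Matrix.mul_assoc, mul_fromRows, e2, ← Matrix.mul_assoc, mul_fromRows,
      Matrix.fromRows_mul]
  obtain ⟨k1, k2⟩ := Matrix.fromRows_inj key
  rw [mob, k1, k2, Matrix.mul_inv_rev, Matrix.mul_assoc, ← Matrix.mul_assoc (den h.1.1 τ),
    Matrix.mul_nonsing_inv _ hd, Matrix.one_mul]
  rfl

/-- The action of `GUPlus` on `ℍ₂` by `τ ↦ (A τ + B) (C τ + D)⁻¹`. -/
instance : MulAction GUPlus H2 where
  smul g τ := ⟨mob g.1.1 τ.1, mob_mem g τ.2⟩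
  one_smul τ := Subtype.ext (mob_one τ.1)
  mul_smul g h τ := Subtype.ext (mob_mul g h τ.2)

/-- The embedding `GL_4(ℤ[ω]) → GL_4(ℂ)`. -/
def toGLC : GL (Fin 2 ⊕ Fin 2) Eis →* GL (Fin 2 ⊕ Fin 2) ℂ :=
  Matrix.GeneralLinearGroup.map (algebraMap Eis ℂ)

/-- The Hermitian modular group `HΓ = {g ∈ GL_4(ℤ[ω]) | g* J g = J}`. -/
def HGamma : Subgroup (GL (Fin 2 ⊕ Fin 2) Eis) where
  carrier := {g | (toGLC g).1ᴴ * J * (toGLC g).1 = J}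
  one_mem' := by simp
  mul_mem' := by
    intro a b ha hb
    change (toGLC a).1ᴴ * J * (toGLC a).1 = J at ha
    change (toGLC b).1ᴴ * J * (toGLC b).1 = J at hb
    change (toGLC (a * b)).1ᴴ * J * (toGLC (a * b)).1 = J
    rw [map_mul]
    calc _ = (toGLC b).1ᴴ * ((toGLC a).1ᴴ * J * (toGLC a).1) * (toGLC b).1 := by
          simp only [Units.val_mul, Matrix.conjTranspose_mul, Matrix.mul_assoc]
      _ = J := by rw [ha, hb]
  inv_mem' := by
    intro a ha
    change (toGLC a).1ᴴ * J * (toGLC a).1 = J at ha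
    change (toGLC a⁻¹).1ᴴ * J * (toGLC a⁻¹).1 = J
    have h1 : (toGLC a).1 * (toGLC a⁻¹).1 = 1 := by rw [← Units.val_mul, ← map_mul]; simp
    have h2 : (toGLC a⁻¹).1ᴴ * (toGLC a).1ᴴ = 1 := by rw [← Matrix.conjTranspose_mul, h1]; simp
    calc _ = (toGLC a⁻¹).1ᴴ * ((toGLC a).1ᴴ * J * (toGLC a).1) * (toGLC a⁻¹).1 := by rw [ha]
      _ = ((toGLC a⁻¹).1ᴴ * (toGLC a).1ᴴ) * J * ((toGLC a).1 * (toGLC a⁻¹).1) := by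
          simp only [Matrix.mul_assoc]
      _ = J := by rw [h1, h2]; simp

/-- Reduction modulo `2`. -/
abbrev modTwo : Eis →+* Eis ⧸ Ideal.span ({2} : Set Eis) := Ideal.Quotient.mk _

section blocks

variable {R : Type*} [CommRing R] (a b : Matrix (Fin 2 ⊕ Fin 2) (Fin 2 ⊕ Fin 2) R)

theorem toBlocks₁₁_mul : (a * b).toBlocks₁₁
    = a.toBlocks₁₁ * b.toBlocks₁₁ + a.toBlocks₁₂ * b.toBlocks₂₁ := by
  conv_lhs => rw [← Matrix.fromBlocks_toBlocks a, ← Matrix.fromBlocks_toBlocks b,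
    Matrix.fromBlocks_multiply, Matrix.toBlocks_fromBlocks₁₁]

theorem toBlocks₂₁_mul : (a * b).toBlocks₂₁
    = a.toBlocks₂₁ * b.toBlocks₁₁ + a.toBlocks₂₂ * b.toBlocks₂₁ := by
  conv_lhs => rw [← Matrix.fromBlocks_toBlocks a, ← Matrix.fromBlocks_toBlocks b,
    Matrix.fromBlocks_multiply, Matrix.toBlocks_fromBlocks₂₁]

theorem toBlocks₁₁_one :
    (1 : Matrix (Fin 2 ⊕ Fin 2) (Fin 2 ⊕ Fin 2) R).toBlocks₁₁ = 1 := by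
  rw [← Matrix.fromBlocks_one, Matrix.toBlocks_fromBlocks₁₁]

theorem toBlocks₂₁_one :
    (1 : Matrix (Fin 2 ⊕ Fin 2) (Fin 2 ⊕ Fin 2) R).toBlocks₂₁ = 0 := by
  rw [← Matrix.fromBlocks_one, Matrix.toBlocks_fromBlocks₂₁]

end blocks

theorem modTwo_inv (a : GL (Fin 2 ⊕ Fin 2) Eis) (ha : a.1.toBlocks₂₁.map modTwo = 0) :
    (a⁻¹).1.toBlocks₁₁.map modTwo * a.1.toBlocks₁₁.map modTwo = 1 ∧
      (a⁻¹).1.toBlocks₂₁.map modTwo = 0 := by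
  have h : (a⁻¹).1 * a.1 = 1 := Units.inv_mul a
  have e1 := congrArg (fun M => M.toBlocks₁₁.map modTwo) h
  have e2 := congrArg (fun M => M.toBlocks₂₁.map modTwo) h
  simp only [toBlocks₁₁_mul, toBlocks₂₁_mul, toBlocks₁₁_one, toBlocks₂₁_one,
    Matrix.map_add _ (map_add modTwo), Matrix.map_mul, ha, mul_zero, add_zero] at e1 e2
  have e3 : (a⁻¹).1.toBlocks₁₁.map modTwo * a.1.toBlocks₁₁.map modTwo = 1 := by
    rw [e1]
    simp
  refine ⟨e3, ?_⟩
  have e4 := mul_eq_one_comm.1 e3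
  calc (a⁻¹).1.toBlocks₂₁.map modTwo = (a⁻¹).1.toBlocks₂₁.map modTwo *
        (a.1.toBlocks₁₁.map modTwo * (a⁻¹).1.toBlocks₁₁.map modTwo) := by rw [e4, mul_one]
    _ = 0 := by
      rw [← mul_assoc, e2]
      simp

/-- The congruence subgroup `HΓ₀(2)` of the elements of `HΓ` with `C ≡ 0 mod 2`. -/
def HGamma0 : Subgroup (GL (Fin 2 ⊕ Fin 2) Eis) where
  carrier := {g | g ∈ HGamma ∧ g.1.toBlocks₂₁.map modTwo = 0}
  one_mem' := ⟨one_mem _, by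
    rw [Units.val_one, toBlocks₂₁_one]
    simp⟩
  mul_mem' := by
    rintro a b ⟨ha, ha'⟩ ⟨hb, hb'⟩
    refine ⟨mul_mem ha hb, ?_⟩
    rw [Units.val_mul, toBlocks₂₁_mul, Matrix.map_add _ (map_add _), Matrix.map_mul,
      Matrix.map_mul, ha', hb']
    simp
  inv_mem' := by
    rintro a ⟨ha, ha'⟩
    exact ⟨inv_mem ha, (modTwo_inv a ha').2⟩

/-- The congruence subgroup `HΓ₁(2)` of the elements of `HΓ₀(2)` with `A ≡ 1 mod 2`. -/
def HGamma1 : Subgroup (GL (Fin 2 ⊕ Fin 2) Eis) where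
  carrier := {g | g ∈ HGamma0 ∧ g.1.toBlocks₁₁.map modTwo = 1}
  one_mem' := ⟨one_mem _, by
    rw [Units.val_one, toBlocks₁₁_one]
    simp⟩
  mul_mem' := by
    rintro a b ⟨ha, ha'⟩ ⟨hb, hb'⟩
    refine ⟨mul_mem ha hb, ?_⟩
    rw [Units.val_mul, toBlocks₁₁_mul, Matrix.map_add _ (map_add _), Matrix.map_mul,
      Matrix.map_mul, ha', hb', hb.2]
    simp
  inv_mem' := by
    rintro a ⟨ha, ha'⟩
    refine ⟨inv_mem ha, ?_⟩
    have h := (modTwo_inv a ha.2).1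
    rwa [ha', mul_one] at h

theorem toGLC_mem (g : HGamma1) : toGLC g.1 ∈ GUPlus :=
  ⟨1, one_pos, by
    have h : (toGLC g.1).1ᴴ * J * (toGLC g.1).1 = J := g.2.1.1
    rw [h, Complex.ofReal_one, one_smul]⟩

/-- The action of `HΓ₁(2)` on `ℍ₂`. -/
def actHGamma1 : HGamma1 →* Equiv.Perm H2 :=
  (MulAction.toPermHom GUPlus H2).comp
    ((toGLC.comp HGamma1.subtype).codRestrict GUPlus toGLC_mem)

/-- The action of `HΓ₁(2) / {±1}` on `ℍ₂`. -/
def actHGamma1ModPm : ModPm HGamma1 →* Equiv.Perm H2 :=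
  QuotientGroup.lift _ actHGamma1 <| by
    rintro ⟨g, hg⟩ (h | h)
    · have : g = 1 := h
      subst this
      exact map_one _
    · have : g = -1 := h
      subst this
      ext τ : 2
      change mob (toGLC (-1)).1 τ.1 = τ.1
      have e : (toGLC (-1)).1 = -1 := by
        ext i j
        simp [toGLC, Matrix.GeneralLinearGroup.map_apply, Matrix.one_apply, apply_ite]
      rw [e, mob_neg, mob_one]

/-! ### The involutions `T`, `W` and `W'` of `ℍ₂` -/

theorem transpose_mem {τ : Matrix (Fin 2) (Fin 2) ℂ} (hτ : τ ∈ H2) : τᵀ ∈ H2 :=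
  Matrix.PosDef.transpose hτ

/-- The involution `T : τ ↦ ᵗτ`. -/
def T : Equiv.Perm H2 where
  toFun τ := ⟨τ.1ᵀ, transpose_mem τ.2⟩
  invFun τ := ⟨τ.1ᵀ, transpose_mem τ.2⟩
  left_inv _ := rfl
  right_inv _ := rfl

/-- The matrix `W = [0, -1; 2, 0]`, as an element of `GUPlus`. -/
def W : GUPlus :=
  ⟨⟨Matrix.fromBlocks 0 (-1) ((2 : ℂ) • 1) 0, Matrix.fromBlocks 0 ((2 : ℂ)⁻¹ • 1) (-1) 0,
    by simp [Matrix.fromBlocks_multiply], by simp [Matrix.fromBlocks_multiply]⟩,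
    2, two_pos, by
      simp [J, Matrix.fromBlocks_multiply, Matrix.fromBlocks_conjTranspose,
        Matrix.fromBlocks_smul]⟩

/-- The matrix `g(A) = [A, 0; 0, (A*)⁻¹]` for `A ∈ GL_2(ℂ)`, as an element of `GUPlus`. -/
def gA (A : GL (Fin 2) ℂ) : GUPlus :=
  ⟨⟨Matrix.fromBlocks A.1 0 0 (A⁻¹).1ᴴ, Matrix.fromBlocks (A⁻¹).1 0 0 A.1ᴴ,
    by
      rw [Matrix.fromBlocks_multiply, ← Matrix.conjTranspose_mul, Units.mul_inv]
      simp,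
    by
      rw [Matrix.fromBlocks_multiply, ← Matrix.conjTranspose_mul, Units.inv_mul]
      simp⟩,
    1, one_pos, by
      have h1 : (A.1)ᴴ * (A⁻¹).1ᴴ = 1 := by
        rw [← Matrix.conjTranspose_mul, Units.inv_mul, Matrix.conjTranspose_one]
      have h2 : (A⁻¹).1 * A.1 = 1 := Units.inv_mul _
      simp only [J, Matrix.fromBlocks_conjTranspose, Matrix.fromBlocks_multiply]
      simp only [Matrix.conjTranspose_conjTranspose, Matrix.conjTranspose_zero, mul_zero,
        zero_mul, add_zero, zero_add, mul_one, mul_neg, neg_mul, h1, h2, Complex.ofReal_one,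
        one_smul, neg_zero]⟩

/-- The swap matrix `A = [0, 1; 1, 0]`. -/
def swapA : GL (Fin 2) ℂ :=
  ⟨!![0, 1; 1, 0], !![0, 1; 1, 0], by simp [Matrix.one_fin_two], by simp [Matrix.one_fin_two]⟩

/-- The automorphism `W' = T · [A] · W` of `ℍ₂`, where `A` is the swap matrix. -/
def W' : Equiv.Perm H2 :=
  T * MulAction.toPerm (gA swapA) * MulAction.toPerm W

/-! ### The isomorphism `Ψ : 𝔻_M⁺ → ℍ₂` -/

theorem omega_eq : omega = ⟨-1 / 2, √3 / 2⟩ := by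
  have h : (2 * Real.pi * Complex.I / 3 : ℂ) = ((Real.pi - Real.pi / 3 : ℝ) : ℂ) * Complex.I := by
    push_cast
    ring
  rw [omega, h, Complex.exp_mul_I, ← Complex.ofReal_cos, ← Complex.ofReal_sin, Real.cos_pi_sub,
    Real.sin_pi_sub, Real.cos_pi_div_three, Real.sin_pi_div_three]
  apply Complex.ext
  · simp
    norm_num
  · simp

theorem omega_sq : omega ^ 2 = -1 - omega := by
  rw [omega_eq]
  have h : √3 * √3 = 3 := Real.mul_self_sqrt (by norm_num)
  apply Complex.ext
  · simp [sq]
    nlinarith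
  · simp [sq]
    ring

theorem star_omega : star omega = -1 - omega := by
  rw [omega_eq]
  apply Complex.ext
  · simp
    norm_num
  · simp

theorem two_omega_ne : 2 * omega + 1 ≠ 0 := by
  intro h
  have := congrArg Complex.im h
  rw [omega_eq] at this
  simp at this

/-- A Hermitian `2 × 2` matrix is positive definite iff its leading minors are positive. -/
theorem posDef_two_iff (r s : ℝ) (w : ℂ) :
    (!![(r : ℂ), w; star w, (s : ℂ)]).PosDef ↔ 0 < r ∧ w.re ^ 2 + w.im ^ 2 < r * s := by
  constructor
  · intro h
    have h0 := h.diag_pos (i := 0)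
    have h1 := h.det_pos
    simp only [Matrix.of_apply, Matrix.cons_val', Matrix.cons_val_zero] at h0
    rw [Matrix.det_fin_two_of] at h1
    refine ⟨by simpa using h0, ?_⟩
    have := (Complex.lt_def.1 h1).1
    simp at this
    nlinarith
  · rintro ⟨hr, hs⟩
    refine Matrix.PosDef.of_dotProduct_mulVec_pos ?_ ?_
    · ext i j
      fin_cases i <;> fin_cases j <;> simp
    · intro v hv
      have key : star v ⬝ᵥ ((!![(r : ℂ), w; star w, (s : ℂ)]) *ᵥ v)
          = ((r * ((v 0).re ^ 2 + (v 0).im ^ 2) + s * ((v 1).re ^ 2 + (v 1).im ^ 2)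
            + 2 * ((v 0).re * (w.re * (v 1).re - w.im * (v 1).im)
              + (v 0).im * (w.re * (v 1).im + w.im * (v 1).re)) : ℝ) : ℂ) := by
        apply Complex.ext
        · rw [Complex.ofReal_re]
          simp [Matrix.mulVec, dotProduct, Fin.sum_univ_two]
          ring
        · rw [Complex.ofReal_im]
          simp [Matrix.mulVec, dotProduct, Fin.sum_univ_two]
          ring
      rw [key]
      have hq : 0 < r * (r * ((v 0).re ^ 2 + (v 0).im ^ 2) + s * ((v 1).re ^ 2 + (v 1).im ^ 2)
            + 2 * ((v 0).re * (w.re * (v 1).re - w.im * (v 1).im)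
              + (v 0).im * (w.re * (v 1).im + w.im * (v 1).re))) := by
        have e : r * (r * ((v 0).re ^ 2 + (v 0).im ^ 2) + s * ((v 1).re ^ 2 + (v 1).im ^ 2)
            + 2 * ((v 0).re * (w.re * (v 1).re - w.im * (v 1).im)
              + (v 0).im * (w.re * (v 1).im + w.im * (v 1).re)))
            = (r * (v 0).re + (w.re * (v 1).re - w.im * (v 1).im)) ^ 2
              + (r * (v 0).im + (w.re * (v 1).im + w.im * (v 1).re)) ^ 2
              + (r * s - (w.re ^ 2 + w.im ^ 2)) * ((v 1).re ^ 2 + (v 1).im ^ 2) := by ring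
        rw [e]
        by_cases h1 : v 1 = 0
        · have h0 : v 0 ≠ 0 := by
            intro h0
            apply hv
            ext i
            fin_cases i
            · exact h0
            · exact h1
          have h0' := Complex.normSq_pos.2 h0
          rw [Complex.normSq_apply] at h0'
          simp only [h1, Complex.zero_re, Complex.zero_im]
          have := mul_pos (mul_pos hr hr) h0'
          nlinarith
        · have h1' := Complex.normSq_pos.2 h1
          rw [Complex.normSq_apply] at h1'
          have : 0 < (r * s - (w.re ^ 2 + w.im ^ 2)) * ((v 1).re ^ 2 + (v 1).im ^ 2) :=
            mul_pos (by linarith) (by nlinarith)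
          positivity
      exact_mod_cast (pos_iff_pos_of_mul_pos hq).1 hr

/-- The matrix `[a, x + ω y; x + ω² y, d]`. -/
def psiMat (a d x y : ℂ) : Matrix (Fin 2) (Fin 2) ℂ :=
  !![a, x + omega * y; x + omega ^ 2 * y, d]

theorem psiMat_mem_iff (a d x y : ℂ) : psiMat a d x y ∈ H2 ↔
    0 < a.im * d.im - x.im ^ 2 + x.im * y.im - y.im ^ 2 ∧ 0 < a.im := by
  have h : (1 / (2 * Complex.I)) • (psiMat a d x y - (psiMat a d x y)ᴴ)
      = !![(a.im : ℂ), x.im + omega * y.im; star (x.im + omega * y.im), (d.im : ℂ)] := by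
    have hI : ∀ z : ℂ, z - star z = 2 * Complex.I * z.im := by
      intro z
      apply Complex.ext <;> simp
      ring
    have h2 : (2 * Complex.I) ≠ 0 := by simp
    have h3 : star (omega ^ 2) = omega := by
      rw [omega_sq, star_sub, star_omega]
      simp
    have h4 : star omega = omega ^ 2 := by rw [star_omega, omega_sq]
    have hx := hI x
    have hy := hI y
    ext i j
    fin_cases i <;> fin_cases j <;>
      simp only [psiMat, Matrix.smul_apply, Matrix.sub_apply, Matrix.conjTranspose_apply,
        Fin.zero_eta, Fin.mk_one, Matrix.of_apply, Matrix.cons_val', Matrix.cons_val_zero,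
        Matrix.cons_val_one, Matrix.cons_val_fin_one, smul_eq_mul] <;>
      rw [one_div, inv_mul_eq_iff_eq_mul₀ h2]
    · exact hI a
    · rw [star_add, star_mul', h3]
      linear_combination hx + omega * hy
    · rw [star_add, star_mul', h4, star_add, star_mul', h4]
      simp only [Complex.star_def, Complex.conj_ofReal] at hx hy ⊢
      linear_combination hx + omega ^ 2 * hy
    · exact hI d
  change Matrix.PosDef _ ↔ _
  rw [h, posDef_two_iff, omega_eq]
  have h3 : √3 ^ 2 = 3 := Real.sq_sqrt (by norm_num)
  simp only [Complex.add_re, Complex.add_im, Complex.mul_re, Complex.mul_im, Complex.ofReal_re,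
    Complex.ofReal_im]
  constructor
  · rintro ⟨h1, h2⟩
    refine ⟨?_, h1⟩
    nlinarith
  · rintro ⟨h1, h2⟩
    refine ⟨h2, ?_⟩
    nlinarith

theorem bil_smul_smul (a b : ℂ) (v w : Fin 6 → ℂ) :
    bil ℂ (a • v) (b • w) = a * b * bil ℂ v w := by
  simp only [bil, Matrix.mulVec_smul, dotProduct_smul, smul_dotProduct, smul_eq_mul]
  ring

theorem coord_mk (v : Fin 6 → ℂ) (hv : v ≠ 0) (i : Fin 6) :
    coord (Projectivization.mk ℂ v hv) i = v i / v 0 := by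
  obtain ⟨a, ha⟩ := Projectivization.exists_smul_eq_mk_rep ℂ v hv
  rw [coord, ← ha]
  simp only [Pi.smul_apply, Units.smul_def, smul_eq_mul]
  exact mul_div_mul_left _ _ a.ne_zero

theorem mem_DM_mk (v : Fin 6 → ℂ) (hv : v ≠ 0) :
    Projectivization.mk ℂ v hv ∈ DM ↔ bil ℂ v v = 0 ∧ 0 < (bil ℂ v (star v)).re := by
  obtain ⟨a, ha⟩ := Projectivization.exists_smul_eq_mk_rep ℂ v hv
  have ha' : (a : ℂ) • v = (Projectivization.mk ℂ v hv).rep := ha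
  change bil ℂ _ _ = 0 ∧ 0 < (bil ℂ _ _).re ↔ _
  rw [← ha', star_smul, bil_smul_smul, bil_smul_smul]
  have h1 : (a : ℂ) * star (a : ℂ) = ((Complex.normSq a : ℝ) : ℂ) := Complex.mul_conj _
  have h2 : 0 < Complex.normSq a := Complex.normSq_pos.2 a.ne_zero
  rw [h1, Complex.re_ofReal_mul]
  refine and_congr ?_ (mul_pos_iff_of_pos_left h2)
  simp

theorem mem_DMPlus_mk (v : Fin 6 → ℂ) (hv : v ≠ 0) (h0 : v 0 = 1) :
    Projectivization.mk ℂ v hv ∈ DMPlus ↔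
      v 1 = -2 * (v 2 * v 3 - v 4 ^ 2 + v 4 * v 5 - v 5 ^ 2) ∧
      0 < (v 2).im * (v 3).im - (v 4).im ^ 2 + (v 4).im * (v 5).im - (v 5).im ^ 2 ∧
      0 < (v 2).im := by
  change _ ∈ DM ∧ 0 < (coord _ 2).im ↔ _
  rw [mem_DM_mk, coord_mk, h0, div_one, and_assoc]
  have e1 : bil ℂ v v = 2 * (v 1 + 2 * (v 2 * v 3 - v 4 ^ 2 + v 4 * v 5 - v 5 ^ 2)) := by
    simp [bil, Q, Matrix.mulVec, dotProduct, Fin.sum_univ_succ, h0]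
    ring
  have e2 : (bil ℂ v (star v)).re = (bil ℂ v v).re + 8 * ((v 2).im * (v 3).im - (v 4).im ^ 2
      + (v 4).im * (v 5).im - (v 5).im ^ 2) := by
    rw [e1]
    simp [bil, Q, Matrix.mulVec, dotProduct, Fin.sum_univ_succ, h0, sq]
    ring
  have e3 : bil ℂ v v = 0 ↔ v 1 = -2 * (v 2 * v 3 - v 4 ^ 2 + v 4 * v 5 - v 5 ^ 2) := by
    rw [e1]
    constructor
    · intro h
      linear_combination h / 2
    · intro h
      rw [h]
      ring
  rw [← e3]
  refine and_congr_right fun h => and_congr_left fun _ => ?_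
  rw [e2, h]
  simp

theorem eq_mk_coord {p : PM} (hp : p ∈ DMPlus) :
    ∃ h : coord p ≠ 0, coord p 0 = 1 ∧ p = Projectivization.mk ℂ (coord p) h := by
  have h0 : p.rep 0 ≠ 0 := by
    intro h
    have := hp.2
    simp [coord, h] at this
  have h1 : coord p 0 = 1 := div_self h0
  have h2 : coord p ≠ 0 := fun h => by simp [h] at h1
  refine ⟨h2, h1, ?_⟩
  conv_lhs => rw [← p.mk_rep]
  rw [Projectivization.mk_eq_mk_iff']
  refine ⟨p.rep 0, ?_⟩
  ext i
  simp only [coord, Pi.smul_apply, smul_eq_mul]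
  exact mul_div_cancel₀ _ h0

theorem coord_of_mem {p : PM} (hp : p ∈ DMPlus) : coord p 0 = 1 ∧
    coord p 1 = -2 * (coord p 2 * coord p 3 - coord p 4 ^ 2 + coord p 4 * coord p 5
      - coord p 5 ^ 2) ∧
    0 < (coord p 2).im * (coord p 3).im - (coord p 4).im ^ 2 + (coord p 4).im * (coord p 5).im
      - (coord p 5).im ^ 2 ∧ 0 < (coord p 2).im := by
  obtain ⟨h, h0, h1⟩ := eq_mk_coord hp
  have h2 := hp
  rw [h1] at h2
  exact ⟨h0, (mem_DMPlus_mk _ h h0).1 h2⟩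

/-- The vector `(1, z₂, a, d, x, y)` on the quadric. -/
def quadVec (a d x y : ℂ) : Fin 6 → ℂ :=
  ![1, -2 * (a * d - x ^ 2 + x * y - y ^ 2), a, d, x, y]

theorem quadVec_ne (a d x y : ℂ) : quadVec a d x y ≠ 0 := fun h => by
  have := congrFun h 0
  simp [quadVec] at this

theorem exists_psiMat (τ : Matrix (Fin 2) (Fin 2) ℂ) : ∃ x y : ℂ,
    τ = psiMat (τ 0 0) (τ 1 1) x y := by
  refine ⟨τ 0 1 - omega * ((τ 0 1 - τ 1 0) / (2 * omega + 1)),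
    (τ 0 1 - τ 1 0) / (2 * omega + 1), ?_⟩
  ext i j
  have h := div_mul_cancel₀ (τ 0 1 - τ 1 0) two_omega_ne
  fin_cases i <;> fin_cases j
  · rfl
  · change τ 0 1 = _
    simp [psiMat]
  · change τ 1 0 = _
    simp only [psiMat, Fin.zero_eta, Fin.mk_one, Matrix.of_apply, Matrix.cons_val', omega_sq,
      Matrix.cons_val_zero, Matrix.cons_val_one, Matrix.cons_val_fin_one]
    linear_combination h
  · rfl

theorem psiMat_inj {a d x y a' d' x' y' : ℂ} (h : psiMat a d x y = psiMat a' d' x' y') :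
    a = a' ∧ d = d' ∧ x = x' ∧ y = y' := by
  have h00 : a = a' := congrFun (congrFun h 0) 0
  have h11 : d = d' := congrFun (congrFun h 1) 1
  have h01 : x + omega * y = x' + omega * y' := congrFun (congrFun h 0) 1
  have h10 : x + omega ^ 2 * y = x' + omega ^ 2 * y' := congrFun (congrFun h 1) 0
  rw [omega_sq] at h10
  have hy : y = y' := mul_left_cancel₀ two_omega_ne (by linear_combination h01 - h10)
  subst hy
  exact ⟨h00, h11, add_right_cancel h01, rfl⟩

/-- The map `Ψ : 𝔻_M⁺ → ℍ₂`,
`[1 : z₂ : ⋯ : z₆] ↦ [z₃, z₅ + ω z₆; z₅ + ω² z₆, z₄]`. -/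
def psiFun (p : DMPlus) : H2 :=
  ⟨psiMat (coord p.1 2) (coord p.1 3) (coord p.1 4) (coord p.1 5),
    (psiMat_mem_iff _ _ _ _).2 (coord_of_mem p.2).2.2⟩

theorem psiFun_bijective : Function.Bijective psiFun := by
  constructor
  · intro p p' h
    obtain ⟨h2, h3, h4, h5⟩ := psiMat_inj (congrArg Subtype.val h)
    have c := coord_of_mem p.2
    have c' := coord_of_mem p'.2
    have e : coord p.1 = coord p'.1 := by
      ext i
      fin_cases i
      · exact c.1.trans c'.1.symm
      · change coord p.1 1 = coord p'.1 1
        rw [c.2.1, c'.2.1, h2, h3, h4, h5]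
      · exact h2
      · exact h3
      · exact h4
      · exact h5
    obtain ⟨_, _, r⟩ := eq_mk_coord p.2
    obtain ⟨_, _, r'⟩ := eq_mk_coord p'.2
    apply Subtype.ext
    rw [r, r']
    simp only [e]
  · rintro ⟨τ, hτ⟩
    obtain ⟨x, y, h⟩ := exists_psiMat τ
    generalize τ 0 0 = a at h
    generalize τ 1 1 = d at h
    subst h
    have hp : Projectivization.mk ℂ (quadVec a d x y) (quadVec_ne a d x y) ∈ DMPlus :=
      (mem_DMPlus_mk _ _ rfl).2 ⟨rfl, (psiMat_mem_iff a d x y).1 hτ⟩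
    refine ⟨⟨_, hp⟩, Subtype.ext ?_⟩
    simp only [psiFun, coord_mk]
    simp [quadVec]

/-- The isomorphism `Ψ : 𝔻_M⁺ ≅ ℍ₂`. -/
def Psi : DMPlus ≃ H2 := Equiv.ofBijective psiFun psiFun_bijective

/-- The action of `G / {±1}` on `ℍ₂`, transported by `Ψ` from its action on `𝔻_M⁺`, for a subgroup
`G` of `O⁺(M)`. -/
def actH2 (G : Subgroup (GL (Fin 6) ℤ)) (hG : G ≤ OPlus) : ModPm G →* Equiv.Perm H2 :=
  Psi.permCongrHom.toMonoidHom.comp (actDPlusModPm G hG)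

end HessianK3
end

/-! The quadric `quad = 0` is the Grassmannian of planes in ℂ⁴. A 4 × 2 matrix with upper block N
and lower block E has six minors, arranged here as det E, -2 det N and the four entries of N · adj
E. For the matrix [τ; 1] these are the coordinates of the point Ψ⁻¹(τ). Up to a scalar, the exterior
square thus turns h ∈ HΓ₁(2) into a linear map of M ⊗ ℂ, and the heart of the matter is that the
maps so obtained are exactly the elements of SO⁺_Enr(M), up to sign. The relation `IsLift g h`
expresses this correspondence. It is compatible with products and inverses, and related elements act
alike on the domain (`IsLift.projAct_eq`), so it remains to see that every g and every h occurs.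

Both directions rest on one Euclidean algorithm. Write a vector of M as (p, q, S) with S a Hermitian
matrix over ℤ[ω]; it is isotropic when pq = -2 det S. The explicit pairs of `exists_upper` and
`exists_lower` add to S multiples of p and of q respectively. Every S has a representative modulo p
with 2|det S| < p² (`exists_reduced`), so alternating the two kinds of moves decreases |p| and |q|.
If p is odd it stays odd, hence nonzero, and the vector ends as a multiple of the first basis vector
(`exists_lift_mulVec_eq`).

For an isometry g, this is applied to the image of the first basis vector. Once that vector is
fixed, the next ones are fixed one by one by further lifts, those of S ↦ A S A* from `exists_conj`
included, until only ±1 on A₂(2) remains. If the first entry of g is even, `isoW` makes it odd; as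
`isoW` has determinant -1 while lifts have determinant 1, this case does not occur in SO⁺_Enr(M).
For h = [A, B; C, D], the algorithm is applied to the minors of [B; D], which become integral with
odd first coordinate after multiplication by the conjugate of det D. This reduces h to B = 0, then
to a block diagonal matrix.

Test points show that only ±1 acts trivially. The kernel of the map to S₅ is described by
congruences modulo 2 because the five isotropic elements generate the 2-torsion. Finally `isoW`
induces W' and has determinant -1, so W' generates a complement of order 2 to HΓ₁(2)/{±1}. -/

open scoped Matrix ComplexOrder LinearAlgebra.Projectivization

noncomputable section

namespace HessianK3

/-! ### Isometries of `M` -/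

/-- The quadratic form `½ ᵗv Q v`. -/
def quad {R : Type*} [CommRing R] (v : Fin 6 → R) : R :=
  v 0 * v 1 + 2 * (v 2 * v 3 - v 4 ^ 2 + v 4 * v 5 - v 5 ^ 2)

theorem dotProduct_Q_mulVec (v w : Fin 6 → ℤ) :
    v ⬝ᵥ (Q *ᵥ w) = quad (v + w) - quad v - quad w := by
  simp [quad, Q, Matrix.mulVec, dotProduct, Fin.sum_univ_succ]
  ring

theorem det_Q : Q.det = 48 := by
  simp [Q, Matrix.det_succ_row_zero, Fin.sum_univ_succ, Fin.succAbove, Matrix.submatrix]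

theorem transpose_mul_Q_mul_eq_iff (M : Matrix (Fin 6) (Fin 6) ℤ) :
    Mᵀ * Q * M = Q ↔ ∀ v, quad (M *ᵥ v) = quad v := by
  have key : ∀ v w : Fin 6 → ℤ, v ⬝ᵥ ((Mᵀ * Q * M) *ᵥ w)
      = (M *ᵥ v) ⬝ᵥ (Q *ᵥ (M *ᵥ w)) := by
    intro v w
    rw [← Matrix.mulVec_mulVec, ← Matrix.mulVec_mulVec, Matrix.dotProduct_mulVec v,
      Matrix.vecMul_transpose]
  have two : ∀ v : Fin 6 → ℤ, quad (v + v) = 4 * quad v := by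
    intro v
    simp only [quad, Pi.add_apply]
    ring
  constructor
  · intro h v
    have h1 := key v v
    rw [h, dotProduct_Q_mulVec, dotProduct_Q_mulVec, two, two] at h1
    linarith
  · intro h
    ext i j
    have h1 := key (Pi.single i 1) (Pi.single j 1)
    rw [dotProduct_Q_mulVec, ← Matrix.mulVec_add, h, h, h, ← dotProduct_Q_mulVec] at h1
    simpa using h1

theorem mem_OM_iff (g : GL (Fin 6) ℤ) : g ∈ OM ↔ ∀ v, quad (g.1 *ᵥ v) = quad v :=
  transpose_mul_Q_mul_eq_iff g.1

/-- Since det Q = 48 is nonzero, comparing determinants gives (det M)² = 1, so invertibility over ℤ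
is automatic. -/
theorem exists_OM (M : Matrix (Fin 6) (Fin 6) ℤ) (h : ∀ v, quad (M *ᵥ v) = quad v) :
    ∃ g ∈ OM, g.1 = M := by
  have h1 := (transpose_mul_Q_mul_eq_iff M).2 h
  have h2 := congrArg Matrix.det h1
  rw [Matrix.det_mul, Matrix.det_mul, Matrix.det_transpose, det_Q] at h2
  have h3 : IsUnit M.det := IsUnit.of_mul_eq_one M.det (by linarith)
  exact ⟨Matrix.GeneralLinearGroup.mk'' M h3, h1, rfl⟩

theorem inv_mulVec_mulVec {n R : Type*} [Fintype n] [DecidableEq n] [CommRing R] (g : GL n R)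
    (v : n → R) : (g⁻¹).1 *ᵥ (g.1 *ᵥ v) = v := by
  rw [Matrix.mulVec_mulVec, ← Units.val_mul, inv_mul_cancel, Units.val_one, Matrix.one_mulVec]

/-- The subgroup of the `g` that fix modulo `2` the vectors with even coordinates `z₁`, `z₂`. -/
def Cong : Subgroup (GL (Fin 6) ℤ) where
  carrier := {g | ∀ v : Fin 6 → ℤ, 2 ∣ v 0 → 2 ∣ v 1 → ∀ i, 2 ∣ (g.1 *ᵥ v) i - v i}
  one_mem' := by intro v _ _ i; simp
  mul_mem' := by
    intro g h hg hh v h0 h1 i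
    have e := hh v h0 h1
    have e0 := (Int.dvd_add_right h0).2 (e 0)
    have e1 := (Int.dvd_add_right h1).2 (e 1)
    rw [add_sub_cancel] at e0 e1
    have := dvd_add (hg _ e0 e1 i) (e i)
    rwa [sub_add_sub_cancel, Matrix.mulVec_mulVec, ← Units.val_mul] at this
  inv_mem' := by
    intro g hg v h0 h1 i
    choose m hm using hg v h0 h1
    have e : g.1 *ᵥ v = v + (2 : ℤ) • m := by
      ext i
      have := hm i
      simp only [Pi.add_apply, Pi.smul_apply, smul_eq_mul]
      linarith
    have e2 : v = (g⁻¹).1 *ᵥ v + (2 : ℤ) • ((g⁻¹).1 *ᵥ m) := by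
      conv_lhs => rw [← inv_mulVec_mulVec g v, e, Matrix.mulVec_add, Matrix.mulVec_smul]
    have e3 := congrFun e2 i
    simp only [Pi.add_apply, Pi.smul_apply, smul_eq_mul] at e3
    exact ⟨-((g⁻¹).1 *ᵥ m) i, by linarith⟩

/-! ### Plücker coordinates -/

/-- `z` is a vector of Plücker coordinates of the `4 × 2` matrix `X`, up to a factor. -/
def IsPluecker (z : Fin 6 → ℂ) (X : Matrix (Fin 2 ⊕ Fin 2) (Fin 2) ℂ) : Prop :=
  ∃ c : ℂ, c ≠ 0 ∧ c * z 0 = X.toRows₂.det ∧ c * z 1 = -2 * X.toRows₁.det ∧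
    c • psiMat (z 2) (z 3) (z 4) (z 5) = X.toRows₁ * X.toRows₂.adjugate

theorem smul_psiMat (c a d x y : ℂ) :
    c • psiMat a d x y = psiMat (c * a) (c * d) (c * x) (c * y) := by
  ext i j
  fin_cases i <;> fin_cases j <;> simp [psiMat] <;> ring

theorem exists_isPluecker (X : Matrix (Fin 2 ⊕ Fin 2) (Fin 2) ℂ) : ∃ z, IsPluecker z X := by
  obtain ⟨x, y, h⟩ := exists_psiMat (X.toRows₁ * X.toRows₂.adjugate)
  exact ⟨![X.toRows₂.det, -2 * X.toRows₁.det, _, _, x, y], 1, one_ne_zero,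
    by simp, by simp, by rw [h, one_smul]; rfl⟩

theorem IsPluecker.smul {z : Fin 6 → ℂ} {X : Matrix (Fin 2 ⊕ Fin 2) (Fin 2) ℂ}
    (h : IsPluecker z X) {a : ℂ} (ha : a ≠ 0) : IsPluecker (a • z) X := by
  obtain ⟨c, hc, h0, h1, h2⟩ := h
  refine ⟨c / a, div_ne_zero hc ha, ?_, ?_, ?_⟩
  · rw [← h0]
    simp only [Pi.smul_apply, smul_eq_mul]
    field_simp
  · rw [← h1]
    simp only [Pi.smul_apply, smul_eq_mul]
    field_simp
  · rw [← h2]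
    simp only [Pi.smul_apply, smul_eq_mul]
    rw [← smul_psiMat, smul_smul, div_mul_cancel₀ _ ha]

/-- No rank condition on X is needed: the minors determine c • z entry by entry, because `psiMat` is
injective. -/
theorem IsPluecker.unique {z z' : Fin 6 → ℂ} {X : Matrix (Fin 2 ⊕ Fin 2) (Fin 2) ℂ}
    (h : IsPluecker z X) (h' : IsPluecker z' X) : ∃ c : ℂ, c ≠ 0 ∧ z' = c • z := by
  obtain ⟨c, hc, h0, h1, h2⟩ := h
  obtain ⟨c', hc', h0', h1', h2'⟩ := h'
  have e := h2.trans h2'.symm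
  rw [smul_psiMat, smul_psiMat] at e
  obtain ⟨e2, e3, e4, e5⟩ := psiMat_inj e
  refine ⟨c / c', div_ne_zero hc hc', ?_⟩
  ext i
  rw [Pi.smul_apply, smul_eq_mul, div_mul_eq_mul_div, eq_div_iff hc', mul_comm]
  fin_cases i
  · exact h0'.trans h0.symm
  · exact h1'.trans h1.symm
  · exact e2.symm
  · exact e3.symm
  · exact e4.symm
  · exact e5.symm

/-- The action of an integral matrix on `M ⊗ ℂ`. -/
def onC (g : GL (Fin 6) ℤ) (z : Fin 6 → ℂ) : Fin 6 → ℂ := g.1.map (Int.cast : ℤ → ℂ) *ᵥ z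

theorem onC_one (z : Fin 6 → ℂ) : onC 1 z = z := by
  simp [onC]

theorem onC_mul (g h : GL (Fin 6) ℤ) (z : Fin 6 → ℂ) : onC (g * h) z = onC g (onC h z) := by
  have : (g.1 * h.1).map (Int.cast : ℤ → ℂ)
      = g.1.map (Int.cast : ℤ → ℂ) * h.1.map (Int.cast : ℤ → ℂ) :=
    Matrix.map_mul (f := Int.castRingHom ℂ)
  simp [onC, this]

theorem onC_smul (g : GL (Fin 6) ℤ) (c : ℂ) (z : Fin 6 → ℂ) : onC g (c • z) = c • onC g z :=
  Matrix.mulVec_smul _ _ _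

theorem onC_intCast (g : GL (Fin 6) ℤ) (v : Fin 6 → ℤ) :
    onC g (fun i => (v i : ℂ)) = fun i => (((g.1 *ᵥ v) i : ℤ) : ℂ) := by
  ext i
  simp [onC, Matrix.mulVec, dotProduct]

theorem onC_neg (g : GL (Fin 6) ℤ) (z : Fin 6 → ℂ) : onC (-g) z = (-1 : ℂ) • onC g z := by
  ext i
  simp [onC, Matrix.mulVec, dotProduct]

theorem onC_ne_zero (g : GL (Fin 6) ℤ) {z : Fin 6 → ℂ} (hz : z ≠ 0) : onC g z ≠ 0 := by
  intro h
  apply hz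
  rw [← onC_one z, ← inv_mul_cancel g, onC_mul, h]
  simp [onC]

theorem projAct_mk (g : GL (Fin 6) ℤ) (v : Fin 6 → ℂ) (hv : v ≠ 0) :
    projAct g (Projectivization.mk ℂ v hv) = Projectivization.mk ℂ (onC g v) (onC_ne_zero g hv) := by
  simp only [projAct, MonoidHom.comp_apply, MulAction.toPermHom_apply, MulAction.toPerm_apply]
  rw [Projectivization.smul_mk]
  rfl

/-- `g ∈ O(M)` and `h ∈ HΓ₁(2)` correspond to each other under `∧²`, up to factors. -/
structure IsLift (g : GL (Fin 6) ℤ) (h : GL (Fin 2 ⊕ Fin 2) Eis) : Prop where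
  mem_OM : g ∈ OM
  det : g.det = 1
  mem_Cong : g ∈ Cong
  mem_HGamma1 : h ∈ HGamma1
  pluecker : ∀ z X, IsPluecker z X → IsPluecker (onC g z) ((toGLC h).1 * X)

theorem IsLift.mul {g g' : GL (Fin 6) ℤ} {h h' : GL (Fin 2 ⊕ Fin 2) Eis} (H : IsLift g h)
    (H' : IsLift g' h') : IsLift (g * g') (h * h') where
  mem_OM := mul_mem H.1 H'.1
  det := by rw [map_mul, H.2, H'.2, mul_one]
  mem_Cong := mul_mem H.3 H'.3
  mem_HGamma1 := mul_mem H.4 H'.4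
  pluecker z X hz := by
    rw [onC_mul, map_mul, Units.val_mul, Matrix.mul_assoc]
    exact H.5 _ _ (H'.5 _ _ hz)

theorem IsLift.inv {g : GL (Fin 6) ℤ} {h : GL (Fin 2 ⊕ Fin 2) Eis} (H : IsLift g h) :
    IsLift g⁻¹ h⁻¹ where
  mem_OM := inv_mem H.1
  det := by rw [map_inv, H.2, inv_one]
  mem_Cong := inv_mem H.3
  mem_HGamma1 := inv_mem H.4
  pluecker z X hz := by
    -- Coordinates z' of h⁻¹X exist in any case, and g maps them to coordinates of X, which by
    -- uniqueness are proportional to z.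
    obtain ⟨z', hz'⟩ := exists_isPluecker ((toGLC h⁻¹).1 * X)
    have h1 := H.5 _ _ hz'
    rw [← Matrix.mul_assoc, ← Units.val_mul, ← map_mul, mul_inv_cancel, map_one, Units.val_one,
      Matrix.one_mul] at h1
    obtain ⟨c, hc, rfl⟩ := h1.unique hz
    rw [onC_smul, ← onC_mul, inv_mul_cancel, onC_one]
    exact hz'.smul hc

theorem isLift_one : IsLift 1 1 where
  mem_OM := one_mem _
  det := map_one _
  mem_Cong := one_mem _
  mem_HGamma1 := one_mem _
  pluecker z X hz := by simpa [onC_one] using hz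

theorem neg_mem_OM {g : GL (Fin 6) ℤ} (h : g ∈ OM) : -g ∈ OM := by
  change (-g).1ᵀ * Q * (-g).1 = Q
  have h' : g.1ᵀ * Q * g.1 = Q := h
  rw [Units.val_neg, Matrix.transpose_neg, Matrix.neg_mul, Matrix.neg_mul, Matrix.mul_neg, neg_neg,
    h']

theorem neg_mem_Cong {g : GL (Fin 6) ℤ} (h : g ∈ Cong) : -g ∈ Cong := by
  intro v h0 h1 i
  obtain ⟨k, hk⟩ := h v h0 h1 i
  refine ⟨-k - v i, ?_⟩
  rw [Units.val_neg, Matrix.neg_mulVec, Pi.neg_apply]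
  linarith

theorem det_neg_six (g : GL (Fin 6) ℤ) : (-g).det = g.det := by
  ext
  simp [Matrix.det_neg]

/-- The scalar in `IsPluecker` absorbs the sign: the correspondence cannot distinguish g from -g. -/
theorem IsLift.neg {g : GL (Fin 6) ℤ} {h : GL (Fin 2 ⊕ Fin 2) Eis} (H : IsLift g h) :
    IsLift (-g) h where
  mem_OM := neg_mem_OM H.1
  det := by rw [det_neg_six, H.2]
  mem_Cong := neg_mem_Cong H.3
  mem_HGamma1 := H.4
  pluecker z X hz := by
    rw [onC_neg]
    exact (H.5 _ _ hz).smul (by simp)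

/-- The group of the elements of `SO(M)` with a lift to `HΓ₁(2)`. -/
def Lift : Subgroup (GL (Fin 6) ℤ) where
  carrier := {g | ∃ h, IsLift g h}
  one_mem' := ⟨1, isLift_one⟩
  mul_mem' := by
    rintro g g' ⟨h, H⟩ ⟨h', H'⟩
    exact ⟨h * h', H.mul H'⟩
  inv_mem' := by
    rintro g ⟨h, H⟩
    exact ⟨h⁻¹, H.inv⟩

theorem neg_mem_Lift {g : GL (Fin 6) ℤ} (hg : g ∈ Lift) : -g ∈ Lift := by
  obtain ⟨h, H⟩ := hg
  exact ⟨h, H.neg⟩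

/-! ### Compatibility of lifts with the actions -/

theorem exists_quadVec (p : DMPlus) : ∃ a d x y : ℂ, (Psi p).1 = psiMat a d x y ∧
    p.1 = Projectivization.mk ℂ (quadVec a d x y) (quadVec_ne a d x y) := by
  refine ⟨_, _, _, _, rfl, ?_⟩
  obtain ⟨c0, c1, _⟩ := coord_of_mem p.2
  obtain ⟨h, _, r⟩ := eq_mk_coord p.2
  conv_lhs => rw [r]
  have e : coord p.1 = quadVec (coord p.1 2) (coord p.1 3) (coord p.1 4) (coord p.1 5) := by
    ext i
    fin_cases i
    · exact c0
    · exact c1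
    all_goals rfl
  simp only [← e]

theorem det_psiMat (a d x y : ℂ) : (psiMat a d x y).det = a * d - x ^ 2 + x * y - y ^ 2 := by
  rw [psiMat, Matrix.det_fin_two_of]
  linear_combination (-x * y - (omega - 1) * y ^ 2) * omega_sq

theorem isPluecker_quadVec (a d x y : ℂ) :
    IsPluecker (quadVec a d x y) (Matrix.fromRows (psiMat a d x y) 1) := by
  refine ⟨1, one_ne_zero, ?_, ?_, ?_⟩
  · simp [quadVec]
  · simp [quadVec, det_psiMat]
  · simp [quadVec]

/-- The matrices h[τ; 1] = [Aτ + B; Cτ + D] and [hτ; 1] differ by right multiplication by the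
invertible matrix Cτ + D, which multiplies all minors by its determinant. -/
theorem IsLift.projAct_eq {g : GL (Fin 6) ℤ} {h : GL (Fin 2 ⊕ Fin 2) Eis} (H : IsLift g h)
    (p : DMPlus) : projAct g p.1 =
      (Psi.symm (actHGamma1 ⟨h, H.mem_HGamma1⟩ (Psi p))).1 := by
  obtain ⟨a, d, x, y, hτ, hp⟩ := exists_quadVec p
  set q := Psi.symm (actHGamma1 ⟨h, H.mem_HGamma1⟩ (Psi p)) with hq
  obtain ⟨a', d', x', y', hτ', hp'⟩ := exists_quadVec q
  have e : (Psi q).1 = mob (toGLC h).1 (psiMat a d x y) := by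
    rw [hq, Equiv.apply_symm_apply, ← hτ]
    rfl
  have h1 := H.5 _ _ (isPluecker_quadVec a d x y)
  rw [mul_fromRows] at h1
  have hu : IsUnit (den (toGLC h).1 (psiMat a d x y)).det := by
    rw [← Matrix.isUnit_iff_isUnit_det, ← hτ]
    exact den_isUnit ⟨toGLC h, toGLC_mem ⟨h, H.4⟩⟩ (Psi p).2
  have h2 : IsPluecker (quadVec a' d' x' y') (Matrix.fromRows (num (toGLC h).1 (psiMat a d x y))
      (den (toGLC h).1 (psiMat a d x y))) := by
    have hm : psiMat a' d' x' y' = num (toGLC h).1 (psiMat a d x y) *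
        (den (toGLC h).1 (psiMat a d x y))⁻¹ := by rw [← hτ', e, mob]
    clear h1 e hq
    generalize num (toGLC h).1 (psiMat a d x y) = N at *
    generalize den (toGLC h).1 (psiMat a d x y) = D at *
    have hN : N = psiMat a' d' x' y' * D := by
      rw [hm, Matrix.mul_assoc, Matrix.nonsing_inv_mul _ hu, Matrix.mul_one]
    refine ⟨D.det, hu.ne_zero, ?_, ?_, ?_⟩
    · simp [quadVec]
    · rw [Matrix.toRows₁_fromRows, hN, Matrix.det_mul, det_psiMat]
      simp [quadVec]
      ring
    · rw [Matrix.toRows₁_fromRows, Matrix.toRows₂_fromRows, hN, Matrix.mul_assoc,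
        Matrix.mul_adjugate]
      simp [quadVec]
  obtain ⟨c, hc, h3⟩ := h2.unique h1
  rw [hp', hp, projAct_mk, Projectivization.mk_eq_mk_iff']
  exact ⟨c, h3.symm⟩

theorem IsLift.mem_OPlus {g : GL (Fin 6) ℤ} {h : GL (Fin 2 ⊕ Fin 2) Eis} (H : IsLift g h) :
    g ∈ OPlus := by
  have key : ∀ {g h}, IsLift g h → ∀ p ∈ DMPlus, projAct g p ∈ DMPlus := by
    intro g h H p hp
    rw [H.projAct_eq ⟨p, hp⟩]
    exact Subtype.prop _
  refine ⟨H.1, Set.Subset.antisymm ?_ ?_⟩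
  · rintro _ ⟨p, hp, rfl⟩
    exact key H p hp
  · intro p hp
    refine ⟨projAct g⁻¹ p, key H.inv p hp, ?_⟩
    rw [← Equiv.Perm.mul_apply, ← map_mul, mul_inv_cancel, map_one, Equiv.Perm.one_apply]

theorem actH2_mk (G : Subgroup (GL (Fin 6) ℤ)) (hG : G ≤ OPlus) (g : G) (τ : H2) :
    actH2 G hG (QuotientGroup.mk g) τ =
      Psi ⟨projAct g.1 (Psi.symm τ).1, (projAct_mem_iff ⟨g.1, hG g.2⟩ _).2 (Psi.symm τ).2⟩ :=
  rfl

theorem IsLift.actH2_eq {g : GL (Fin 6) ℤ} {h : GL (Fin 2 ⊕ Fin 2) Eis} (H : IsLift g h)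
    (G : Subgroup (GL (Fin 6) ℤ)) (hG : G ≤ OPlus) (hg : g ∈ G) :
    actH2 G hG (QuotientGroup.mk ⟨g, hg⟩) =
      actHGamma1ModPm (QuotientGroup.mk ⟨h, H.mem_HGamma1⟩) := by
  ext1 τ
  rw [actH2_mk]
  have h1 := H.projAct_eq (Psi.symm τ)
  rw [Equiv.apply_symm_apply] at h1
  rw [← Equiv.eq_symm_apply]
  exact Subtype.ext h1

/-! ### The `2`-torsion of the discriminant group -/

/-- On U(2) ⊕ A₂(2) the form is twice an integral form, so halving is harmless there. Only the two
coordinates of U impose a condition. -/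
theorem half_mem_dualM {m : Fin 6 → ℤ} (h0 : 2 ∣ m 0) (h1 : 2 ∣ m 1) :
    (fun i => (m i : ℚ) / 2) ∈ dualM := by
  rintro _ ⟨n, rfl⟩
  obtain ⟨a, ha⟩ := h0
  obtain ⟨b, hb⟩ := h1
  refine ⟨a * n 1 + b * n 0 + m 2 * n 3 + m 3 * n 2 - 2 * m 4 * n 4 + m 4 * n 5 + m 5 * n 4
    - 2 * m 5 * n 5, ?_⟩
  simp [bil, Q, Matrix.mulVec, dotProduct, Fin.sum_univ_succ, ha, hb]
  ring

/-- The class of `m / 2` in `M^∨ / M`. -/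
def half (m : Fin 6 → ℤ) (h0 : 2 ∣ m 0) (h1 : 2 ∣ m 1) : Discr :=
  Submodule.Quotient.mk ⟨_, half_mem_dualM h0 h1⟩

theorem half_eq_iff {m n : Fin 6 → ℤ} {h0 : 2 ∣ m 0} {h1 : 2 ∣ m 1} {h0' : 2 ∣ n 0}
    {h1' : 2 ∣ n 1} : half m h0 h1 = half n h0' h1' ↔ ∀ i, 2 ∣ m i - n i := by
  rw [half, half, Submodule.Quotient.eq]
  change (fun i => (m i : ℚ) / 2) - (fun i => (n i : ℚ) / 2) ∈ latM ↔ _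
  constructor
  · rintro ⟨k, hk⟩ i
    refine ⟨k i, ?_⟩
    have := congrFun hk i
    simp only [Pi.sub_apply] at this
    have h : ((m i - n i : ℤ) : ℚ) = ((2 * k i : ℤ) : ℚ) := by
      push_cast
      linarith
    exact_mod_cast h
  · intro h
    choose k hk using h
    refine ⟨k, ?_⟩
    ext i
    have h : ((m i - n i : ℤ) : ℚ) = ((2 * k i : ℤ) : ℚ) := by rw [hk]
    push_cast at h
    simp only [Pi.sub_apply]
    linarith

theorem half_add {m n : Fin 6 → ℤ} {h0 : 2 ∣ m 0} {h1 : 2 ∣ m 1} {h0' : 2 ∣ n 0}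
    {h1' : 2 ∣ n 1} : half (m + n) ((Int.dvd_add_right h0).2 h0') ((Int.dvd_add_right h1).2 h1')
      = half m h0 h1 + half n h0' h1' := by
  rw [half, half, half, ← Submodule.Quotient.mk_add]
  congr 1
  ext i
  simp [add_div]

theorem two_smul_half (m : Fin 6 → ℤ) (h0 : 2 ∣ m 0) (h1 : 2 ∣ m 1) :
    (2 : ℤ) • half m h0 h1 = 0 := by
  rw [half, ← Submodule.Quotient.mk_smul, Submodule.Quotient.mk_eq_zero]
  refine ⟨m, ?_⟩
  ext i
  simp only [Submodule.coe_subtype, Submodule.coe_smul, Pi.smul_apply, zsmul_eq_mul]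
  push_cast
  ring

theorem exists_half {v : Discr} (hv : (2 : ℤ) • v = 0) : ∃ m h0 h1, v = half m h0 h1 := by
  induction v using Submodule.Quotient.induction_on with
  | H x =>
    rw [← Submodule.Quotient.mk_smul, Submodule.Quotient.mk_eq_zero] at hv
    obtain ⟨m, hm⟩ := hv
    have hm' : ∀ i, x.1 i = (m i : ℚ) / 2 := by
      intro i
      have := congrFun hm i
      simp only [Submodule.coe_subtype, Submodule.coe_smul, Pi.smul_apply, zsmul_eq_mul] at this
      push_cast at this
      linarith
    obtain ⟨k, hk⟩ := x.2 _ ⟨Pi.single 1 1, rfl⟩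
    obtain ⟨l, hl⟩ := x.2 _ ⟨Pi.single 0 1, rfl⟩
    have h0 : m 0 = 2 * k := by
      simp [bil, Q, Matrix.mulVec, dotProduct, Fin.sum_univ_succ, Pi.single_apply, hm'] at hk
      have : (m 0 : ℚ) = 2 * k := by linarith
      exact_mod_cast this
    have h1 : m 1 = 2 * l := by
      simp [bil, Q, Matrix.mulVec, dotProduct, Fin.sum_univ_succ, Pi.single_apply, hm'] at hl
      have : (m 1 : ℚ) = 2 * l := by linarith
      exact_mod_cast this
    refine ⟨m, ⟨k, h0⟩, ⟨l, h1⟩, ?_⟩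
    exact congrArg _ (Subtype.ext (funext hm'))

theorem qM_half_eq_zero_iff (m : Fin 6 → ℤ) (h0 : 2 ∣ m 0) (h1 : 2 ∣ m 1) :
    qM (half m h0 h1) = 0 ↔ 2 ∣ m 2 * m 3 - m 4 ^ 2 + m 4 * m 5 - m 5 ^ 2 := by
  obtain ⟨a, ha⟩ := h0
  obtain ⟨b, hb⟩ := h1
  change ((bil ℚ (fun i => (m i : ℚ) / 2) (fun i => (m i : ℚ) / 2) : ℚ) :
    ℚ ⧸ AddSubgroup.zmultiples (2 : ℚ)) = 0 ↔ _
  rw [QuotientAddGroup.eq_zero_iff, AddSubgroup.mem_zmultiples_iff]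
  have e : bil ℚ (fun i => (m i : ℚ) / 2) (fun i => (m i : ℚ) / 2) =
      ((2 * (a * b) + (m 2 * m 3 - m 4 ^ 2 + m 4 * m 5 - m 5 ^ 2) : ℤ) : ℚ) := by
    simp [bil, Q, Matrix.mulVec, dotProduct, Fin.sum_univ_succ, ha, hb]
    ring
  rw [e]
  generalize m 2 * m 3 - m 4 ^ 2 + m 4 * m 5 - m 5 ^ 2 = t
  constructor
  · rintro ⟨k, hk⟩
    have : k * 2 = 2 * (a * b) + t := by
      have h : ((k * 2 : ℤ) : ℚ) = ((2 * (a * b) + t : ℤ) : ℚ) := by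
        rw [← hk]
        simp
      exact_mod_cast h
    exact ⟨k - a * b, by linarith⟩
  · rintro ⟨k, rfl⟩
    refine ⟨a * b + k, ?_⟩
    push_cast
    simp
    ring

/-- The elements of the `2`-torsion of `M^∨ / M`, indexed by `(ℤ/2)⁴`. -/
def halfFin (c : Fin 4 → Fin 2) : Discr :=
  half ![0, 0, (c 0).1, (c 1).1, (c 2).1, (c 3).1] (by simp) (by simp)

theorem halfFin_injective : Function.Injective halfFin := by
  intro c c' h
  have h' := half_eq_iff.1 h
  have h2 := h' 2
  have h3 := h' 3
  have h4 := h' 4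
  have h5 := h' 5
  simp only [Matrix.cons_val] at h2 h3 h4 h5
  ext i
  fin_cases i <;> simp <;> omega

theorem exists_halfFin {v : Discr} (hv : (2 : ℤ) • v = 0) : ∃ c, v = halfFin c := by
  obtain ⟨m, h0, h1, rfl⟩ := exists_half hv
  have key : ∀ i, ∃ c : Fin 2, 2 ∣ m i - c.1 := by
    intro i
    rcases Int.emod_two_eq_zero_or_one (m i) with h | h
    · exact ⟨0, by simp; omega⟩
    · exact ⟨1, by simp; omega⟩
  choose c hc using key
  refine ⟨![c 2, c 3, c 4, c 5], half_eq_iff.2 fun i => ?_⟩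
  fin_cases i
  · simpa using h0
  · simpa using h1
  · simpa using hc 2
  · simpa using hc 3
  · simpa using hc 4
  · simpa using hc 5

theorem halfFin_add (c c' : Fin 4 → Fin 2) : halfFin (c + c') = halfFin c + halfFin c' := by
  refine (half_eq_iff.2 fun i => ?_).trans half_add
  fin_cases i <;> simp [Fin.val_add] <;> omega

theorem halfFin_zero : halfFin 0 = 0 := by
  have h := halfFin_add 0 0
  rwa [add_zero, left_eq_add] at h

/-- The quadratic form on `(ℤ/2)⁴`. -/
abbrev IsIso (c : Fin 4 → Fin 2) : Prop :=
  c ≠ 0 ∧ 2 ∣ ((c 0).1 * (c 1).1 - (c 2).1 ^ 2 + (c 2).1 * (c 3).1 - (c 3).1 ^ 2 : ℤ)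

theorem halfFin_mem_isoTwo_iff (c : Fin 4 → Fin 2) : halfFin c ∈ isoTwo ↔ IsIso c := by
  refine and_congr (not_congr ?_) ((and_iff_right (two_smul_half _ _ _)).trans
    (qM_half_eq_zero_iff _ _ _))
  rw [← halfFin_zero, halfFin_injective.eq_iff]

theorem isoTwo_eq : isoTwo = halfFin '' {c | IsIso c} := by
  ext v
  constructor
  · intro hv
    obtain ⟨c, rfl⟩ := exists_halfFin hv.2.1
    exact ⟨c, (halfFin_mem_isoTwo_iff c).1 hv, rfl⟩
  · rintro ⟨c, h, rfl⟩
    exact (halfFin_mem_isoTwo_iff c).2 h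

theorem card_isoTwo : Nat.card isoTwo = 5 := by
  rw [isoTwo_eq, Nat.card_image_of_injective halfFin_injective, Nat.card_eq_fintype_card]
  decide

theorem discrAct_half (g : OM) (m : Fin 6 → ℤ) (h0 : 2 ∣ m 0) (h1 : 2 ∣ m 1)
    (h0' : 2 ∣ (g.1.1 *ᵥ m) 0) (h1' : 2 ∣ (g.1.1 *ᵥ m) 1) :
    (discrAct g).1 (half m h0 h1) = half (g.1.1 *ᵥ m) h0' h1' := by
  refine congrArg (Submodule.Quotient.mk (p := latM.comap dualM.subtype)) (Subtype.ext ?_)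
  ext i
  simp [linQ, Matrix.mulVec, dotProduct, Finset.sum_div, mul_div_assoc]

/-- The isometry preserves the dual lattice, and pairing the image of m/2 with the two basis vectors
of U reads off the halves of its first two coordinates. -/
theorem even_of_mem_OM (g : OM) (m : Fin 6 → ℤ) (h0 : 2 ∣ m 0) (h1 : 2 ∣ m 1) :
    2 ∣ (g.1.1 *ᵥ m) 0 ∧ 2 ∣ (g.1.1 *ᵥ m) 1 := by
  have h := linQ_dualM g (half_mem_dualM h0 h1)
  obtain ⟨k, hk⟩ := h _ ⟨Pi.single 1 1, rfl⟩
  obtain ⟨l, hl⟩ := h _ ⟨Pi.single 0 1, rfl⟩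
  have e : linQ g.1 (fun i => (m i : ℚ) / 2) = fun i => (((g.1.1 *ᵥ m) i : ℤ) : ℚ) / 2 := by
    ext i
    simp [linQ, Matrix.mulVec, dotProduct, Finset.sum_div, mul_div_assoc]
  rw [e] at hk hl
  generalize g.1.1 *ᵥ m = n at *
  simp [bil, Q, Matrix.mulVec, dotProduct, Fin.sum_univ_succ, Pi.single_apply] at hk hl
  constructor
  · refine ⟨k, ?_⟩
    have : (n 0 : ℚ) = 2 * k := by linarith
    exact_mod_cast this
  · refine ⟨l, ?_⟩
    have : (n 1 : ℚ) = 2 * l := by linarith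
    exact_mod_cast this

theorem mem_Cong_iff (g : OM) :
    g.1 ∈ Cong ↔ ∀ x : Discr, (2 : ℤ) • x = 0 → (discrAct g).1 x = x := by
  constructor
  · intro h x hx
    obtain ⟨m, h0, h1, rfl⟩ := exists_half hx
    obtain ⟨h0', h1'⟩ := even_of_mem_OM g m h0 h1
    rw [discrAct_half g m h0 h1 h0' h1', half_eq_iff]
    exact h m h0 h1
  · intro h m h0 h1
    obtain ⟨h0', h1'⟩ := even_of_mem_OM g m h0 h1
    have := h _ (two_smul_half m h0 h1)
    rw [discrAct_half g m h0 h1 h0' h1', half_eq_iff] at this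
    exact this

/-- The five isotropic elements generate the 2-torsion. Hence an isometry fixing these five fixes
the whole 2-torsion, which is how the kernel of the map to S₅ becomes a congruence condition. -/
theorem two_torsion_induction {P : Discr → Prop} (h0 : P 0)
    (hadd : ∀ x y, P x → P y → P (x + y)) (hiso : ∀ x ∈ isoTwo, P x) {x : Discr}
    (hx : (2 : ℤ) • x = 0) : P x := by
  obtain ⟨c, rfl⟩ := exists_halfFin hx
  -- Of the 16 elements one is zero and five are isotropic; the other ten are the sums of pairs of
  -- distinct isotropic ones.
  have key : ∀ c : Fin 4 → Fin 2, c = 0 ∨ IsIso c ∨ ∃ a b, IsIso a ∧ IsIso b ∧ c = a + b := by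
    decide +kernel
  rcases key c with rfl | h | ⟨a, b, ha, hb, rfl⟩
  · rwa [halfFin_zero]
  · exact hiso _ ((halfFin_mem_isoTwo_iff c).2 h)
  · rw [halfFin_add]
    exact hadd _ _ (hiso _ ((halfFin_mem_isoTwo_iff a).2 ha))
      (hiso _ ((halfFin_mem_isoTwo_iff b).2 hb))

theorem mem_OEnr_iff_discr (g : GL (Fin 6) ℤ) : g ∈ OEnr ↔
    ∃ h : g ∈ OPlus, ∀ x : Discr, (2 : ℤ) • x = 0 → (discrAct ⟨g, h.1⟩).1 x = x := by
  constructor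
  · rintro ⟨⟨g, h⟩, hk, rfl⟩
    refine ⟨h, fun x hx => ?_⟩
    refine two_torsion_induction (P := fun x => (discrAct ⟨g, h.1⟩).1 x = x) (map_zero _) ?_ ?_ hx
    · intro x y hx hy
      rw [map_add, hx, hy]
    · intro x hx
      have h1 := congrArg (fun f : Equiv.Perm isoTwo => (f ⟨x, hx⟩).1) (MonoidHom.mem_ker.1 hk)
      exact h1
  · rintro ⟨h, hx⟩
    refine ⟨⟨g, h⟩, ?_, rfl⟩
    rw [SetLike.mem_coe, MonoidHom.mem_ker]
    ext v : 2
    exact hx v.1 v.2.2.1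

theorem mem_OEnr_iff (g : GL (Fin 6) ℤ) : g ∈ OEnr ↔ g ∈ OPlus ∧ g ∈ Cong := by
  rw [mem_OEnr_iff_discr]
  constructor
  · rintro ⟨h, hx⟩
    exact ⟨h, (mem_Cong_iff ⟨g, h.1⟩).2 hx⟩
  · rintro ⟨h, hx⟩
    exact ⟨h, (mem_Cong_iff ⟨g, h.1⟩).1 hx⟩

theorem mem_SOEnr_iff (g : GL (Fin 6) ℤ) : g ∈ SOEnr ↔ g ∈ OEnr ∧ g.det = 1 := Iff.rfl

theorem IsLift.mem_SOEnr {g : GL (Fin 6) ℤ} {h : GL (Fin 2 ⊕ Fin 2) Eis} (H : IsLift g h) :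
    g ∈ SOEnr :=
  ⟨(mem_OEnr_iff g).2 ⟨H.mem_OPlus, H.mem_Cong⟩, H.det⟩

/-! ### Eisenstein integers -/

/-- The ring `ℤ[ω]` as a subalgebra of `ℂ`. -/
abbrev EisSub : Subalgebra ℤ ℂ := Algebra.adjoin ℤ {omega}

theorem omega_mem : omega ∈ EisSub := Algebra.subset_adjoin rfl

theorem mem_EisSub_iff {z : ℂ} : z ∈ EisSub ↔ ∃ a b : ℤ, z = a + b * omega := by
  constructor
  · intro h
    induction h using Algebra.adjoin_induction with
    | mem x hx => exact ⟨0, 1, by simpa using hx⟩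
    | algebraMap r => exact ⟨r, 0, by simp⟩
    | add x y _ _ hx hy =>
      obtain ⟨a, b, rfl⟩ := hx
      obtain ⟨c, d, rfl⟩ := hy
      exact ⟨a + c, b + d, by push_cast; ring⟩
    | mul x y _ _ hx hy =>
      obtain ⟨a, b, rfl⟩ := hx
      obtain ⟨c, d, rfl⟩ := hy
      refine ⟨a * c - b * d, a * d + b * c - b * d, ?_⟩
      push_cast
      linear_combination (b * d : ℂ) * omega_sq
  · rintro ⟨a, b, rfl⟩
    exact add_mem (intCast_mem _ a) (mul_mem (intCast_mem _ b) omega_mem)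

theorem star_eis (a b : ℤ) : star (a + b * omega : ℂ) = (a - b : ℤ) + (-b : ℤ) * omega := by
  rw [star_add, star_mul', star_omega]
  simp
  ring

theorem star_mem_EisSub {z : ℂ} (h : z ∈ EisSub) : star z ∈ EisSub := by
  obtain ⟨a, b, rfl⟩ := mem_EisSub_iff.1 h
  exact mem_EisSub_iff.2 ⟨_, _, star_eis a b⟩

theorem eis_inj {a b c d : ℤ} (h : (a + b * omega : ℂ) = c + d * omega) : a = c ∧ b = d := by
  have him : omega.im ≠ 0 := by
    rw [omega_eq]
    simp
  have h1 := congrArg Complex.im h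
  simp at h1
  rcases h1 with h1 | h1
  · subst h1
    exact ⟨by simpa using h, rfl⟩
  · exact absurd h1 him

theorem eis_eq_zero {a b : ℤ} (h : (a + b * omega : ℂ) = 0) : a = 0 ∧ b = 0 :=
  eis_inj (by simpa using h)

theorem exists_int_of_star_eq {z : ℂ} (h : z ∈ EisSub) (hs : star z = z) : ∃ n : ℤ, z = n := by
  obtain ⟨a, b, rfl⟩ := mem_EisSub_iff.1 h
  rw [star_eis] at hs
  obtain ⟨_, h2⟩ := eis_inj hs
  have : b = 0 := by omega
  exact ⟨a, by simp [this]⟩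

theorem star_mul_self_eis (a b : ℤ) :
    star (a + b * omega : ℂ) * (a + b * omega) = (a ^ 2 - a * b + b ^ 2 : ℤ) := by
  rw [star_eis]
  push_cast
  linear_combination (-b ^ 2 : ℂ) * omega_sq

/-- The ring of the `2 × 2` matrices with entries in `ℤ[ω]`. -/
abbrev EisMat : Subalgebra ℤ (Matrix (Fin 2) (Fin 2) ℂ) := EisSub.matrix

theorem conjTranspose_mem {A : Matrix (Fin 2) (Fin 2) ℂ} (h : A ∈ EisMat) : Aᴴ ∈ EisMat :=
  fun i j => star_mem_EisSub (h j i)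

theorem mem_EisMat_of {a b c d : ℂ} (ha : a ∈ EisSub) (hb : b ∈ EisSub) (hc : c ∈ EisSub)
    (hd : d ∈ EisSub) : !![a, b; c, d] ∈ EisMat := by
  intro i j
  fin_cases i <;> fin_cases j <;> assumption

theorem adjugate_mem {A : Matrix (Fin 2) (Fin 2) ℂ} (h : A ∈ EisMat) : A.adjugate ∈ EisMat := by
  rw [Matrix.adjugate_fin_two]
  exact mem_EisMat_of (h 1 1) (neg_mem (h 0 1)) (neg_mem (h 1 0)) (h 0 0)

theorem det_mem {A : Matrix (Fin 2) (Fin 2) ℂ} (h : A ∈ EisMat) : A.det ∈ EisSub := by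
  rw [Matrix.det_fin_two]
  exact sub_mem (mul_mem (h 0 0) (h 1 1)) (mul_mem (h 0 1) (h 1 0))

theorem psiMat_mem (r s x y : ℤ) : psiMat r s x y ∈ EisMat :=
  mem_EisMat_of (intCast_mem _ _) (add_mem (intCast_mem _ _) (mul_mem omega_mem (intCast_mem _ _)))
    (add_mem (intCast_mem _ _) (mul_mem (pow_mem omega_mem 2) (intCast_mem _ _)))
    (intCast_mem _ _)

theorem psiMat_conjTranspose (r s x y : ℤ) :
    (psiMat r s x y)ᴴ = psiMat r s x y := by
  have h1 : star (omega ^ 2) = omega := by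
    rw [omega_sq, star_sub, star_omega]
    simp
  have h2 : star omega = omega ^ 2 := by rw [star_omega, omega_sq]
  ext i j
  fin_cases i <;> fin_cases j <;> simp only [psiMat, Matrix.conjTranspose_apply, Fin.zero_eta,
    Fin.mk_one, Matrix.of_apply, Matrix.cons_val', Matrix.cons_val_zero, Matrix.cons_val_one,
    Matrix.cons_val_fin_one, star_add, star_mul', h1, h2, star_intCast]

theorem exists_psiMat_int {S : Matrix (Fin 2) (Fin 2) ℂ} (h : S ∈ EisMat) (hS : Sᴴ = S) :
    ∃ r s x y : ℤ, S = psiMat r s x y := by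
  obtain ⟨r, hr⟩ := exists_int_of_star_eq (h 0 0) (congrFun (congrFun hS 0) 0)
  obtain ⟨s, hs⟩ := exists_int_of_star_eq (h 1 1) (congrFun (congrFun hS 1) 1)
  obtain ⟨x, y, hxy⟩ := mem_EisSub_iff.1 (h 0 1)
  refine ⟨r, s, x, y, ?_⟩
  have h10 : S 1 0 = star (S 0 1) := (congrFun (congrFun hS 1) 0).symm
  rw [hxy, star_eis] at h10
  ext i j
  fin_cases i <;> fin_cases j
  · exact hr
  · simp [psiMat, hxy, mul_comm]
  · simp [psiMat, h10, omega_sq]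
    ring
  · exact hs

/-! ### Elements of the congruence subgroup in block form -/

/-- `[A, B; C, D]` is an element of `HΓ₁(2)`. -/
structure IsBlock (A B C D : Matrix (Fin 2) (Fin 2) ℂ) : Prop where
  exists_A : ∃ A' ∈ EisMat, A = 1 + (2 : ℂ) • A'
  memB : B ∈ EisMat
  exists_C : ∃ C' ∈ EisMat, C = (2 : ℂ) • C'
  memD : D ∈ EisMat
  eq₁₁ : Aᴴ * C = Cᴴ * A
  eq₁₂ : Aᴴ * D - Cᴴ * B = 1
  eq₂₂ : Bᴴ * D = Dᴴ * B

theorem two_smul_mem {A : Matrix (Fin 2) (Fin 2) ℂ} (h : A ∈ EisMat) : (2 : ℂ) • A ∈ EisMat := by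
  rw [two_smul]
  exact add_mem h h

theorem unitary_iff (A B C D : Matrix (Fin 2) (Fin 2) ℂ) :
    (Matrix.fromBlocks A B C D)ᴴ * J * Matrix.fromBlocks A B C D = J ↔
      Aᴴ * C = Cᴴ * A ∧ Aᴴ * D - Cᴴ * B = 1 ∧ Bᴴ * D = Dᴴ * B := by
  rw [J, Matrix.fromBlocks_conjTranspose, Matrix.fromBlocks_multiply, Matrix.fromBlocks_multiply,
    Matrix.fromBlocks_inj]
  simp only [mul_zero, mul_one, mul_neg, zero_add, add_zero, neg_mul]
  constructor
  · rintro ⟨h1, h2, h3, h4⟩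
    refine ⟨?_, ?_, ?_⟩
    · rw [← sub_eq_zero, ← h1]
      abel
    · rw [← h2]
      abel
    · rw [← sub_eq_zero, ← h4]
      abel
  · rintro ⟨h1, h2, h3⟩
    refine ⟨?_, ?_, ?_, ?_⟩
    · rw [h1]
      abel
    · rw [← h2]
      abel
    · rw [← Matrix.conjTranspose_one, ← h2]
      simp [Matrix.conjTranspose_mul]
      abel
    · rw [h3]
      abel

theorem modTwo_eq_zero_iff (z : Eis) : modTwo z = 0 ↔ ∃ w : Eis, z = 2 * w := by
  rw [Ideal.Quotient.eq_zero_iff_mem, Ideal.mem_span_singleton]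
  rfl

theorem map_modTwo_eq_iff (A B : Matrix (Fin 2) (Fin 2) Eis) :
    A.map modTwo = B.map modTwo ↔ ∃ A' ∈ EisMat, A.map (algebraMap Eis ℂ)
      = B.map (algebraMap Eis ℂ) + (2 : ℂ) • A' := by
  have key : A.map modTwo = B.map modTwo ↔ ∀ i j, ∃ w : Eis, A i j - B i j = 2 * w := by
    simp_rw [← modTwo_eq_zero_iff, map_sub, sub_eq_zero]
    exact Matrix.ext_iff.symm
  rw [key]
  constructor
  · intro h
    choose w hw using h
    refine ⟨Matrix.of fun i j => (w i j : ℂ), fun i j => (w i j).2, ?_⟩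
    ext i j
    have := congrArg Subtype.val (hw i j)
    exact eq_add_of_sub_eq' this
  · rintro ⟨A', hA', h⟩ i j
    refine ⟨⟨A' i j, hA' i j⟩, Subtype.ext ?_⟩
    have := congrFun (congrFun h i) j
    exact sub_eq_of_eq_add' this

theorem exists_block {h : GL (Fin 2 ⊕ Fin 2) Eis} (hh : h ∈ HGamma1) :
    ∃ A B C D, IsBlock A B C D ∧ (toGLC h).1 = Matrix.fromBlocks A B C D := by
  have hu : (toGLC h).1ᴴ * J * (toGLC h).1 = J := hh.1.1
  have e : (toGLC h).1 = h.1.map (algebraMap Eis ℂ) := rfl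
  have hb := (Matrix.fromBlocks_toBlocks (toGLC h).1)
  rw [← hb, unitary_iff] at hu
  refine ⟨_, _, _, _, ⟨?_, fun i j => Subtype.prop _, ?_, fun i j => Subtype.prop _, hu.1, hu.2.1,
    hu.2.2⟩, hb.symm⟩
  · have h1 : h.1.toBlocks₁₁.map modTwo = (1 : Matrix (Fin 2) (Fin 2) Eis).map modTwo := by
      rw [hh.2]
      simp
    obtain ⟨A', hA', e1⟩ := (map_modTwo_eq_iff _ _).1 h1
    refine ⟨A', hA', ?_⟩
    rw [Matrix.map_one _ (map_zero _) (map_one _)] at e1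
    exact e1
  · have h1 : h.1.toBlocks₂₁.map modTwo = (0 : Matrix (Fin 2) (Fin 2) Eis).map modTwo := by
      rw [hh.1.2]
      simp
    obtain ⟨A', hA', e1⟩ := (map_modTwo_eq_iff _ _).1 h1
    refine ⟨A', hA', ?_⟩
    rw [Matrix.map_zero _ (map_zero _), zero_add] at e1
    exact e1

theorem IsBlock.memA {A B C D : Matrix (Fin 2) (Fin 2) ℂ} (H : IsBlock A B C D) : A ∈ EisMat := by
  obtain ⟨A', hA', rfl⟩ := H.exists_A
  exact add_mem (one_mem _) (two_smul_mem hA')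

theorem IsBlock.memC {A B C D : Matrix (Fin 2) (Fin 2) ℂ} (H : IsBlock A B C D) : C ∈ EisMat := by
  obtain ⟨A', hA', rfl⟩ := H.exists_C
  exact two_smul_mem hA'

theorem IsBlock.exists_mem {A B C D : Matrix (Fin 2) (Fin 2) ℂ} (H : IsBlock A B C D) :
    ∃ h ∈ HGamma1, (toGLC h).1 = Matrix.fromBlocks A B C D := by
  have hmem : ∀ i j, Matrix.fromBlocks A B C D i j ∈ EisSub := by
    rintro (i | i) (j | j)
    exacts [H.memA i j, H.memB i j, H.memC i j, H.memD i j]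
  have hJ := (unitary_iff A B C D).2 ⟨H.eq₁₁, H.eq₁₂, H.eq₂₂⟩
  set M : Matrix (Fin 2 ⊕ Fin 2) (Fin 2 ⊕ Fin 2) Eis := Matrix.of fun i j => ⟨_, hmem i j⟩ with hM
  have e : M.map (algebraMap Eis ℂ) = Matrix.fromBlocks A B C D := rfl
  have hdet : algebraMap Eis ℂ M.det = (Matrix.fromBlocks A B C D).det := by
    rw [← e, ← RingHom.mapMatrix_apply, RingHom.map_det]
  have hJdet : J.det ≠ 0 := by
    have : J * -J = 1 := by
      rw [J, Matrix.fromBlocks_neg, Matrix.fromBlocks_multiply, ← Matrix.fromBlocks_one]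
      simp
    intro h
    have := congrArg Matrix.det this
    rw [Matrix.det_mul, h, zero_mul, Matrix.det_one] at this
    exact zero_ne_one this
  have h1 := congrArg Matrix.det hJ
  rw [Matrix.det_mul, Matrix.det_mul, Matrix.det_conjTranspose, mul_right_comm,
    mul_eq_right₀ hJdet, ← hdet] at h1
  -- Unitarity gives |det|² = 1, so the inverse of the determinant is its conjugate, which lies
  -- again in ℤ[ω].
  have hu : IsUnit M.det := by
    refine IsUnit.of_mul_eq_one ⟨star (algebraMap Eis ℂ M.det), star_mem_EisSub M.det.2⟩ ?_
    apply Subtype.ext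
    rw [mul_comm]
    exact h1
  refine ⟨Matrix.GeneralLinearGroup.mk'' M hu, ⟨⟨?_, ?_⟩, ?_⟩, rfl⟩
  · exact hJ
  · obtain ⟨C', hC', hC⟩ := H.exists_C
    have : M.toBlocks₂₁.map modTwo = (0 : Matrix (Fin 2) (Fin 2) Eis).map modTwo := by
      rw [map_modTwo_eq_iff]
      refine ⟨C', hC', ?_⟩
      rw [Matrix.map_zero _ (map_zero _), zero_add, ← hC]
      rfl
    rw [Matrix.map_zero _ (map_zero _)] at this
    exact this
  · obtain ⟨A', hA', hA⟩ := H.exists_A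
    have : M.toBlocks₁₁.map modTwo = (1 : Matrix (Fin 2) (Fin 2) Eis).map modTwo := by
      rw [map_modTwo_eq_iff]
      refine ⟨A', hA', ?_⟩
      rw [Matrix.map_one _ (map_zero _) (map_one _), ← hA]
      rfl
    rw [Matrix.map_one _ (map_zero _) (map_one _)] at this
    exact this

/-- A criterion for the existence of a lift with given blocks. -/
theorem IsBlock.exists_isLift {A B C D : Matrix (Fin 2) (Fin 2) ℂ} (H : IsBlock A B C D)
    {g : GL (Fin 6) ℤ} (hg : g ∈ OM) (hdet : g.det = 1) (hc : g ∈ Cong)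
    (hp : ∀ (z : Fin 6 → ℂ) (N E : Matrix (Fin 2) (Fin 2) ℂ), z 0 = E.det → z 1 = -2 * N.det →
      psiMat (z 2) (z 3) (z 4) (z 5) = N * E.adjugate →
      IsPluecker (onC g z) (Matrix.fromRows (A * N + B * E) (C * N + D * E))) :
    ∃ h, IsLift g h ∧ (toGLC h).1 = Matrix.fromBlocks A B C D := by
  obtain ⟨h, hh, e⟩ := H.exists_mem
  refine ⟨h, ⟨hg, hdet, hc, hh, ?_⟩, e⟩
  rintro z X ⟨c, hc, h0, h1, h2⟩
  -- Rescaling z turns the coordinates into the exact minors, so the criterion need only be checked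
  -- for a factor equal to 1.
  have h3 := hp (c • z) X.toRows₁ X.toRows₂ h0 h1 (by rw [← h2, smul_psiMat]; rfl)
  have h4 := h3.smul (inv_ne_zero hc)
  rw [onC_smul, smul_smul, inv_mul_cancel₀ hc, one_smul] at h4
  convert h4 using 1
  rw [e, ← Matrix.fromBlocks_mul_fromRows, Matrix.fromRows_toRows]

/-! ### Elementary lifts -/

/-- The action on `M` of the translation by the Hermitian matrix `[r, x + ω y; x + ω² y, s]`. -/
def upperMat (r s x y : ℤ) : Matrix (Fin 6) (Fin 6) ℤ :=
  !![1, 0, 0, 0, 0, 0;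
     -2 * (r * s - x ^ 2 + x * y - y ^ 2), 1, -2 * s, -2 * r, 2 * (2 * x - y), 2 * (2 * y - x);
     r, 0, 1, 0, 0, 0;
     s, 0, 0, 1, 0, 0;
     x, 0, 0, 0, 1, 0;
     y, 0, 0, 0, 0, 1]

/-- The conjugate of `upperMat r s x y` by the exchange of the first two coordinates. -/
def lowerMat (r s x y : ℤ) : Matrix (Fin 6) (Fin 6) ℤ :=
  !![1, -2 * (r * s - x ^ 2 + x * y - y ^ 2), -2 * s, -2 * r, 2 * (2 * x - y), 2 * (2 * y - x);
     0, 1, 0, 0, 0, 0;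
     0, r, 1, 0, 0, 0;
     0, s, 0, 1, 0, 0;
     0, x, 0, 0, 1, 0;
     0, y, 0, 0, 0, 1]

theorem upperMat_mulVec {R : Type*} [CommRing R] (r s x y : ℤ) (v : Fin 6 → R) :
    (upperMat r s x y).map (Int.cast : ℤ → R) *ᵥ v =
      ![v 0, v 1 - 2 * (r * s - x ^ 2 + x * y - y ^ 2) * v 0 - 2 * s * v 2 - 2 * r * v 3
        + 2 * (2 * x - y) * v 4 + 2 * (2 * y - x) * v 5,
        v 2 + r * v 0, v 3 + s * v 0, v 4 + x * v 0, v 5 + y * v 0] := by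
  ext i
  fin_cases i <;> simp [upperMat, Matrix.mulVec, dotProduct, Fin.sum_univ_succ] <;> ring

theorem lowerMat_mulVec {R : Type*} [CommRing R] (r s x y : ℤ) (v : Fin 6 → R) :
    (lowerMat r s x y).map (Int.cast : ℤ → R) *ᵥ v =
      ![v 0 - 2 * (r * s - x ^ 2 + x * y - y ^ 2) * v 1 - 2 * s * v 2 - 2 * r * v 3
        + 2 * (2 * x - y) * v 4 + 2 * (2 * y - x) * v 5,
        v 1, v 2 + r * v 1, v 3 + s * v 1, v 4 + x * v 1, v 5 + y * v 1] := by
  ext i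
  fin_cases i <;> simp [lowerMat, Matrix.mulVec, dotProduct, Fin.sum_univ_succ] <;> ring

theorem map_intCast_self {n : Type*} (M : Matrix n n ℤ) : M.map (Int.cast : ℤ → ℤ) = M := by
  ext
  simp

theorem det_upperMat (r s x y : ℤ) : (upperMat r s x y).det = 1 := by
  simp [upperMat, Matrix.det_succ_row_zero, Fin.sum_univ_succ, Fin.succAbove, Matrix.submatrix]

theorem det_lowerMat (r s x y : ℤ) : (lowerMat r s x y).det = 1 := by
  simp [lowerMat, Matrix.det_succ_column_zero, Fin.sum_univ_succ, Fin.succAbove, Matrix.submatrix]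

/-- The entries of `psiMat`. -/
theorem psiMat_eq {a d x y : ℂ} {S : Matrix (Fin 2) (Fin 2) ℂ} : psiMat a d x y = S ↔
    a = S 0 0 ∧ d = S 1 1 ∧ x + omega * y = S 0 1 ∧ x + (-1 - omega) * y = S 1 0 := by
  rw [← omega_sq]
  constructor
  · rintro rfl
    exact ⟨rfl, rfl, rfl, rfl⟩
  · rintro ⟨h1, h2, h3, h4⟩
    ext i j
    fin_cases i <;> fin_cases j
    exacts [h1, h3, h4, h2]

/-- With S the Hermitian matrix of r, s, x, y, the block matrix [1, S; 0, 1] replaces N by N + SE,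
so that N · adj E becomes N · adj E + (det E) S. This is the addition of z₁ S seen in the last four
coordinates. -/
theorem exists_upper (r s x y : ℤ) : ∃ g ∈ Lift, ∀ v : Fin 6 → ℤ, g.1 *ᵥ v =
    ![v 0, v 1 - 2 * (r * s - x ^ 2 + x * y - y ^ 2) * v 0 - 2 * s * v 2 - 2 * r * v 3
        + 2 * (2 * x - y) * v 4 + 2 * (2 * y - x) * v 5,
        v 2 + r * v 0, v 3 + s * v 0, v 4 + x * v 0, v 5 + y * v 0] := by
  have hv : ∀ v : Fin 6 → ℤ, _ := fun v => upperMat_mulVec r s x y v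
  rw [map_intCast_self] at hv
  obtain ⟨g, hg, e⟩ := exists_OM (upperMat r s x y) (by
    intro v
    rw [hv]
    simp only [quad, Matrix.cons_val, Int.cast_id]
    ring)
  have hdet : g.det = 1 := Units.ext (by
    rw [Matrix.GeneralLinearGroup.val_det_apply, e, det_upperMat, Units.val_one])
  have hcong : g ∈ Cong := by
    rintro v ⟨a, ha⟩ ⟨b, hb⟩ i
    rw [e, hv]
    fin_cases i
    · simp
    · exact ⟨- 2 * (r * s - x ^ 2 + x * y - y ^ 2) * a - s * v 2 - r * v 3
        + (2 * x - y) * v 4 + (2 * y - x) * v 5, by simp [ha]; ring⟩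
    all_goals simp [ha]
    all_goals exact Dvd.dvd.mul_left (dvd_mul_right _ _) _
  have H : IsBlock 1 (psiMat r s x y) 0 1 :=
    ⟨⟨0, zero_mem _, by simp⟩, psiMat_mem r s x y, ⟨0, zero_mem _, by simp⟩, one_mem _,
      by simp, by simp, by simp [psiMat_conjTranspose]⟩
  refine ⟨g, ?_, by rw [e]; exact hv⟩
  obtain ⟨h, hh, _⟩ := H.exists_isLift hg hdet hcong fun z N E h0 h1 h2 => by
    rw [psiMat_eq] at h2
    obtain ⟨h2, h3, h4, h5⟩ := h2
    rw [onC, e, upperMat_mulVec]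
    simp only [Matrix.mul_apply, Fin.sum_univ_two, Matrix.adjugate_fin_two, Matrix.of_apply,
      Matrix.cons_val', Matrix.cons_val_zero, Matrix.cons_val_one, Matrix.cons_val_fin_one,
      Matrix.det_fin_two] at h0 h1 h2 h3 h4 h5
    refine ⟨1, one_ne_zero, ?_, ?_, ?_⟩
    · simp [h0, Matrix.det_fin_two]
    · simp only [Matrix.toRows₁_fromRows, Matrix.det_fin_two, Matrix.add_apply, Matrix.one_mul,
        Matrix.mul_apply, Fin.sum_univ_two, psiMat, omega_sq, Matrix.of_apply, Matrix.cons_val',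
        Matrix.cons_val_zero, Matrix.cons_val_one, Matrix.cons_val_fin_one]
      linear_combination h1 - 2 * (r * s - x ^ 2 + x * y - y ^ 2) * h0 - 2 * s * h2 - 2 * r * h3
        + 2 * (x + omega * y) * h5 + 2 * (x + (-1 - omega) * y) * h4
        + (4 * y * z 5 + 2 * y ^ 2 * (E 0 0 * E 1 1 - E 0 1 * E 1 0)) * omega_sq
    · rw [one_smul, psiMat_eq]
      simp only [Matrix.toRows₁_fromRows, Matrix.toRows₂_fromRows, Matrix.adjugate_fin_two,
        Matrix.add_apply, Matrix.one_mul, Matrix.zero_mul, zero_add,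
        Matrix.mul_apply, Fin.sum_univ_two, psiMat, omega_sq, Matrix.of_apply, Matrix.cons_val',
        Matrix.cons_val_zero, Matrix.cons_val_one, Matrix.cons_val_fin_one, Matrix.cons_val]
      refine ⟨?_, ?_, ?_, ?_⟩
      · linear_combination h2 + r * h0
      · linear_combination h3 + s * h0
      · linear_combination h4 + (x + omega * y) * h0
      · linear_combination h5 + (x + (-1 - omega) * y) * h0
  exact ⟨h, hh⟩

/-- The lower left block is C = -2 adj S for the Hermitian matrix S of r, s, x, y, whence the
exchange and the signs of r and s. Indeed N · adj(CN + E) = N · adj E + (det N) adj C, and (det N)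
adj C = -2 (det N) S is z₂ S. The factor 2 in z₂ = -2 det N is the one that makes C even. -/
theorem exists_lower (r s x y : ℤ) : ∃ g h, IsLift g h ∧ (∀ v : Fin 6 → ℤ, g.1 *ᵥ v =
    ![v 0 - 2 * (r * s - x ^ 2 + x * y - y ^ 2) * v 1 - 2 * s * v 2 - 2 * r * v 3
        + 2 * (2 * x - y) * v 4 + 2 * (2 * y - x) * v 5,
        v 1, v 2 + r * v 1, v 3 + s * v 1, v 4 + x * v 1, v 5 + y * v 1]) ∧
    (toGLC h).1 = Matrix.fromBlocks 1 0 ((2 : ℂ) • psiMat (-s : ℤ) (-r : ℤ) x y) 1 := by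
  have hv : ∀ v : Fin 6 → ℤ, _ := fun v => lowerMat_mulVec r s x y v
  rw [map_intCast_self] at hv
  obtain ⟨g, hg, e⟩ := exists_OM (lowerMat r s x y) (by
    intro v
    rw [hv]
    simp only [quad, Matrix.cons_val, Int.cast_id]
    ring)
  have hdet : g.det = 1 := Units.ext (by
    rw [Matrix.GeneralLinearGroup.val_det_apply, e, det_lowerMat, Units.val_one])
  have hcong : g ∈ Cong := by
    rintro v ⟨a, ha⟩ ⟨b, hb⟩ i
    rw [e, hv]
    fin_cases i
    · exact ⟨- 2 * (r * s - x ^ 2 + x * y - y ^ 2) * b - s * v 2 - r * v 3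
        + (2 * x - y) * v 4 + (2 * y - x) * v 5, by simp [hb]; ring⟩
    · simp
    all_goals simp [hb]
    all_goals exact Dvd.dvd.mul_left (dvd_mul_right _ _) _
  have H : IsBlock 1 0 ((2 : ℂ) • psiMat (-s : ℤ) (-r : ℤ) x y) 1 :=
    ⟨⟨0, zero_mem _, by simp⟩, zero_mem _, ⟨_, psiMat_mem (-s) (-r) x y, rfl⟩, one_mem _,
      by simp [Matrix.conjTranspose_smul, psiMat_conjTranspose (-s) (-r) x y,
        -Int.cast_neg], by simp, by simp⟩
  obtain ⟨h, hh, eh⟩ := H.exists_isLift hg hdet hcong fun z N E h0 h1 h2 => by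
    rw [psiMat_eq] at h2
    obtain ⟨h2, h3, h4, h5⟩ := h2
    rw [onC, e, lowerMat_mulVec]
    simp only [Matrix.mul_apply, Fin.sum_univ_two, Matrix.adjugate_fin_two, Matrix.of_apply,
      Matrix.cons_val', Matrix.cons_val_zero, Matrix.cons_val_one, Matrix.cons_val_fin_one,
      Matrix.det_fin_two] at h0 h1 h2 h3 h4 h5
    refine ⟨1, one_ne_zero, ?_, ?_, ?_⟩
    · simp only [Matrix.toRows₂_fromRows, Matrix.det_fin_two, Matrix.add_apply, Matrix.one_mul,
        Matrix.mul_apply, Fin.sum_univ_two, psiMat, omega_sq, Matrix.of_apply, Matrix.cons_val',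
        Matrix.cons_val_zero, Matrix.cons_val_one, Matrix.cons_val_fin_one, Matrix.smul_apply,
        smul_eq_mul, Int.cast_neg]
      linear_combination h0 - 2 * (r * s - x ^ 2 + x * y - y ^ 2) * h1 - 2 * s * h2 - 2 * r * h3
        + 2 * (x + omega * y) * h5 + 2 * (x + (-1 - omega) * y) * h4
        + (4 * y * z 5 - 4 * y ^ 2 * (N 0 0 * N 1 1 - N 0 1 * N 1 0)) * omega_sq
    · simp [h1, Matrix.det_fin_two]
    · rw [one_smul, psiMat_eq]
      simp only [Matrix.toRows₁_fromRows, Matrix.toRows₂_fromRows, Matrix.adjugate_fin_two,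
        Matrix.add_apply, Matrix.one_mul, Matrix.zero_mul, add_zero, Matrix.smul_apply,
        smul_eq_mul, Int.cast_neg,
        Matrix.mul_apply, Fin.sum_univ_two, psiMat, omega_sq, Matrix.of_apply, Matrix.cons_val',
        Matrix.cons_val_zero, Matrix.cons_val_one, Matrix.cons_val_fin_one, Matrix.cons_val]
      refine ⟨?_, ?_, ?_, ?_⟩
      · linear_combination h2 + r * h1
      · linear_combination h3 + s * h1
      · linear_combination h4 + (x + omega * y) * h1
      · linear_combination h5 + (x + (-1 - omega) * y) * h1
  exact ⟨g, h, hh, by rw [e]; exact hv, eh⟩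

/-- The action on `M` of the linear map `S ↦ A S A*` of Hermitian matrices, where
`A = [a + a' ω, b + b' ω; c + c' ω, d + d' ω]`. -/
def conjMat (a a' b b' c c' d d' : ℤ) : Matrix (Fin 6) (Fin 6) ℤ :=
  !![1, 0, 0, 0, 0, 0;
     0, 1, 0, 0, 0, 0;
     0, 0, a ^ 2 - a * a' + a' ^ 2, b ^ 2 - b * b' + b' ^ 2,
       2 * (a * b - a * b' + a' * b') - (a' * b - a * b'),
       -(a * b - a * b' + a' * b') - (a' * b - a * b');
     0, 0, c ^ 2 - c * c' + c' ^ 2, d ^ 2 - d * d' + d' ^ 2,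
       2 * (c * d - c * d' + c' * d') - (c' * d - c * d'),
       -(c * d - c * d' + c' * d') - (c' * d - c * d');
     0, 0, a * c - a * c' + a' * c', b * d - b * d' + b' * d',
       (a * d - a * d' + a' * d') + (b * c - b * c' + b' * c'),
       -(a' * d - a * d') + (b' * c - b * c') - (b * c - b * c' + b' * c');
     0, 0, a' * c - a * c', b' * d - b * d', (a' * d - a * d') + (b' * c - b * c'),
       (a * d - a * d' + a' * d') - (a' * d - a * d') - (b * c - b * c' + b' * c')]

theorem psiMat_conj (a a' b b' c c' d d' : ℤ) (z : Fin 6 → ℂ) :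
    psiMat (((conjMat a a' b b' c c' d d').map (Int.cast : ℤ → ℂ) *ᵥ z) 2)
      (((conjMat a a' b b' c c' d d').map (Int.cast : ℤ → ℂ) *ᵥ z) 3)
      (((conjMat a a' b b' c c' d d').map (Int.cast : ℤ → ℂ) *ᵥ z) 4)
      (((conjMat a a' b b' c c' d d').map (Int.cast : ℤ → ℂ) *ᵥ z) 5) =
    !![a + a' * omega, b + b' * omega; c + c' * omega, d + d' * omega] *
      psiMat (z 2) (z 3) (z 4) (z 5) *
      (!![a + a' * omega, b + b' * omega; c + c' * omega, d + d' * omega])ᴴ := by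
  have h3 : omega ^ 3 = 1 := by linear_combination (omega - 1) * omega_sq
  rw [psiMat_eq]
  simp only [Matrix.mul_apply, Fin.sum_univ_two, psiMat, omega_sq, Matrix.of_apply,
    Matrix.cons_val', Matrix.cons_val_zero, Matrix.cons_val_one, Matrix.cons_val_fin_one,
    Matrix.conjTranspose_apply, star_eis]
  simp only [Matrix.mulVec, dotProduct, Fin.sum_univ_six, conjMat, Matrix.map_apply,
    Matrix.of_apply, Matrix.cons_val]
  push_cast
  refine ⟨?_, ?_, ?_, ?_⟩ <;> ring_nf <;> simp only [h3, omega_sq] <;> ring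

/-- Writing M = 1 + 2T gives det M ≡ 1 + 2 tr T modulo 4, while tr M = 6 + 2 tr T. The trace modulo
4 therefore distinguishes determinant 1 from -1, which avoids expanding a 6 × 6 determinant. -/
theorem det_eq_one_of_congr {M : Matrix (Fin 6) (Fin 6) ℤ} (h : IsUnit M.det)
    (hM : ∀ i j, 2 ∣ (M - 1) i j) (ht : 4 ∣ M.trace - 2) : M.det = 1 := by
  choose T hT using hM
  have e : M = 1 + (2 : ℤ) • (Matrix.of T) := by
    ext i j
    have := hT i j
    simp only [Matrix.sub_apply, Matrix.add_apply, Matrix.smul_apply, Matrix.of_apply,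
      smul_eq_mul] at this ⊢
    linarith
  have h1 := Matrix.det_one_add_smul (2 : ℤ) (Matrix.of T)
  rw [← e] at h1
  have h2 : M.trace = 6 + 2 * (Matrix.of T).trace := by
    rw [e, Matrix.trace_add, Matrix.trace_smul, Matrix.trace_one]
    simp
  rcases Int.isUnit_iff.1 h with h | h
  · exact h
  · exfalso
    obtain ⟨k, hk⟩ := ht
    omega

/-- The map S ↦ A S A* multiplies det S by |det A|² = 1, so it is an isometry. Here δ adj(A)* is the
inverse of A*, and det A = δ is also the scalar by which the minors of the transformed matrix differ
from the transformed coordinates. -/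
theorem exists_conj {A : Matrix (Fin 2) (Fin 2) ℂ} (hA : ∃ A' ∈ EisMat, A = 1 + (2 : ℂ) • A')
    {δ : ℤ} (hδ : δ = 1 ∨ δ = -1) (hdet : A.det = δ) :
    ∃ g h, IsLift g h ∧ (∀ v : Fin 6 → ℤ, (g.1 *ᵥ v) 0 = v 0 ∧ (g.1 *ᵥ v) 1 = v 1 ∧
      psiMat ((g.1 *ᵥ v) 2 : ℤ) ((g.1 *ᵥ v) 3 : ℤ) ((g.1 *ᵥ v) 4 : ℤ) ((g.1 *ᵥ v) 5 : ℤ) =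
        A * psiMat (v 2) (v 3) (v 4) (v 5) * Aᴴ) ∧
      (toGLC h).1 = Matrix.fromBlocks A 0 0 ((δ : ℂ) • A.adjugateᴴ) := by
  have hδ2 : (δ : ℂ) * δ = 1 := by rcases hδ with rfl | rfl <;> simp
  have hδs : star (δ : ℂ) = δ := star_intCast δ
  have hδ0 : (δ : ℂ) ≠ 0 := left_ne_zero_of_mul_eq_one hδ2
  obtain ⟨A', hA', rfl⟩ := hA
  obtain ⟨a, a', ha⟩ := mem_EisSub_iff.1 (hA' 0 0)
  obtain ⟨b, b', hb⟩ := mem_EisSub_iff.1 (hA' 0 1)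
  obtain ⟨c, c', hc⟩ := mem_EisSub_iff.1 (hA' 1 0)
  obtain ⟨d, d', hd⟩ := mem_EisSub_iff.1 (hA' 1 1)
  set A := 1 + (2 : ℂ) • A' with hA
  set M := conjMat (1 + 2 * a) (2 * a') (2 * b) (2 * b') (2 * c) (2 * c') (1 + 2 * d) (2 * d')
    with hM
  have eA : A = !![((1 + 2 * a : ℤ) : ℂ) + (2 * a' : ℤ) * omega, (2 * b : ℤ) + (2 * b' : ℤ) * omega;
      (2 * c : ℤ) + (2 * c' : ℤ) * omega, (1 + 2 * d : ℤ) + (2 * d' : ℤ) * omega] := by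
    ext i j
    fin_cases i <;> fin_cases j <;> simp [hA, ha, hb, hc, hd] <;> ring
  have hψ : ∀ z : Fin 6 → ℂ, psiMat ((M.map (Int.cast : ℤ → ℂ) *ᵥ z) 2)
      ((M.map (Int.cast : ℤ → ℂ) *ᵥ z) 3) ((M.map (Int.cast : ℤ → ℂ) *ᵥ z) 4)
      ((M.map (Int.cast : ℤ → ℂ) *ᵥ z) 5) = A * psiMat (z 2) (z 3) (z 4) (z 5) * Aᴴ := by
    intro z
    rw [eA]
    exact psiMat_conj _ _ _ _ _ _ _ _ z
  have hcast : ∀ v : Fin 6 → ℤ, M.map (Int.cast : ℤ → ℂ) *ᵥ (fun i => (v i : ℂ))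
      = fun i => ((M *ᵥ v) i : ℂ) := by
    intro v
    ext i
    simp [Matrix.mulVec, dotProduct]
  have hψ' : ∀ v : Fin 6 → ℤ, psiMat ((M *ᵥ v) 2 : ℤ) ((M *ᵥ v) 3 : ℤ) ((M *ᵥ v) 4 : ℤ)
      ((M *ᵥ v) 5 : ℤ) = A * psiMat (v 2) (v 3) (v 4) (v 5) * Aᴴ := by
    intro v
    have := hψ (fun i => (v i : ℂ))
    rwa [hcast] at this
  have h0 : ∀ {R : Type} [CommRing R] (z : Fin 6 → R), (M.map (Int.cast : ℤ → R) *ᵥ z) 0 = z 0 := by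
    intro R _ z
    simp [hM, conjMat, Matrix.mulVec, dotProduct, Fin.sum_univ_succ]
  have h1 : ∀ {R : Type} [CommRing R] (z : Fin 6 → R), (M.map (Int.cast : ℤ → R) *ᵥ z) 1 = z 1 := by
    intro R _ z
    simp [hM, conjMat, Matrix.mulVec, dotProduct, Fin.sum_univ_succ]
  have h0' : ∀ v : Fin 6 → ℤ, (M *ᵥ v) 0 = v 0 := by
    intro v
    have := h0 v
    rwa [map_intCast_self] at this
  have h1' : ∀ v : Fin 6 → ℤ, (M *ᵥ v) 1 = v 1 := by
    intro v
    have := h1 v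
    rwa [map_intCast_self] at this
  obtain ⟨g, hg, e⟩ := exists_OM M (by
    intro v
    have h2 := congrArg Matrix.det (hψ' v)
    rw [Matrix.det_mul, Matrix.det_mul, Matrix.det_conjTranspose, hdet, hδs, mul_right_comm, hδ2,
      one_mul, det_psiMat, det_psiMat] at h2
    rw [quad, quad, h0', h1']
    have h3 : (M *ᵥ v) 2 * (M *ᵥ v) 3 - (M *ᵥ v) 4 ^ 2 + (M *ᵥ v) 4 * (M *ᵥ v) 5
        - (M *ᵥ v) 5 ^ 2 = v 2 * v 3 - v 4 ^ 2 + v 4 * v 5 - v 5 ^ 2 := by exact_mod_cast h2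
    rw [h3])
  have hmod : ∀ i j, 2 ∣ (M - 1) i j := by
    intro i j
    refine (ZMod.intCast_zmod_eq_zero_iff_dvd _ 2).1 ?_
    have h2 : (2 : ZMod 2) = 0 := rfl
    have hn : (-1 : ZMod 2) = 1 := rfl
    fin_cases i <;> fin_cases j <;> simp [hM, conjMat, h2]
  have hdet1 : M.det = 1 := by
    refine det_eq_one_of_congr ?_ hmod ?_
    · rw [← e]
      exact Matrix.isUnits_det_units g
    -- The trace of S ↦ A S A* is |tr A|², and tr A = 2((1 + a + d) + (a' + d')ω); the two fixed
    -- coordinates contribute the remaining 2.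
    · refine ⟨(1 + a + d) ^ 2 - (1 + a + d) * (a' + d') + (a' + d') ^ 2, ?_⟩
      simp only [Matrix.trace, Fin.sum_univ_six, Matrix.diag_apply, hM, conjMat, Matrix.of_apply,
        Matrix.cons_val]
      ring
  have hgdet : g.det = 1 := Units.ext (by
    rw [Matrix.GeneralLinearGroup.val_det_apply, e, hdet1, Units.val_one])
  have hcong : g ∈ Cong := by
    intro v _ _ i
    have h2 : (g.1 *ᵥ v) i - v i = ((M - 1) *ᵥ v) i := by
      rw [e, Matrix.sub_mulVec, Matrix.one_mulVec]
      rfl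
    rw [h2, Matrix.mulVec, dotProduct]
    exact Finset.dvd_sum fun j _ => Dvd.dvd.mul_right (hmod i j) (v j)
  have hAm : A ∈ EisMat := add_mem (one_mem _) (two_smul_mem hA')
  have hadj : Aᴴ * A.adjugateᴴ = (δ : ℂ) • 1 := by
    rw [← Matrix.conjTranspose_mul, Matrix.adjugate_mul, hdet, Matrix.conjTranspose_smul,
      Matrix.conjTranspose_one, hδs]
  have H : IsBlock A 0 0 ((δ : ℂ) • A.adjugateᴴ) := by
    refine ⟨⟨A', hA', rfl⟩, zero_mem _, ⟨0, zero_mem _, by simp⟩, ?_, by simp, ?_, by simp⟩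
    · intro i j
      exact EisSub.mul_mem (intCast_mem _ δ) (conjTranspose_mem (adjugate_mem hAm) i j)
    · rw [Matrix.mul_smul, hadj, smul_smul, hδ2]
      simp
  obtain ⟨h, hh, eh⟩ := H.exists_isLift hg hgdet hcong fun z N E e0 e1 e2 => by
    rw [onC, e]
    refine ⟨δ, hδ0, ?_, ?_, ?_⟩
    · rw [h0, e0, Matrix.toRows₂_fromRows, Matrix.zero_mul, zero_add, Matrix.det_mul,
        Matrix.det_smul, Matrix.det_conjTranspose, Matrix.det_adjugate, hdet]
      simp [sq, hδ2]
    · rw [h1, e1, Matrix.toRows₁_fromRows, Matrix.zero_mul, add_zero, Matrix.det_mul, hdet]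
      ring
    · rw [hψ, e2, Matrix.toRows₁_fromRows, Matrix.toRows₂_fromRows, Matrix.zero_mul, add_zero,
        Matrix.zero_mul, zero_add, Matrix.adjugate_mul_distrib, Matrix.adjugate_smul,
        Matrix.adjugate_conjTranspose, Matrix.adjugate_adjugate']
      simp [Matrix.mul_assoc]
  exact ⟨g, h, hh, fun v => by rw [e]; exact ⟨h0' v, h1' v, hψ' v⟩, eh⟩

/-! ### Reduction of isotropic vectors -/

theorem eq_zero_of_norm_eq_zero {x y : ℤ} (h : x ^ 2 - x * y + y ^ 2 = 0) : x = 0 ∧ y = 0 := by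
  have hy : y = 0 := by
    by_contra hy
    have : 0 < y ^ 2 := by positivity
    nlinarith [sq_nonneg (2 * x - y)]
  subst hy
  exact ⟨by simpa using h, rfl⟩

theorem norm_nonneg (x y : ℤ) : 0 ≤ x ^ 2 - x * y + y ^ 2 := by
  nlinarith [sq_nonneg (2 * x - y), sq_nonneg y]

theorem exists_abs_le {p : ℤ} (hp : 0 < p) (x : ℤ) : ∃ k, -p ≤ 2 * (x + p * k) ∧
    2 * (x + p * k) ≤ p := by
  refine ⟨-((2 * x + p) / (2 * p)), ?_⟩
  have h1 := Int.emod_add_mul_ediv (2 * x + p) (2 * p)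
  have h2 := Int.emod_nonneg (2 * x + p) (by omega : 2 * p ≠ 0)
  have h3 := Int.emod_lt_of_pos (2 * x + p) (by omega : 0 < 2 * p)
  constructor <;> nlinarith

/-- The covering radius of `ℤ[ω]`. -/
theorem exists_norm_le {p : ℤ} (hp : 0 < p) (x y : ℤ) : ∃ k l,
    3 * ((x + p * k) ^ 2 - (x + p * k) * (y + p * l) + (y + p * l) ^ 2) ≤ p ^ 2 := by
  obtain ⟨k, hk1, hk2⟩ := exists_abs_le hp x
  obtain ⟨l, hl1, hl2⟩ := exists_abs_le hp y
  -- three points of the lattice around a point of an equilateral triangle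
  have tri : ∀ u v : ℤ, 0 ≤ u → 0 ≤ v → 2 * u ≤ p → 2 * v ≤ p →
      3 * (u ^ 2 + u * v + v ^ 2) ≤ p ^ 2 ∨
      3 * ((p - u) ^ 2 - (p - u) * v + v ^ 2) ≤ p ^ 2 ∨
      3 * (u ^ 2 - u * (p - v) + (p - v) ^ 2) ≤ p ^ 2 := by
    intro u v hu hv hu' hv'
    -- Up to the scale p, the numbers a, u, v are barycentric coordinates in an equilateral triangle
    -- of lattice points, and the three alternatives are the squared distances to its vertices. The
    -- vertex with the largest weight is close enough.
    obtain ⟨a, ha⟩ : ∃ a, a = p - u - v := ⟨_, rfl⟩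
    have hp' : p = a + u + v := by omega
    have ha0 : 0 ≤ a := by omega
    subst hp'
    rcases le_total u v with h1 | h1
    · rcases le_total v a with h2 | h2
      · left
        nlinarith [mul_nonneg hu (sub_nonneg.2 (h1.trans h2)), mul_nonneg hv (sub_nonneg.2 h2),
          mul_nonneg ha0 (sub_nonneg.2 (h1.trans h2)), mul_nonneg ha0 (sub_nonneg.2 h2),
          mul_nonneg hu (sub_nonneg.2 h2)]
      · right; right
        nlinarith [mul_nonneg hu (sub_nonneg.2 h1), mul_nonneg hv (sub_nonneg.2 h1),
          mul_nonneg ha0 (sub_nonneg.2 h2), mul_nonneg hv (sub_nonneg.2 h2),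
          mul_nonneg ha0 (sub_nonneg.2 h1), mul_nonneg hu (sub_nonneg.2 h2)]
    · rcases le_total u a with h2 | h2
      · left
        nlinarith [mul_nonneg hv (sub_nonneg.2 (h1.trans h2)), mul_nonneg hu (sub_nonneg.2 h2),
          mul_nonneg ha0 (sub_nonneg.2 (h1.trans h2)), mul_nonneg ha0 (sub_nonneg.2 h2),
          mul_nonneg hv (sub_nonneg.2 h2)]
      · right; left
        nlinarith [mul_nonneg hv (sub_nonneg.2 h1), mul_nonneg hu (sub_nonneg.2 h1),
          mul_nonneg ha0 (sub_nonneg.2 h2), mul_nonneg hu (sub_nonneg.2 h2),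
          mul_nonneg ha0 (sub_nonneg.2 h1), mul_nonneg hv (sub_nonneg.2 h2)]
  -- For coordinates of the same sign the norm is at most the square of the larger one, so at most
  -- p²/4, and no shift is needed.
  have same : ∀ u v : ℤ, 0 ≤ u → 0 ≤ v → 2 * u ≤ p → 2 * v ≤ p →
      3 * (u ^ 2 - u * v + v ^ 2) ≤ p ^ 2 := by
    intro u v hu hv hu' hv'
    rcases le_total u v with h | h
    · nlinarith [mul_nonneg hu (sub_nonneg.2 h)]
    · nlinarith [mul_nonneg hv (sub_nonneg.2 h)]
  rcases le_total 0 (x + p * k) with hx | hx <;> rcases le_total 0 (y + p * l) with hy | hy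
  · exact ⟨k, l, same _ _ hx hy hk2 hl2⟩
  · rcases tri (x + p * k) (-(y + p * l)) hx (by omega) hk2 (by omega) with h | h | h
    · exact ⟨k, l, by linarith⟩
    · exact ⟨k - 1, l, by linarith⟩
    · exact ⟨k, l + 1, by linarith⟩
  · rcases tri (-(x + p * k)) (y + p * l) (by omega) hy (by omega) hl2 with h | h | h
    · exact ⟨k, l, by linarith⟩
    · exact ⟨k + 1, l, by linarith⟩
    · exact ⟨k, l - 1, by linarith⟩
  · have := same (-(x + p * k)) (-(y + p * l)) (by omega) (by omega) (by omega) (by omega)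
    exact ⟨k, l, by linarith⟩

/-- Here r and t are the absolute values of diagonal entries of opposite signs. If the determinant
is too large, then rt ≥ p²/6 because n ≤ p²/3, so r ≥ p/3. Shifting the entry of absolute value r by
p towards the other sign gives a product (p - r)t between 0 and p²/3, from which n is now
subtracted. -/
theorem abs_flip_lt {p r t n : ℤ} (hp : 0 < p) (hr : 0 ≤ r) (ht : 0 ≤ t)
    (ht' : 2 * t ≤ p) (hr' : 2 * r ≤ p) (hn : 0 ≤ n) (hn' : 3 * n ≤ p ^ 2)
    (h : p ^ 2 ≤ 2 * (n + r * t)) : t ≠ 0 ∧ 2 * |(p - r) * t - n| < p ^ 2 := by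
  have hp2 : 0 < p ^ 2 := by positivity
  have h1 : p ^ 2 ≤ 6 * (r * t) := by linarith
  have h2 : p ≤ 3 * r := by nlinarith
  have h3 : 3 * ((p - r) * t) ≤ p ^ 2 := by nlinarith
  have h4 : 0 ≤ (p - r) * t := mul_nonneg (by omega) ht
  refine ⟨?_, ?_⟩
  · rintro rfl
    omega
  · rw [← abs_two, ← abs_mul, abs_lt]
    constructor <;> linarith

/-- With diagonal entries at most p/2 and off-diagonal norm at most p²/3, the bound holds at once if
the diagonal entries have the same sign. For opposite signs the sum of the two terms may reach
7p²/12, and then `abs_flip_lt` shifts one diagonal entry. The last alternative records that the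
shifted entry may be large only if the other one is nonzero; the descent needs this when the second
coordinate vanishes. -/
theorem exists_reduced_of_pos {p : ℤ} (hp : 0 < p) (r s x y : ℤ) : ∃ a b c d,
    2 * |(r + p * a) * (s + p * b) - ((x + p * c) ^ 2 - (x + p * c) * (y + p * d)
      + (y + p * d) ^ 2)| < p ^ 2 ∧ 2 * |s + p * b| ≤ p ∧
    (2 * |r + p * a| ≤ p ∨ s + p * b ≠ 0) := by
  obtain ⟨c, d, hN⟩ := exists_norm_le hp x y
  have hN0 := norm_nonneg (x + p * c) (y + p * d)
  obtain ⟨a, ha1, ha2⟩ := exists_abs_le hp r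
  obtain ⟨b, hb1, hb2⟩ := exists_abs_le hp s
  have hbs : 2 * |s + p * b| ≤ p := by
    rw [← abs_two, ← abs_mul, abs_le]
    exact ⟨hb1, hb2⟩
  obtain ⟨n, hn⟩ : ∃ n, n = (x + p * c) ^ 2 - (x + p * c) * (y + p * d) + (y + p * d) ^ 2 :=
    ⟨_, rfl⟩
  rw [← hn] at hN hN0
  by_cases h : 2 * |(r + p * a) * (s + p * b) - n| < p ^ 2
  · exact ⟨a, b, c, d, hn ▸ h, hbs, Or.inl (by
      rw [← abs_two, ← abs_mul, abs_le]
      exact ⟨ha1, ha2⟩)⟩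
  have hp2 : 0 < p ^ 2 := by positivity
  have same : ∀ u v : ℤ, 0 ≤ u → 0 ≤ v → 2 * u ≤ p → 2 * v ≤ p →
      2 * |u * v - n| < p ^ 2 := by
    intro u v hu hv hu' hv'
    have h1 : 4 * (u * v) ≤ p ^ 2 := by nlinarith
    have h2 := mul_nonneg hu hv
    rw [← abs_two, ← abs_mul, abs_lt]
    constructor <;> linarith
  rcases le_total 0 (r + p * a) with hr | hr <;> rcases le_total 0 (s + p * b) with hs | hs
  · exact absurd (same _ _ hr hs ha2 hb2) h
  · have h' : p ^ 2 ≤ 2 * (n + (r + p * a) * -(s + p * b)) := by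
      have h1 : (r + p * a) * (s + p * b) ≤ 0 := mul_nonpos_of_nonneg_of_nonpos hr hs
      rw [abs_of_nonpos (by linarith)] at h
      linarith
    obtain ⟨h1, h2⟩ := abs_flip_lt hp hr (by omega) (by omega) ha2 hN0 hN h'
    refine ⟨a - 1, b, c, d, ?_, hbs, Or.inr (by omega)⟩
    rw [← hn]
    convert h2 using 4
    ring
  · have h' : p ^ 2 ≤ 2 * (n + -(r + p * a) * (s + p * b)) := by
      have h1 : (r + p * a) * (s + p * b) ≤ 0 := mul_nonpos_of_nonpos_of_nonneg hr hs
      rw [abs_of_nonpos (by linarith)] at h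
      linarith
    obtain ⟨h1, h2⟩ := abs_flip_lt hp (by omega) hs hb2 (by omega) hN0 hN h'
    refine ⟨a + 1, b, c, d, ?_, hbs, Or.inr (by omega)⟩
    rw [← hn]
    convert h2 using 4
    ring
  · refine absurd ?_ h
    have := same _ _ (neg_nonneg.2 hr) (neg_nonneg.2 hs) (by omega) (by omega)
    rwa [neg_mul_neg] at this

theorem exists_reduced {p : ℤ} (hp : p ≠ 0) (r s x y : ℤ) : ∃ a b c d,
    2 * |(r + a * p) * (s + b * p) - ((x + c * p) ^ 2 - (x + c * p) * (y + d * p)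
      + (y + d * p) ^ 2)| < p ^ 2 ∧ 2 * |s + b * p| ≤ |p| ∧
    (2 * |r + a * p| ≤ |p| ∨ s + b * p ≠ 0) := by
  rcases hp.lt_or_gt with h | h
  · obtain ⟨a, b, c, d, H⟩ := exists_reduced_of_pos (neg_pos.2 h) r s x y
    refine ⟨-a, -b, -c, -d, ?_⟩
    rw [abs_of_neg h]
    simpa [mul_comm] using H
  · obtain ⟨a, b, c, d, H⟩ := exists_reduced_of_pos h r s x y
    refine ⟨a, b, c, d, ?_⟩
    rw [abs_of_pos h]
    simpa [mul_comm] using H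

theorem exists_abs_sub_lt {p s : ℤ} (hs : s ≠ 0) (h : 2 * |s| ≤ |p|) :
    ∃ e : ℤ, |p - 2 * e * s| < |p| := by
  rcases le_total 0 p with h1 | h1 <;> rcases le_total 0 s with h2 | h2 <;>
    simp only [abs_of_nonneg, abs_of_nonpos, h1, h2] at h ⊢
  · exact ⟨1, abs_lt.2 (by omega)⟩
  · exact ⟨-1, abs_lt.2 (by omega)⟩
  · exact ⟨-1, abs_lt.2 (by omega)⟩
  · exact ⟨1, abs_lt.2 (by omega)⟩

theorem quad_mulVec_of_mem_Lift {g : GL (Fin 6) ℤ} (hg : g ∈ Lift) (v : Fin 6 → ℤ) :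
    quad (g.1 *ᵥ v) = quad v := by
  obtain ⟨h, H⟩ := hg
  exact (mem_OM_iff g).1 H.mem_OM v

/-- An isotropic vector with odd first coordinate is equivalent to a multiple of the first basis
vector. -/
theorem exists_lift_mulVec_eq (v : Fin 6 → ℤ) (hv : Odd (v 0)) (hq : quad v = 0) :
    ∃ g ∈ Lift, ∃ p : ℤ, g.1 *ᵥ v = ![p, 0, 0, 0, 0, 0] := by
  induction hn : (v 0).natAbs using Nat.strong_induction_on generalizing v with
  | _ n ih =>
  subst hn
  have step : ∀ g ∈ Lift, Odd ((g.1 *ᵥ v) 0) → |(g.1 *ᵥ v) 0| < |v 0| →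
      ∃ g ∈ Lift, ∃ p : ℤ, g.1 *ᵥ v = ![p, 0, 0, 0, 0, 0] := by
    intro g hg ho hlt
    obtain ⟨g', hg', p, e⟩ := ih _ (Int.natAbs_lt_iff_sq_lt.2 (sq_lt_sq.2 hlt)) _ ho
      (by rw [quad_mulVec_of_mem_Lift hg, hq]) rfl
    exact ⟨g' * g, mul_mem hg' hg, p, by rw [Units.val_mul, ← Matrix.mulVec_mulVec, e]⟩
  -- This is the role of the parity: without it the descent could reach a vector with vanishing
  -- first coordinate.
  have hp : v 0 ≠ 0 := by
    intro h
    rw [h] at hv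
    exact absurd hv (by decide)
  obtain ⟨a, b, c, d, h1, h2, h3⟩ := exists_reduced hp (v 2) (v 3) (v 4) (v 5)
  obtain ⟨g, hg, e⟩ := exists_upper a b c d
  have eg := e v
  have hq1 := quad_mulVec_of_mem_Lift hg v
  rw [hq, eg] at hq1
  set w := ![v 0, v 1 - 2 * (a * b - c ^ 2 + c * d - d ^ 2) * v 0 - 2 * b * v 2 - 2 * a * v 3
        + 2 * (2 * c - d) * v 4 + 2 * (2 * d - c) * v 5,
        v 2 + a * v 0, v 3 + b * v 0, v 4 + c * v 0, v 5 + d * v 0] with hw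
  have w0 : w 0 = v 0 := rfl
  change 2 * |w 2 * w 3 - (w 4 ^ 2 - w 4 * w 5 + w 5 ^ 2)| < v 0 ^ 2 at h1
  change 2 * |w 3| ≤ |v 0| at h2
  change 2 * |w 2| ≤ |v 0| ∨ w 3 ≠ 0 at h3
  clear_value w
  -- A lower move changes the first coordinate by an even number, so parity persists and it suffices
  -- to make that coordinate smaller.
  have hlow : ∀ r s x y : ℤ, |w 0 - 2 * (r * s - x ^ 2 + x * y - y ^ 2) * w 1 - 2 * s * w 2
      - 2 * r * w 3 + 2 * (2 * x - y) * w 4 + 2 * (2 * y - x) * w 5| < |v 0| →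
      ∃ g ∈ Lift, ∃ p : ℤ, g.1 *ᵥ v = ![p, 0, 0, 0, 0, 0] := by
    intro r s x y hlt
    obtain ⟨g', h', H', e', _⟩ := exists_lower r s x y
    have eg' : (g' * g).1 *ᵥ v = g'.1 *ᵥ w := by
      rw [Units.val_mul, ← Matrix.mulVec_mulVec, eg]
    refine step (g' * g) (mul_mem ⟨h', H'⟩ hg) ?_ ?_
    · rw [eg', e' w]
      simp only [Matrix.cons_val]
      rw [← w0] at hv
      obtain ⟨k, hk⟩ := hv
      exact ⟨k - (r * s - x ^ 2 + x * y - y ^ 2) * w 1 - s * w 2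
        - r * w 3 + (2 * x - y) * w 4 + (2 * y - x) * w 5, by rw [hk]; ring⟩
    · rw [eg', e' w]
      exact hlt
  have hpq : w 0 * w 1 = -2 * (w 2 * w 3 - (w 4 ^ 2 - w 4 * w 5 + w 5 ^ 2)) := by
    rw [quad] at hq1
    linarith
  -- If the second coordinate is zero, then det S = 0. A nonzero diagonal entry of absolute value at
  -- most |p|/2 makes p smaller by a lower move, and if both diagonal entries vanish, so does the
  -- off-diagonal one.
  by_cases hw1 : w 1 = 0
  · have hS : w 2 * w 3 = w 4 ^ 2 - w 4 * w 5 + w 5 ^ 2 := by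
      rw [hw1] at hpq
      linarith
    by_cases hw3 : w 3 = 0
    · have h2' := h3.resolve_right (not_not.2 hw3)
      by_cases hw2 : w 2 = 0
      · rw [hw2, zero_mul] at hS
        obtain ⟨h4, h5⟩ := eq_zero_of_norm_eq_zero hS.symm
        refine ⟨g, hg, v 0, ?_⟩
        rw [eg]
        ext i
        fin_cases i
        exacts [w0, hw1, hw2, hw3, h4, h5]
      · obtain ⟨t, ht⟩ := exists_abs_sub_lt hw2 h2'
        apply hlow 0 t 0 0
        rw [hw1, w0]
        simpa using ht
    · obtain ⟨t, ht⟩ := exists_abs_sub_lt hw3 h2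
      apply hlow t 0 0 0
      rw [hw1, w0]
      simpa using ht
  -- Reduction modulo p gives |pq| = 2|det S| < p², so |q| < |p|. Reduction modulo q then gives a
  -- new first coordinate smaller than |q|.
  · have hlt1 : |w 1| < |v 0| := by
      have e1 := congrArg abs hpq
      rw [abs_mul, abs_mul, w0, abs_neg, abs_two] at e1
      rw [← e1, ← sq_abs] at h1
      have := abs_pos.2 hp
      nlinarith
    obtain ⟨a', b', c', d', k1, _, _⟩ := exists_reduced hw1 (w 2) (w 3) (w 4) (w 5)
    obtain ⟨g', h', H', e', _⟩ := exists_lower a' b' c' d'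
    apply hlow a' b' c' d'
    have hq2 := quad_mulVec_of_mem_Lift ⟨h', H'⟩ w
    rw [hq1, e', quad] at hq2
    simp only [Matrix.cons_val] at hq2
    refine lt_trans ?_ hlt1
    generalize w 0 - 2 * (a' * b' - c' ^ 2 + c' * d' - d' ^ 2) * w 1 - 2 * b' * w 2
      - 2 * a' * w 3 + 2 * (2 * c' - d') * w 4 + 2 * (2 * d' - c') * w 5 = u at *
    have e2 : u * w 1 = -2 * ((w 2 + a' * w 1) * (w 3 + b' * w 1) - ((w 4 + c' * w 1) ^ 2
      - (w 4 + c' * w 1) * (w 5 + d' * w 1) + (w 5 + d' * w 1) ^ 2)) := by linarith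
    have e1 := congrArg abs e2
    rw [abs_mul, abs_mul, abs_neg, abs_two] at e1
    rw [← e1, ← sq_abs] at k1
    have := abs_pos.2 hw1
    nlinarith

/-! ### Isotropic Hermitian matrices -/

theorem exists_norm_le' {p : ℤ} (hp : p ≠ 0) (x y : ℤ) : ∃ k l,
    3 * ((x + k * p) ^ 2 - (x + k * p) * (y + l * p) + (y + l * p) ^ 2) ≤ p ^ 2 := by
  rcases hp.lt_or_gt with h | h
  · obtain ⟨k, l, H⟩ := exists_norm_le (neg_pos.2 h) x y
    exact ⟨-k, -l, by simpa [mul_comm] using H⟩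
  · obtain ⟨k, l, H⟩ := exists_norm_le h x y
    exact ⟨k, l, by simpa [mul_comm] using H⟩

/-- Hermitian matrices over `ℤ[ω]` of determinant zero are multiples of `w w*` for a vector `w` that
is the first column of a matrix in `SL_2(ℤ[ω])`. -/
theorem exists_eq_smul_of_det_eq_zero (r s x y : ℤ) (h : r * s = x ^ 2 - x * y + y ^ 2) :
    ∃ k : ℤ, ∃ A ∈ EisMat, A.det = 1 ∧ psiMat r s x y = A * psiMat k 0 0 0 * Aᴴ := by
  induction hn : s.natAbs using Nat.strong_induction_on generalizing r s x y with
  | _ n ih =>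
  subst hn
  by_cases hs : s = 0
  · subst hs
    obtain ⟨rfl, rfl⟩ := eq_zero_of_norm_eq_zero (by rw [← h, mul_zero] : x ^ 2 - x * y + y ^ 2 = 0)
    exact ⟨r, 1, one_mem _, Matrix.det_one, by simp⟩
  obtain ⟨c, d, hN⟩ := exists_norm_le' hs x y
  -- This is the upper left entry after adding c + dω times the second row to the first, and
  -- likewise for columns. Determinant zero gives s r' = norm ≤ s²/3, so exchanging the diagonal
  -- entries yields a descent.
  obtain ⟨r', hr'⟩ : ∃ r', r' = r + 2 * x * c - x * d - y * c + 2 * y * d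
    + s * (c ^ 2 - c * d + d ^ 2) := ⟨_, rfl⟩
  have h' : s * r' = (x + c * s) ^ 2 - (x + c * s) * (y + d * s) + (y + d * s) ^ 2 := by
    rw [hr']
    linear_combination h
  have hlt : |r'| < |s| := by
    have e1 := congrArg abs h'
    rw [abs_mul, abs_of_nonneg (norm_nonneg _ _)] at e1
    rw [← e1, ← sq_abs] at hN
    have := abs_pos.2 hs
    nlinarith
  obtain ⟨k, A, hA, hdet, e⟩ := ih r'.natAbs (Int.natAbs_lt_iff_sq_lt.2 (sq_lt_sq.2 hlt)) s r'
    ((y + d * s) - (x + c * s)) (y + d * s) (by rw [h']; ring) rfl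
  -- The left factor undoes the row operation and the exchange of the basis vectors.
  refine ⟨k, !![-(c + d * omega), -1; 1, 0] * A, mul_mem ?_ hA, ?_, ?_⟩
  · exact mem_EisMat_of (neg_mem (mem_EisSub_iff.2 ⟨c, d, rfl⟩)) (neg_mem (one_mem _)) (one_mem _)
      (zero_mem _)
  · rw [Matrix.det_mul, hdet, Matrix.det_fin_two_of]
    simp
  · rw [Matrix.conjTranspose_mul, ← Matrix.mul_assoc, Matrix.mul_assoc _ A, Matrix.mul_assoc _ _ Aᴴ,
      ← e, psiMat_eq]
    simp only [Matrix.mul_apply, Fin.sum_univ_two, psiMat, omega_sq, Matrix.of_apply,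
      Matrix.cons_val', Matrix.cons_val_zero, Matrix.cons_val_one, Matrix.cons_val_fin_one,
      Matrix.conjTranspose_apply, star_neg, star_eis, star_one, star_zero, hr']
    push_cast
    refine ⟨?_, ?_, ?_, ?_⟩ <;> ring_nf <;> simp only [omega_sq] <;> ring

/-- The quotient ℤ[ω]/2 is the field with four elements, whose nonzero elements are the classes of
1, ω, ω². An element of odd norm is nonzero there, so a cube root of unity makes it congruent to 1.
-/
theorem exists_unit_mul_eq (a b : ℤ) (h : Odd (a ^ 2 - a * b + b ^ 2)) :
    ∃ u v : ℂ, u ∈ EisSub ∧ v ∈ EisSub ∧ u * v = 1 ∧ star u = v ∧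
      ∃ t ∈ EisSub, (a + b * omega) * u = 1 + 2 * t := by
  have h3 : omega ^ 3 = 1 := by linear_combination (omega - 1) * omega_sq
  have hs : star omega = omega ^ 2 := by rw [star_omega, omega_sq]
  rcases Int.even_or_odd' a with ⟨k, rfl | rfl⟩ <;> rcases Int.even_or_odd' b with ⟨l, rfl | rfl⟩
  · exfalso
    rw [← Int.not_even_iff_odd] at h
    exact h ⟨2 * k ^ 2 - 2 * k * l + 2 * l ^ 2, by ring⟩
  · refine ⟨omega ^ 2, omega, pow_mem omega_mem 2, omega_mem, ?_, ?_,
      k * omega ^ 2 + l, add_mem (mul_mem (intCast_mem _ _) (pow_mem omega_mem 2))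
      (intCast_mem _ _), ?_⟩
    · linear_combination h3
    · rw [star_pow, hs]
      linear_combination omega * h3
    · push_cast
      linear_combination (2 * l + 1) * h3
  · refine ⟨1, 1, one_mem _, one_mem _, one_mul _, star_one _, _,
      mem_EisSub_iff.2 ⟨k, l, rfl⟩, ?_⟩
    push_cast
    ring
  · refine ⟨omega, omega ^ 2, omega_mem, pow_mem omega_mem 2, ?_, hs, _,
      mem_EisSub_iff.2 ⟨-1 - l, k - l, rfl⟩, ?_⟩
    · linear_combination h3
    · push_cast
      linear_combination (2 * l + 1) * omega_sq

/-- The matrix `A` in the previous statement may be taken congruent to `1` modulo `2`. -/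
theorem exists_congr_eq_smul_of_det_eq_zero (r s x y : ℤ) (hr : Odd r) (hx : Even x) (hy : Even y)
    (h : r * s = x ^ 2 - x * y + y ^ 2) :
    ∃ k : ℤ, ∃ A : Matrix (Fin 2) (Fin 2) ℂ, (∃ A' ∈ EisMat, A = 1 + (2 : ℂ) • A') ∧
      A.det = 1 ∧ psiMat r s x y = A * psiMat k 0 0 0 * Aᴴ := by
  obtain ⟨k, A, hA, hdet, e⟩ := exists_eq_smul_of_det_eq_zero r s x y h
  obtain ⟨a, b, hab⟩ := mem_EisSub_iff.1 (hA 0 0)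
  obtain ⟨e0, e1, e2, e3⟩ := psiMat_eq.1 e
  simp only [Matrix.mul_apply, Fin.sum_univ_two, psiMat, Matrix.of_apply,
    Matrix.cons_val', Matrix.cons_val_zero, Matrix.cons_val_one, Matrix.cons_val_fin_one,
    Matrix.conjTranspose_apply, mul_zero, zero_mul, add_zero] at e0 e1 e2 e3
  have hr' : r = k * (a ^ 2 - a * b + b ^ 2) := by
    have h2 := star_mul_self_eis a b
    rw [← hab] at h2
    have h3 : (r : ℂ) = ((k * (a ^ 2 - a * b + b ^ 2) : ℤ) : ℂ) := by
      rw [e0, Int.cast_mul, ← h2]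
      ring
    exact_mod_cast h3
  -- As r = k|A₀₀|² is odd, both k and the norm of A₀₀ are odd. The first column of A can be scaled
  -- by a unit u so that its top entry becomes 1 modulo 2.
  rw [hr', Int.odd_mul] at hr
  obtain ⟨u, v, hu, hv, huv, hsu, t, ht, htu⟩ := exists_unit_mul_eq a b hr.2
  have hsv : star v = u := by rw [← hsu, star_star]
  rw [← hab] at htu
  obtain ⟨k', hk'⟩ := hr.1
  obtain ⟨x', rfl⟩ := hx
  obtain ⟨y', rfl⟩ := hy
  rw [Matrix.det_fin_two] at hdet
  have m10 := hA 1 0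
  have m01 := hA 0 1
  have m11 := hA 1 1
  generalize A 0 0 = α at *
  generalize A 0 1 = β at *
  generalize A 1 0 = γ at *
  generalize A 1 1 = δ at *
  have hst : star α * v = 1 + 2 * star t := by
    have := congrArg star htu
    rwa [star_mul', hsu, star_add, star_mul', star_one, star_ofNat] at this
  -- The lower off-diagonal entry of the Hermitian matrix is even and equals kγᾱ; as k and ᾱv are 1
  -- modulo 2, the entry γu must be even. Solving for it gives 2n.
  obtain ⟨n, hn⟩ : ∃ n, n = x' + (-1 - omega) * y' - star t * k * γ * u - k' * γ * u := ⟨_, rfl⟩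
  have hnm : n ∈ EisSub := by
    rw [hn]
    refine sub_mem (sub_mem (add_mem (intCast_mem _ _) (mul_mem (sub_mem (neg_mem (one_mem _))
      omega_mem) (intCast_mem _ _))) (mul_mem (mul_mem (mul_mem (star_mem_EisSub ht)
      (intCast_mem _ _)) m10) hu)) (mul_mem (mul_mem (intCast_mem _ _) m10) hu)
  have hγ : γ * u = 2 * n := by
    have hk : (k : ℂ) = 2 * k' + 1 := by exact_mod_cast hk'
    rw [hn]
    push_cast at e3
    linear_combination -e3 - (k * γ * u) * hst + γ * k * star α * huv - (γ * u) * hk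
  -- Only the first column of A matters for the product, so the second may be changed at will within
  -- determinant 1. Scaled by v, it has βv times the new first column subtracted: its upper entry
  -- becomes -2tβv and its lower entry q, and the determinant then forces q ≡ 1 modulo 2.
  obtain ⟨q, hq⟩ : ∃ q, q = δ * v - β * v * (γ * u) := ⟨_, rfl⟩
  have hqm : q ∈ EisSub := by
    rw [hq]
    exact sub_mem (mul_mem m11 hv) (mul_mem (mul_mem m01 hv) (mul_mem m10 hu))
  have hdet' : (α * u) * q - (-2 * t * β * v) * (γ * u) = 1 := by
    rw [hq]
    linear_combination (-β * v * (γ * u)) * htu + u * v * hdet + huv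
  refine ⟨k, !![α * u, -2 * t * β * v; γ * u, q], ⟨!![t, -t * β * v; n, -t * q - 2 * t * β * v * n],
    mem_EisMat_of ht (mul_mem (mul_mem (neg_mem ht) m01) hv) hnm (sub_mem (mul_mem (neg_mem ht) hqm)
      (mul_mem (mul_mem (mul_mem (mul_mem (ofNat_mem _ 2) ht) m01) hv) hnm)), ?_⟩, ?_, ?_⟩
  · ext i j
    fin_cases i <;> fin_cases j <;> simp
    · exact htu
    · ring
    · exact hγ
    · linear_combination hdet' - q * htu + (-2 * t * β * v) * hγ
  · rw [Matrix.det_fin_two_of]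
    exact hdet'
  · rw [psiMat_eq]
    simp only [Matrix.mul_apply, Fin.sum_univ_two, psiMat, Matrix.of_apply,
      Matrix.cons_val', Matrix.cons_val_zero, Matrix.cons_val_one, Matrix.cons_val_fin_one,
      Matrix.conjTranspose_apply, mul_zero, zero_mul, add_zero, star_mul', hsu]
    refine ⟨?_, ?_, ?_, ?_⟩
    · linear_combination e0 - α * k * star α * huv
    · linear_combination e1 - γ * k * star γ * huv
    · linear_combination e2 - α * k * star γ * huv
    · linear_combination e3 - γ * k * star α * huv

/-! ### Isometries have lifts -/

theorem Lift_le_OPlus : Lift ≤ OPlus := fun _ ⟨_, H⟩ => H.mem_OPlus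

theorem Lift_le_Cong : Lift ≤ Cong := fun _ ⟨_, H⟩ => H.mem_Cong

/-- The polarization of `quad`. -/
def polar (v w : Fin 6 → ℤ) : ℤ :=
  v 0 * w 1 + v 1 * w 0 + 2 * (v 2 * w 3 + v 3 * w 2 - 2 * v 4 * w 4 + v 4 * w 5 + v 5 * w 4
    - 2 * v 5 * w 5)

theorem polar_eq (v w : Fin 6 → ℤ) : polar v w = quad (v + w) - quad v - quad w := by
  simp only [polar, quad, Pi.add_apply]
  ring

theorem polar_mulVec {g : GL (Fin 6) ℤ} (hg : g ∈ OM) (v w : Fin 6 → ℤ) :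
    polar (g.1 *ᵥ v) (g.1 *ᵥ w) = polar v w := by
  rw [mem_OM_iff] at hg
  rw [polar_eq, polar_eq, ← Matrix.mulVec_add, hg, hg, hg]

/-- The basis vectors of `M`. -/
def basisVec (j : Fin 6) : Fin 6 → ℤ := Pi.single j 1

theorem basisVec_apply (i j : Fin 6) : basisVec j i = if i = j then 1 else 0 := Pi.single_apply _ _ _

theorem eq_of_mulVec_basisVec {g g' : GL (Fin 6) ℤ}
    (h : ∀ j, g.1 *ᵥ basisVec j = g'.1 *ᵥ basisVec j) : g = g' := by
  apply Units.ext
  ext i j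
  have := congrFun (h j) i
  simpa [basisVec] using this

theorem polar_basisVec (v : Fin 6 → ℤ) : polar v (basisVec 0) = v 1 ∧ polar v (basisVec 1) = v 0 ∧
    polar v (basisVec 2) = 2 * v 3 ∧ polar v (basisVec 3) = 2 * v 2 := by
  simp [polar, basisVec_apply]

theorem vec_ext {v w : Fin 6 → ℤ} (h0 : v 0 = w 0) (h1 : v 1 = w 1) (h2 : v 2 = w 2)
    (h3 : v 3 = w 3) (h4 : v 4 = w 4) (h5 : v 5 = w 5) : v = w := by
  ext i
  fin_cases i
  exacts [h0, h1, h2, h3, h4, h5]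

theorem isUnit_of_mulVec_eq {g : GL (Fin 6) ℤ} {v w : Fin 6 → ℤ} {k : ℤ} {j : Fin 6}
    (h : g.1 *ᵥ v = k • w) (hv : v j = 1) : k = 1 ∨ k = -1 := by
  have h1 := congrArg (fun u => ((g⁻¹).1 *ᵥ u) j) h
  simp only [inv_mulVec_mulVec, Matrix.mulVec_smul, Pi.smul_apply, smul_eq_mul, hv] at h1
  exact Int.isUnit_iff.1 (IsUnit.of_mul_eq_one _ h1.symm)

theorem psiMat_int_inj {a d x y a' d' x' y' : ℤ}
    (h : psiMat a d x y = psiMat a' d' x' y') : a = a' ∧ d = d' ∧ x = x' ∧ y = y' := by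
  obtain ⟨h1, h2, h3, h4⟩ := psiMat_inj h
  exact ⟨by exact_mod_cast h1, by exact_mod_cast h2, by exact_mod_cast h3, by exact_mod_cast h4⟩

/-- The lift of `S ↦ A S A*` as a map of vectors. -/
theorem exists_conj_mulVec {A : Matrix (Fin 2) (Fin 2) ℂ}
    (hA : ∃ A' ∈ EisMat, A = 1 + (2 : ℂ) • A') {δ : ℤ} (hδ : δ = 1 ∨ δ = -1) (hdet : A.det = δ) :
    ∃ g ∈ Lift, ∀ v w : Fin 6 → ℤ, v 0 = w 0 → v 1 = w 1 →
      A * psiMat (v 2) (v 3) (v 4) (v 5) * Aᴴ = psiMat (w 2) (w 3) (w 4) (w 5) →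
      g.1 *ᵥ v = w := by
  obtain ⟨g, h, H, hg, _⟩ := exists_conj hA hδ hdet
  refine ⟨g, ⟨h, H⟩, fun v w h0 h1 h2 => ?_⟩
  obtain ⟨e0, e1, e2⟩ := hg v
  rw [h2] at e2
  obtain ⟨k2, k3, k4, k5⟩ := psiMat_int_inj e2
  exact vec_ext (e0.trans h0) (e1.trans h1) k2 k3 k4 k5

/-- The isometry -1 of A₂(2) comes from A = diag(1, -1), a matrix of determinant -1. -/
theorem exists_flip : ∃ g ∈ Lift, ∀ v : Fin 6 → ℤ,
    g.1 *ᵥ v = ![v 0, v 1, v 2, v 3, -v 4, -v 5] := by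
  obtain ⟨g, hg, h⟩ := exists_conj_mulVec (A := !![1, 0; 0, -1]) (δ := -1)
    ⟨!![0, 0; 0, -1], mem_EisMat_of (zero_mem _) (zero_mem _) (zero_mem _) (neg_mem (one_mem _)), by
      ext i j
      fin_cases i <;> fin_cases j <;> simp
      norm_num⟩ (Or.inr rfl) (by simp [Matrix.det_fin_two_of])
  refine ⟨g, hg, fun v => h v _ rfl rfl ?_⟩
  rw [eq_comm, psiMat_eq]
  simp [Matrix.mul_apply, Fin.sum_univ_two, psiMat, omega_sq]
  constructor <;> ring

theorem norm_eq_one {x y : ℤ} (hy : Even y) (h : x ^ 2 - x * y + y ^ 2 = 1) :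
    (x = 1 ∨ x = -1) ∧ y = 0 := by
  obtain ⟨t, rfl⟩ := hy
  have ht : t = 0 := by
    by_contra ht
    have : 0 < t ^ 2 := by positivity
    nlinarith [sq_nonneg (x - t)]
  subst ht
  refine ⟨Int.isUnit_iff.1 (IsUnit.of_mul_eq_one x ?_), by simp⟩
  linarith

/-- Such an isometry preserves the orthogonal complement A₂(2) of the fixed vectors. The congruence
modulo 2 and the norm equation force each of the two basis vectors to go to ± itself, and their
product forces the signs to agree. The result is 1 or the isometry of `exists_flip`. -/
theorem mem_Lift_of_fix_four {g : GL (Fin 6) ℤ} (hg : g ∈ OM) (hc : g ∈ Cong)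
    (h0 : g.1 *ᵥ basisVec 0 = basisVec 0) (h1 : g.1 *ᵥ basisVec 1 = basisVec 1)
    (h2 : g.1 *ᵥ basisVec 2 = basisVec 2) (h3 : g.1 *ᵥ basisVec 3 = basisVec 3) : g ∈ Lift := by
  have key : ∀ j, 4 ≤ j → (g.1 *ᵥ basisVec j) 0 = 0 ∧ (g.1 *ᵥ basisVec j) 1 = 0 ∧
      (g.1 *ᵥ basisVec j) 2 = 0 ∧ (g.1 *ᵥ basisVec j) 3 = 0 := by
    intro j hj
    have p0 := polar_mulVec hg (basisVec j) (basisVec 0)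
    have p1 := polar_mulVec hg (basisVec j) (basisVec 1)
    have p2 := polar_mulVec hg (basisVec j) (basisVec 2)
    have p3 := polar_mulVec hg (basisVec j) (basisVec 3)
    rw [h0, (polar_basisVec _).1, (polar_basisVec _).1] at p0
    rw [h1, (polar_basisVec _).2.1, (polar_basisVec _).2.1] at p1
    rw [h2, (polar_basisVec _).2.2.1, (polar_basisVec _).2.2.1] at p2
    rw [h3, (polar_basisVec _).2.2.2, (polar_basisVec _).2.2.2] at p3
    have e : basisVec j 0 = 0 ∧ basisVec j 1 = 0 ∧ basisVec j 2 = 0 ∧ basisVec j 3 = 0 := by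
      clear p0 p1 p2 p3
      fin_cases j <;> simp_all [basisVec_apply]
    omega
  obtain ⟨a0, a1, a2, a3⟩ := key 4 (by decide)
  obtain ⟨b0, b1, b2, b3⟩ := key 5 (by decide)
  have q4 := (mem_OM_iff g).1 hg (basisVec 4)
  have q5 := (mem_OM_iff g).1 hg (basisVec 5)
  have p45 := polar_mulVec hg (basisVec 4) (basisVec 5)
  have c4 := hc (basisVec 4) (by simp [basisVec_apply]) (by simp [basisVec_apply])
  have c5 := hc (basisVec 5) (by simp [basisVec_apply]) (by simp [basisVec_apply])
  have c44 := c4 4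
  have c45 := c4 5
  have c54 := c5 4
  have c55 := c5 5
  clear c4 c5 key
  simp only [quad, polar, a0, a1, a2, a3, b0, b1, b2, b3, basisVec_apply] at q4 q5 p45 c44 c45 c54 c55
  simp at q4 q5 p45 c44 c45 c54 c55
  obtain ⟨hx, hy⟩ := norm_eq_one (x := (g.1 *ᵥ basisVec 4) 4) (y := (g.1 *ᵥ basisVec 4) 5)
    (by rw [Int.even_iff]; omega) (by linarith)
  obtain ⟨hx', hy'⟩ := norm_eq_one (x := (g.1 *ᵥ basisVec 5) 5) (y := (g.1 *ᵥ basisVec 5) 4)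
    (by rw [Int.even_iff]; omega) (by linarith)
  rw [hy, hy'] at p45
  rcases hx with hx | hx
  · have hg1 : g = 1 := by
      refine eq_of_mulVec_basisVec fun j => ?_
      rw [Units.val_one, Matrix.one_mulVec]
      fin_cases j
      · exact h0
      · exact h1
      · exact h2
      · exact h3
      · exact vec_ext a0 a1 a2 a3 hx hy
      · refine vec_ext b0 b1 b2 b3 hy' ?_
        rw [hx] at p45
        have h55 : (g.1 *ᵥ basisVec 5) 5 = 1 := by linarith
        exact h55
    rw [hg1]
    exact one_mem _
  · obtain ⟨d, hd, e⟩ := exists_flip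
    have hgd : g = d := by
      refine eq_of_mulVec_basisVec fun j => ?_
      rw [e]
      fin_cases j
      · rw [Fin.zero_eta, h0]; decide
      · rw [Fin.mk_one, h1]; decide
      · refine h2.trans ?_; decide
      · refine h3.trans ?_; decide
      · exact vec_ext a0 a1 a2 a3 hx hy
      · refine vec_ext b0 b1 b2 b3 hy' ?_
        rw [hx] at p45
        have h55 : (g.1 *ᵥ basisVec 5) 5 = -1 := by linarith
        exact h55
    rw [hgd]
    exact hd

theorem mul_mulVec_of_eq {g g' : GL (Fin 6) ℤ} {u v w : Fin 6 → ℤ} (h : g.1 *ᵥ u = v)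
    (h' : g'.1 *ᵥ v = w) : (g' * g).1 *ᵥ u = w := by
  rw [Units.val_mul, ← Matrix.mulVec_mulVec, h, h']

/-- The image of the fourth basis vector is a Hermitian matrix with lower right entry 1 and even
off-diagonal entry 2(x + yω). The matrix [1, -2(x + yω); 0, 1] clears the latter, and the upper left
entry then vanishes by isotropy. -/
theorem mem_Lift_of_fix_three {g : GL (Fin 6) ℤ} (hg : g ∈ OM) (hc : g ∈ Cong)
    (h0 : g.1 *ᵥ basisVec 0 = basisVec 0) (h1 : g.1 *ᵥ basisVec 1 = basisVec 1)
    (h2 : g.1 *ᵥ basisVec 2 = basisVec 2) : g ∈ Lift := by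
  have p0 := polar_mulVec hg (basisVec 3) (basisVec 0)
  have p1 := polar_mulVec hg (basisVec 3) (basisVec 1)
  have p2 := polar_mulVec hg (basisVec 3) (basisVec 2)
  have q := (mem_OM_iff g).1 hg (basisVec 3)
  have c := hc (basisVec 3) (by simp [basisVec_apply]) (by simp [basisVec_apply])
  have c4 := c 4
  have c5 := c 5
  rw [h0, (polar_basisVec _).1, (polar_basisVec _).1] at p0
  rw [h1, (polar_basisVec _).2.1, (polar_basisVec _).2.1] at p1
  rw [h2, (polar_basisVec _).2.2.1, (polar_basisVec _).2.2.1] at p2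
  clear c
  simp [basisVec_apply] at p0 p1 p2 c4 c5
  simp only [quad, p0, p1, p2] at q
  simp [basisVec_apply] at q
  obtain ⟨x, hx⟩ := c4
  obtain ⟨y, hy⟩ := c5
  rw [hx, hy] at q
  obtain ⟨l, hl, e⟩ := exists_conj_mulVec (A := !![1, -2 * (x + y * omega); 0, 1]) (δ := 1)
    ⟨!![0, -(x + y * omega); 0, 0], mem_EisMat_of (zero_mem _)
      (neg_mem (mem_EisSub_iff.2 ⟨x, y, rfl⟩)) (zero_mem _) (zero_mem _), by
      ext i j
      fin_cases i <;> fin_cases j <;> simp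
      ring⟩ (Or.inl rfl) (by simp [Matrix.det_fin_two_of])
  have conj_eq : ∀ v w : Fin 6 → ℤ, v 0 = w 0 → v 1 = w 1 →
      w 2 = v 2 - 2 * (2 * x * v 4 - x * v 5 - y * v 4 + 2 * y * v 5)
        + 4 * (x ^ 2 - x * y + y ^ 2) * v 3 →
      w 3 = v 3 → w 4 = v 4 - 2 * x * v 3 → w 5 = v 5 - 2 * y * v 3 → l.1 *ᵥ v = w := by
    intro v w k0 k1 k2 k3 k4 k5
    refine e v w k0 k1 ?_
    rw [eq_comm, psiMat_eq, k2, k3, k4, k5]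
    simp only [Matrix.mul_apply, Fin.sum_univ_two, psiMat, omega_sq, Matrix.of_apply,
      Matrix.cons_val', Matrix.cons_val_zero, Matrix.cons_val_one, Matrix.cons_val_fin_one,
      Matrix.conjTranspose_apply, star_mul', star_neg, star_eis, star_one, star_zero, star_ofNat]
    push_cast
    refine ⟨?_, ?_, ?_, ?_⟩ <;> ring_nf <;> simp only [omega_sq] <;> ring
  have hl0 : l.1 *ᵥ basisVec 0 = basisVec 0 := by
    apply conj_eq <;> simp [basisVec_apply]
  have hl1 : l.1 *ᵥ basisVec 1 = basisVec 1 := by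
    apply conj_eq <;> simp [basisVec_apply]
  have hl2 : l.1 *ᵥ basisVec 2 = basisVec 2 := by
    apply conj_eq <;> simp [basisVec_apply]
  have hl3 : l.1 *ᵥ (g.1 *ᵥ basisVec 3) = basisVec 3 := by
    apply conj_eq <;> simp only [p0, p1, p2, hx, hy] <;> simp [basisVec_apply]
    linarith
  rw [← Subgroup.mul_mem_cancel_left _ hl]
  exact mem_Lift_of_fix_four (mul_mem (Lift_le_OPlus hl).1 hg) (mul_mem (Lift_le_Cong hl) hc)
    (mul_mulVec_of_eq h0 hl0) (mul_mulVec_of_eq h1 hl1) (mul_mulVec_of_eq h2 hl2)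
    (mul_mulVec_of_eq rfl hl3)

/-- This is where the preservation of the component 𝔻_M⁺ enters. -/
theorem eq_one_of_mulVec_eq_smul {g : GL (Fin 6) ℤ} (hg : g ∈ OPlus)
    (h0 : g.1 *ᵥ basisVec 0 = basisVec 0) (h1 : g.1 *ᵥ basisVec 1 = basisVec 1) {k : ℤ}
    (h2 : g.1 *ᵥ basisVec 2 = k • basisVec 2) : k = 1 := by
  refine (isUnit_of_mulVec_eq (j := 2) h2 (by simp [basisVec_apply])).resolve_right fun hk => ?_
  subst hk
  have p0 := polar_mulVec hg.1 (basisVec 3) (basisVec 0)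
  have p1 := polar_mulVec hg.1 (basisVec 3) (basisVec 1)
  have p2 := polar_mulVec hg.1 (basisVec 2) (basisVec 3)
  have q := (mem_OM_iff g).1 hg.1 (basisVec 3)
  rw [h0, (polar_basisVec _).1, (polar_basisVec _).1] at p0
  rw [h1, (polar_basisVec _).2.1, (polar_basisVec _).2.1] at p1
  rw [h2] at p2
  simp [basisVec_apply] at p0 p1
  simp [polar, basisVec_apply] at p2
  have p3 : (g.1 *ᵥ basisVec 3) 3 = -1 := by linarith
  simp only [quad, p0, p1, p3] at q
  simp [basisVec_apply] at q
  have hn := norm_nonneg ((g.1 *ᵥ basisVec 3) 4) ((g.1 *ᵥ basisVec 3) 5)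
  -- The test point is τ = i · 1. For k = -1 the third coordinate of its image has imaginary part (g
  -- e₃)₂ - 1, with basis vectors numbered from 0, and isotropy of g e₃ makes (g e₃)₂ minus a norm,
  -- hence at most 0.
  have hz : Projectivization.mk ℂ (quadVec Complex.I Complex.I 0 0) (quadVec_ne _ _ _ _) ∈ DMPlus :=
    (mem_DMPlus_mk _ _ rfl).2 ⟨rfl, by simp [quadVec], by simp [quadVec]⟩
  have hz' := (projAct_mem_iff ⟨g, hg⟩ _).2 hz
  rw [projAct_mk] at hz'
  have him := hz'.2
  rw [coord_mk] at him
  have ev : quadVec Complex.I Complex.I 0 0 = (fun i => (basisVec 0 i : ℂ))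
      + (2 : ℂ) • (fun i => (basisVec 1 i : ℂ)) + Complex.I • (fun i => (basisVec 2 i : ℂ))
      + Complex.I • (fun i => (basisVec 3 i : ℂ)) := by
    ext i
    fin_cases i <;> simp [quadVec, basisVec_apply]
  have hadd : ∀ a b, onC g (a + b) = onC g a + onC g b := fun a b => Matrix.mulVec_add _ _ _
  rw [ev, hadd, hadd, hadd, onC_smul, onC_smul, onC_smul, onC_intCast, onC_intCast, onC_intCast,
    onC_intCast, h0, h1, h2] at him
  simp only [Pi.add_apply, Pi.smul_apply, p1] at him
  simp [basisVec_apply] at him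
  have : 1 < (g.1 *ᵥ basisVec 3) 2 := by exact_mod_cast him
  linarith

/-- The image of the third basis vector is a Hermitian matrix of determinant zero, congruent to
diag(1, 0) modulo 2 in the entries that matter, so it has the form A diag(k, 0) A* with A ≡ 1.
Undoing A leaves k times the basis vector, and k = 1. -/
theorem mem_Lift_of_fix_two {g : GL (Fin 6) ℤ} (hg : g ∈ OPlus) (hc : g ∈ Cong)
    (h0 : g.1 *ᵥ basisVec 0 = basisVec 0) (h1 : g.1 *ᵥ basisVec 1 = basisVec 1) : g ∈ Lift := by
  have p0 := polar_mulVec hg.1 (basisVec 2) (basisVec 0)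
  have p1 := polar_mulVec hg.1 (basisVec 2) (basisVec 1)
  have q := (mem_OM_iff g).1 hg.1 (basisVec 2)
  have c := hc (basisVec 2) (by simp [basisVec_apply]) (by simp [basisVec_apply])
  have c2 := c 2
  have c4 := c 4
  have c5 := c 5
  rw [h0, (polar_basisVec _).1, (polar_basisVec _).1] at p0
  rw [h1, (polar_basisVec _).2.1, (polar_basisVec _).2.1] at p1
  clear c
  simp [basisVec_apply] at p0 p1 c2 c4 c5
  simp only [quad, p0, p1] at q
  simp [basisVec_apply] at q
  obtain ⟨k, A, hA, hdet, e⟩ := exists_congr_eq_smul_of_det_eq_zero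
    ((g.1 *ᵥ basisVec 2) 2) ((g.1 *ᵥ basisVec 2) 3) ((g.1 *ᵥ basisVec 2) 4)
    ((g.1 *ᵥ basisVec 2) 5) (by rw [Int.odd_iff]; omega) (by rw [Int.even_iff]; omega)
    (by rw [Int.even_iff]; omega) (by linarith)
  obtain ⟨l, hl, el⟩ := exists_conj_mulVec hA (Or.inl rfl) (by rw [hdet, Int.cast_one])
  have hfix : ∀ v : Fin 6 → ℤ, v 2 = 0 → v 3 = 0 → v 4 = 0 → v 5 = 0 → l.1 *ᵥ v = v := by
    intro v k2 k3 k4 k5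
    refine el v v rfl rfl ?_
    have : psiMat 0 0 0 0 = 0 := by
      ext i j
      fin_cases i <;> fin_cases j <;> simp [psiMat]
    rw [k2, k3, k4, k5, Int.cast_zero, this, mul_zero, zero_mul]
  have hinv : ∀ {v w : Fin 6 → ℤ}, l.1 *ᵥ v = w → (l⁻¹).1 *ᵥ w = v := by
    rintro v _ rfl
    exact inv_mulVec_mulVec l v
  have hl0 := hinv (hfix (basisVec 0) rfl rfl rfl rfl)
  have hl1 := hinv (hfix (basisVec 1) rfl rfl rfl rfl)
  have hl2 : (l⁻¹).1 *ᵥ (g.1 *ᵥ basisVec 2) = k • basisVec 2 := by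
    refine hinv (el _ _ ?_ ?_ ?_)
    · rw [p1]
      simp [basisVec_apply]
    · rw [p0]
      simp [basisVec_apply]
    · rw [e]
      simp [basisVec_apply]
  have hl' := inv_mem hl
  have hlg := mul_mem (Lift_le_OPlus hl') hg
  have hk := eq_one_of_mulVec_eq_smul hlg (mul_mulVec_of_eq h0 hl0) (mul_mulVec_of_eq h1 hl1)
    (mul_mulVec_of_eq rfl hl2)
  rw [hk, one_smul] at hl2
  rw [← Subgroup.mul_mem_cancel_left _ hl']
  exact mem_Lift_of_fix_three hlg.1 (mul_mem (Lift_le_Cong hl') hc) (mul_mulVec_of_eq h0 hl0)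
    (mul_mulVec_of_eq h1 hl1) (mul_mulVec_of_eq rfl hl2)

/-- Pairing with the fixed vector shows that the image of the second basis vector has second
coordinate 1. A lower move clears its last four coordinates without moving the fixed vector, and
isotropy then clears the first. -/
theorem mem_Lift_of_fix_one {g : GL (Fin 6) ℤ} (hg : g ∈ OPlus) (hc : g ∈ Cong)
    (h0 : g.1 *ᵥ basisVec 0 = basisVec 0) : g ∈ Lift := by
  have p0 := polar_mulVec hg.1 (basisVec 1) (basisVec 0)
  have q := (mem_OM_iff g).1 hg.1 (basisVec 1)
  rw [h0, (polar_basisVec _).1, (polar_basisVec _).1] at p0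
  simp [basisVec_apply] at p0
  simp only [quad, p0] at q
  simp [basisVec_apply] at q
  generalize hw : g.1 *ᵥ basisVec 1 = w at *
  obtain ⟨l, h, H, e, _⟩ := exists_lower (-w 2) (-w 3) (-w 4) (-w 5)
  have hl : l ∈ Lift := ⟨h, H⟩
  have hl0 : l.1 *ᵥ basisVec 0 = basisVec 0 := by
    rw [e]
    refine vec_ext ?_ ?_ ?_ ?_ ?_ ?_ <;> simp [basisVec_apply]
  have hl1 : l.1 *ᵥ w = basisVec 1 := by
    rw [e]
    refine vec_ext ?_ ?_ ?_ ?_ ?_ ?_ <;> simp [basisVec_apply, p0]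
    linarith
  rw [← Subgroup.mul_mem_cancel_left _ hl]
  exact mem_Lift_of_fix_two (mul_mem (Lift_le_OPlus hl) hg) (mul_mem (Lift_le_Cong hl) hc)
    (mul_mulVec_of_eq h0 hl0) (mul_mulVec_of_eq hw hl1)

/-- Isometries that are trivial on the `2`-torsion of the discriminant group have a lift if
their first entry is odd. -/
theorem mem_Lift_of_odd {g : GL (Fin 6) ℤ} (hg : g ∈ OPlus) (hc : g ∈ Cong)
    (ho : Odd ((g.1 *ᵥ basisVec 0) 0)) : g ∈ Lift := by
  obtain ⟨l, hl, p, e⟩ := exists_lift_mulVec_eq _ ho (by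
    rw [(mem_OM_iff g).1 hg.1]
    simp [quad, basisVec_apply])
  have e' : (l * g).1 *ᵥ basisVec 0 = p • basisVec 0 := by
    rw [Units.val_mul, ← Matrix.mulVec_mulVec, e]
    refine vec_ext ?_ ?_ ?_ ?_ ?_ ?_ <;> simp [basisVec_apply]
  have hm := mul_mem (Lift_le_OPlus hl) hg
  have hm' := mul_mem (Lift_le_Cong hl) hc
  rw [← Subgroup.mul_mem_cancel_left _ hl]
  rcases isUnit_of_mulVec_eq (j := 0) e' (by simp [basisVec_apply]) with rfl | rfl
  · exact mem_Lift_of_fix_one hm hm' (by rw [e', one_smul])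
  · have hn : -(1 : GL (Fin 6) ℤ) ∈ Lift := neg_mem_Lift (one_mem _)
    rw [← Subgroup.mul_mem_cancel_left _ hn]
    refine mem_Lift_of_fix_one (mul_mem (Lift_le_OPlus hn) hm) (mul_mem (Lift_le_Cong hn) hm') ?_
    rw [neg_one_mul, Units.val_neg, Matrix.neg_mulVec, e', neg_smul, one_smul, neg_neg]

/-! ### Elements of the congruence subgroup are lifts -/

theorem toGLC_injective : Function.Injective toGLC := by
  intro g h e
  apply Units.ext
  ext i j
  exact congrFun (congrFun (congrArg (fun M : GL (Fin 2 ⊕ Fin 2) ℂ => M.1) e) i) j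

theorem parity_of_eq {a b : ℤ} {e : ℂ} (he : e ∈ EisSub) (h : (a + b * omega : ℂ) = 1 + 2 * e) :
    Odd a ∧ Even b := by
  obtain ⟨c, d, rfl⟩ := mem_EisSub_iff.1 he
  have h1 : (a + b * omega : ℂ) = (1 + 2 * c : ℤ) + (2 * d : ℤ) * omega := by
    rw [h]
    push_cast
    ring
  obtain ⟨h2, h3⟩ := eis_inj h1
  exact ⟨⟨c, by omega⟩, ⟨d, by omega⟩⟩

theorem exists_det_eq {D : Matrix (Fin 2) (Fin 2) ℂ} (hD : ∃ D' ∈ EisMat, D = 1 + (2 : ℂ) • D') :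
    ∃ a b : ℤ, D.det = a + b * omega ∧ Odd a ∧ Even b := by
  obtain ⟨D', hD', rfl⟩ := hD
  obtain ⟨a, b, hab⟩ := mem_EisSub_iff.1 (det_mem (add_mem (one_mem _) (two_smul_mem hD')))
  refine ⟨a, b, hab, parity_of_eq (e := D' 0 0 + D' 1 1 + 2 * (D' 0 0 * D' 1 1 - D' 0 1 * D' 1 0))
    (add_mem (add_mem (hD' 0 0) (hD' 1 1)) (mul_mem (ofNat_mem _ 2) (sub_mem
    (mul_mem (hD' 0 0) (hD' 1 1)) (mul_mem (hD' 0 1) (hD' 1 0))))) ?_⟩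
  rw [← hab, Matrix.det_fin_two]
  simp
  ring

theorem norm_odd {a b : ℤ} (ha : Odd a) (hb : Even b) : Odd (a ^ 2 - a * b + b ^ 2) := by
  obtain ⟨k, rfl⟩ := ha
  obtain ⟨l, rfl⟩ := hb
  exact ⟨2 * k ^ 2 + 2 * k - (2 * k + 1) * l + 2 * l ^ 2, by ring⟩

theorem det_ne_zero_of_congr {D : Matrix (Fin 2) (Fin 2) ℂ}
    (hD : ∃ D' ∈ EisMat, D = 1 + (2 : ℂ) • D') : D.det ≠ 0 := by
  obtain ⟨a, b, h, ha, _⟩ := exists_det_eq hD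
  intro h0
  rw [h0] at h
  have := (eis_eq_zero h.symm).1
  rw [this] at ha
  exact absurd ha (by decide)

/-- Modulo 2 the relation A*D - C*B = 1 reads D = 1. -/
theorem IsBlock.exists_D {A B C D : Matrix (Fin 2) (Fin 2) ℂ} (H : IsBlock A B C D) :
    ∃ D' ∈ EisMat, D = 1 + (2 : ℂ) • D' := by
  obtain ⟨A', hA', hA⟩ := H.exists_A
  obtain ⟨C', hC', hC⟩ := H.exists_C
  have h := H.eq₁₂
  refine ⟨C'ᴴ * B - A'ᴴ * D, sub_mem (mul_mem (conjTranspose_mem hC') H.memB)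
    (mul_mem (conjTranspose_mem hA') H.memD), ?_⟩
  have h2 : star (2 : ℂ) = 2 := star_ofNat 2
  rw [hA, hC, Matrix.conjTranspose_add, Matrix.conjTranspose_smul, Matrix.conjTranspose_smul,
    Matrix.conjTranspose_one, h2, Matrix.add_mul, Matrix.one_mul, Matrix.smul_mul,
    Matrix.smul_mul] at h
  rw [smul_sub, ← h]
  abel

/-- The hypothesis makes z a unit of ℤ[ω], that is, an element of norm 1; among the six units only
±1 have an even coefficient of ω. -/
theorem eq_one_or_neg_one_of_norm {z w : ℂ} (hw : w ∈ EisSub) {a b : ℤ} (hz : z = a + b * omega)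
    (hb : Even b) (h : star z * w = 1) : z = 1 ∨ z = -1 := by
  obtain ⟨c, d, rfl⟩ := mem_EisSub_iff.1 hw
  have h1 : ((a ^ 2 - a * b + b ^ 2) * (c ^ 2 - c * d + d ^ 2) : ℤ) = 1 := by
    have h2 := congrArg (fun u => star u * u) h
    simp only [star_mul', star_star, star_one, mul_one] at h2
    have h3 := star_mul_self_eis a b
    have h4 := star_mul_self_eis c d
    rw [← hz] at h3
    have : (((a ^ 2 - a * b + b ^ 2) * (c ^ 2 - c * d + d ^ 2) : ℤ) : ℂ) = ((1 : ℤ) : ℂ) := by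
      rw [Int.cast_mul, ← h3, ← h4, Int.cast_one, ← h2]
      ring
    exact_mod_cast this
  have h2 : a ^ 2 - a * b + b ^ 2 = 1 := by
    rcases Int.isUnit_iff.1 (IsUnit.of_mul_eq_one _ h1) with h | h
    · exact h
    · have := norm_nonneg a b
      omega
  obtain ⟨ha, hb⟩ := norm_eq_one hb h2
  subst hb
  rcases ha with rfl | rfl <;> simp [hz]

/-- The second columns of `h` have integral Plücker coordinates, up to a factor. -/
theorem IsBlock.exists_int_isPluecker {A B C D : Matrix (Fin 2) (Fin 2) ℂ} (H : IsBlock A B C D) :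
    ∃ v : Fin 6 → ℤ, Odd (v 0) ∧ quad v = 0 ∧
      IsPluecker (fun i => (v i : ℂ)) (Matrix.fromRows B D) := by
  have hd := det_ne_zero_of_congr H.exists_D
  obtain ⟨a, b, hab, ha, hb⟩ := exists_det_eq H.exists_D
  have hn := star_mul_self_eis a b
  rw [← hab] at hn
  -- The relation B*D = D*B makes the minors real, respectively Hermitian, once they are multiplied
  -- by the conjugate of det D. The first coordinate becomes |det D|², which is odd since D ≡ 1
  -- modulo 2.
  obtain ⟨m, hm⟩ : ∃ m : ℤ, star D.det * B.det = m := by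
    apply exists_int_of_star_eq (mul_mem (star_mem_EisSub (det_mem H.memD)) (det_mem H.memB))
    have h1 := congrArg Matrix.det H.eq₂₂
    rw [Matrix.det_mul, Matrix.det_mul, Matrix.det_conjTranspose, Matrix.det_conjTranspose] at h1
    rw [star_mul', star_star, ← h1, mul_comm]
  have hS : (star D.det • (B * D.adjugate))ᴴ = star D.det • (B * D.adjugate) := by
    have h1 := congrArg (fun X => D.adjugateᴴ * X * D.adjugate) H.eq₂₂
    have h2 : D.adjugateᴴ * Dᴴ = star D.det • 1 := by
      rw [← Matrix.conjTranspose_mul, Matrix.mul_adjugate, Matrix.conjTranspose_smul,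
        Matrix.conjTranspose_one]
    rw [← Matrix.mul_assoc, ← Matrix.mul_assoc, h2, Matrix.mul_assoc, Matrix.mul_adjugate,
      Matrix.smul_mul, Matrix.one_mul, Matrix.smul_mul, Matrix.mul_smul, Matrix.mul_one] at h1
    rw [Matrix.conjTranspose_smul, star_star, Matrix.conjTranspose_mul, h1]
  obtain ⟨r, s, x, y, he⟩ := exists_psiMat_int (S := star D.det • (B * D.adjugate)) (by
    intro i j
    exact EisSub.mul_mem (star_mem_EisSub (det_mem H.memD))
      (EisMat.mul_mem H.memB (adjugate_mem H.memD) i j)) hS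
  have hs : star D.det ≠ 0 := star_ne_zero.2 hd
  refine ⟨![a ^ 2 - a * b + b ^ 2, -2 * m, r, s, x, y], norm_odd ha hb, ?_,
    (star D.det)⁻¹, inv_ne_zero hs, ?_, ?_, ?_⟩
  · have h1 := congrArg Matrix.det he
    rw [det_psiMat, Matrix.det_smul, Matrix.det_mul, Matrix.det_adjugate] at h1
    have h2 : ((r * s - x ^ 2 + x * y - y ^ 2 : ℤ) : ℂ) = ((a ^ 2 - a * b + b ^ 2) * m : ℤ) := by
      push_cast
      rw [← h1, ← hm]
      push_cast at hn
      rw [← hn]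
      simp
      ring
    have h3 : r * s - x ^ 2 + x * y - y ^ 2 = (a ^ 2 - a * b + b ^ 2) * m := by exact_mod_cast h2
    simp only [quad, Matrix.cons_val]
    linear_combination 2 * h3
  · change _ * ((a ^ 2 - a * b + b ^ 2 : ℤ) : ℂ) = _
    rw [← hn, inv_mul_cancel_left₀ hs]
    rfl
  · change _ * ((-2 * m : ℤ) : ℂ) = _
    rw [Int.cast_mul, ← hm, mul_left_comm, inv_mul_cancel_left₀ hs]
    simp
  · change _ • psiMat r s x y = _
    rw [← he, inv_smul_smul₀ hs]
    rfl

theorem toGLC_mul_fromRows {h : GL (Fin 2 ⊕ Fin 2) Eis} {A B C D : Matrix (Fin 2) (Fin 2) ℂ}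
    (e : (toGLC h).1 = Matrix.fromBlocks A B C D) :
    (toGLC h).1 * Matrix.fromRows (0 : Matrix (Fin 2) (Fin 2) ℂ) (1 : Matrix (Fin 2) (Fin 2) ℂ)
      = Matrix.fromRows B D := by
  rw [e, Matrix.fromBlocks_mul_fromRows]
  simp

/-- Here D is the inverse of A*, so det A is a unit; being odd with an even coefficient of ω, it is
±1 and `exists_conj` applies. -/
theorem exists_isLift_of_diag {h : GL (Fin 2 ⊕ Fin 2) Eis} {A D : Matrix (Fin 2) (Fin 2) ℂ}
    (H : IsBlock A 0 0 D) (e : (toGLC h).1 = Matrix.fromBlocks A 0 0 D) : ∃ g, IsLift g h := by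
  have h1 : Aᴴ * D = 1 := by simpa using H.eq₁₂
  obtain ⟨a, b, hab, ha, hb⟩ := exists_det_eq H.exists_A
  have h2 := congrArg Matrix.det h1
  rw [Matrix.det_mul, Matrix.det_conjTranspose, Matrix.det_one] at h2
  obtain ⟨δ, hδ, hδ'⟩ : ∃ δ : ℤ, (δ = 1 ∨ δ = -1) ∧ A.det = δ := by
    rcases eq_one_or_neg_one_of_norm (det_mem H.memD) hab hb h2 with h | h
    · exact ⟨1, Or.inl rfl, by simp [h]⟩
    · exact ⟨-1, Or.inr rfl, by simp [h]⟩
  obtain ⟨g, h', hh, _, e'⟩ := exists_conj H.exists_A hδ hδ'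
  obtain ⟨_, _, _, _, H', e''⟩ := exists_block hh.mem_HGamma1
  have hD : (δ : ℂ) • A.adjugateᴴ = D := by
    have h3 : D * Aᴴ = 1 := mul_eq_one_comm.1 h1
    have h4 : Aᴴ * ((δ : ℂ) • A.adjugateᴴ) = 1 := by
      rw [Matrix.mul_smul, ← Matrix.conjTranspose_mul, Matrix.adjugate_mul,
        Matrix.conjTranspose_smul, hδ', Matrix.conjTranspose_one, smul_smul]
      rcases hδ with rfl | rfl <;> simp
    calc _ = D * Aᴴ * ((δ : ℂ) • A.adjugateᴴ) := by rw [h3, Matrix.one_mul]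
      _ = D := by rw [Matrix.mul_assoc, h4, Matrix.mul_one]
  have : h' = h := toGLC_injective (Units.ext (by rw [e', e, hD]))
  exact ⟨g, this ▸ hh⟩

theorem exists_isLift_of_mul {h h' : GL (Fin 2 ⊕ Fin 2) Eis} {l : GL (Fin 6) ℤ} (hl : IsLift l h')
    (H : ∃ g, IsLift g (h' * h)) : ∃ g, IsLift g h := by
  obtain ⟨g, hg⟩ := H
  have := hl.inv.mul hg
  rw [inv_mul_cancel_left] at this
  exact ⟨_, this⟩

/-- With C = 2C' and D*A = 1, one has C = 2(C'D*)A, where C'D* is Hermitian and integral. A lower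
move by its negative leaves a block diagonal matrix. -/
theorem exists_isLift_of_lower {h : GL (Fin 2 ⊕ Fin 2) Eis} {A C D : Matrix (Fin 2) (Fin 2) ℂ}
    (H : IsBlock A 0 C D) (e : (toGLC h).1 = Matrix.fromBlocks A 0 C D) : ∃ g, IsLift g h := by
  have h1 : Aᴴ * D = 1 := by simpa using H.eq₁₂
  have h1' : Dᴴ * A = 1 := by
    rw [← Matrix.conjTranspose_one, ← h1, Matrix.conjTranspose_mul,
      Matrix.conjTranspose_conjTranspose]
  have h2 : D * Aᴴ = 1 := mul_eq_one_comm.1 h1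
  have h2' : A * Dᴴ = 1 := mul_eq_one_comm.1 h1'
  obtain ⟨C', hC', hC⟩ := H.exists_C
  have h3 : C'ᴴ * A = Aᴴ * C' := by
    have h4 := H.eq₁₁
    have h5 : star (2 : ℂ) = 2 := star_ofNat 2
    rw [hC, Matrix.conjTranspose_smul, h5, Matrix.mul_smul, Matrix.smul_mul] at h4
    exact ((smul_right_injective _ (two_ne_zero' ℂ)) h4).symm
  have hS : (C' * Dᴴ)ᴴ = C' * Dᴴ := by
    calc (C' * Dᴴ)ᴴ = D * (C'ᴴ * (A * Dᴴ)) := by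
          rw [h2', Matrix.mul_one, Matrix.conjTranspose_mul, Matrix.conjTranspose_conjTranspose]
      _ = D * Aᴴ * (C' * Dᴴ) := by
          rw [← Matrix.mul_assoc C'ᴴ, h3]
          simp only [Matrix.mul_assoc]
      _ = C' * Dᴴ := by rw [h2, Matrix.one_mul]
  obtain ⟨r, s, x, y, hr⟩ := exists_psiMat_int (mul_mem hC' (conjTranspose_mem H.memD)) hS
  obtain ⟨l, h', hl, _, e'⟩ := exists_lower s r (-x) (-y)
  refine exists_isLift_of_mul hl ?_
  have hneg : psiMat ((-r : ℤ) : ℂ) ((-s : ℤ) : ℂ) ((-x : ℤ) : ℂ) ((-y : ℤ) : ℂ) = -(C' * Dᴴ) := by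
    rw [hr, ← neg_one_smul ℂ (psiMat (r : ℂ) s x y), smul_psiMat]
    simp
  have e2 : (toGLC (h' * h)).1 = Matrix.fromBlocks A 0 0 D := by
    rw [map_mul, Units.val_mul, e, e', hneg, Matrix.fromBlocks_multiply, hC]
    simp [Matrix.mul_assoc, h1']
  refine exists_isLift_of_diag ⟨H.exists_A, zero_mem _, ⟨0, zero_mem _, by simp⟩, H.memD, by simp,
    by simpa using h1, by simp⟩ e2

/-- The second pair of columns [B; D] spans the image of the plane with coordinates (1, 0, …, 0).
Moving its integral coordinates to a multiple of this vector makes B · adj D zero, hence B = 0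
because det D is nonzero. -/
theorem exists_isLift {h : GL (Fin 2 ⊕ Fin 2) Eis} (hh : h ∈ HGamma1) : ∃ g, IsLift g h := by
  obtain ⟨A, B, C, D, H, e⟩ := exists_block hh
  obtain ⟨v, hv, hq, hp⟩ := H.exists_int_isPluecker
  obtain ⟨l, ⟨h', hl⟩, p, hlv⟩ := exists_lift_mulVec_eq v hv hq
  refine exists_isLift_of_mul hl ?_
  obtain ⟨A₁, B₁, C₁, D₁, H₁, e₁⟩ := exists_block (mul_mem hl.mem_HGamma1 hh)
  have h1 := hl.pluecker _ _ hp
  rw [onC_intCast, hlv, ← toGLC_mul_fromRows e, ← Matrix.mul_assoc, ← Units.val_mul, ← map_mul,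
    toGLC_mul_fromRows e₁] at h1
  obtain ⟨c, hc, _, _, h2⟩ := h1
  have hB : B₁ = 0 := by
    have h3 : B₁ * D₁.adjugate = 0 := by
      rw [Matrix.toRows₁_fromRows, Matrix.toRows₂_fromRows] at h2
      rw [← h2, smul_psiMat]
      ext i j
      fin_cases i <;> fin_cases j <;> simp [psiMat]
    have h4 := congrArg (fun X => X * D₁) h3
    simp only [Matrix.mul_assoc, Matrix.adjugate_mul, Matrix.mul_smul, Matrix.mul_one,
      Matrix.zero_mul] at h4
    exact (smul_eq_zero.1 h4).resolve_left (det_ne_zero_of_congr H₁.exists_D)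
  subst hB
  exact exists_isLift_of_lower H₁ e₁

/-! ### Faithfulness -/

theorem eq_one_of_block {h : GL (Fin 2 ⊕ Fin 2) Eis} (hh : h ∈ HGamma1)
    (hτ : ∀ τ ∈ H2, mob (toGLC h).1 τ = τ) : h = 1 ∨ h = -1 := by
  obtain ⟨A, B, C, D, H, e⟩ := exists_block hh
  have key : ∀ τ ∈ H2, A * τ + B = τ * (C * τ + D) := by
    intro τ ht
    have h1 := hτ τ ht
    have hu := (Matrix.isUnit_iff_isUnit_det _).1 (den_isUnit ⟨toGLC h, toGLC_mem ⟨h, hh⟩⟩ ht)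
    have h2 : num (toGLC h).1 τ = τ * den (toGLC h).1 τ := by
      have h3 : mob (toGLC h).1 τ * den (toGLC h).1 τ = τ * den (toGLC h).1 τ := by rw [h1]
      rwa [mob, Matrix.mul_assoc, Matrix.nonsing_inv_mul (den (toGLC h).1 τ) hu,
        Matrix.mul_one] at h3
    rwa [e] at h2
  have mem : ∀ (a d x y : ℝ) (t : ℝ), 0 < t → psiMat (a + t * Complex.I) (d + t * Complex.I) x y ∈ H2 := by
    intro a d x y t ht
    rw [psiMat_mem_iff]
    constructor
    · simp
      positivity
    · simpa using ht
  have entries : ∀ (a d x y : ℝ) (t : ℝ), 0 < t → ∀ i j,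
      (A * psiMat (a + t * Complex.I) (d + t * Complex.I) x y + B) i j =
      (psiMat (a + t * Complex.I) (d + t * Complex.I) x y *
        (C * psiMat (a + t * Complex.I) (d + t * Complex.I) x y + D)) i j :=
    fun a d x y t ht i j => congrFun (congrFun (key _ (mem a d x y t ht)) i) j
  have scal : ∀ t : ℝ, psiMat (((0 : ℝ) : ℂ) + t * Complex.I) (((0 : ℝ) : ℂ) + t * Complex.I) (0 : ℝ)
      (0 : ℝ) = (t * Complex.I) • (1 : Matrix (Fin 2) (Fin 2) ℂ) := by
    intro t
    ext i j
    fin_cases i <;> fin_cases j <;> simp [psiMat]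
  have k : ∀ t : ℝ, 0 < t → ∀ i j, t * Complex.I * A i j + B i j
      = - t ^ 2 * C i j + t * Complex.I * D i j := by
    intro t ht i j
    have h1 := entries 0 0 0 0 t ht i j
    rw [scal] at h1
    simp only [Matrix.mul_smul, Matrix.smul_mul, Matrix.mul_one, Matrix.one_mul, Matrix.add_apply,
      Matrix.smul_apply, smul_eq_mul] at h1
    linear_combination h1 + t ^ 2 * C i j * Complex.I_sq
  -- On the scalar matrices τ = it the fixed point equation is polynomial in t. Its second
  -- difference at t = 1, 2, 3 isolates C; values at 1 and 2 then give B, and one value gives A = D.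
  have hC : C = 0 := by
    ext i j
    have h1 := k 1 one_pos i j
    have h2 := k 2 two_pos i j
    have h3 := k 3 three_pos i j
    push_cast at h1 h2 h3
    rw [Matrix.zero_apply]
    linear_combination (h1 - 2 * h2 + h3) / 2
  subst hC
  have hB : B = 0 := by
    ext i j
    have h1 := k 1 one_pos i j
    have h2 := k 2 two_pos i j
    rw [Matrix.zero_apply] at *
    push_cast at h1 h2
    linear_combination 2 * h1 - h2
  subst hB
  have hA : D = A := by
    ext i j
    have h1 := k 1 one_pos i j
    rw [Matrix.zero_apply] at h1
    push_cast at h1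
    refine mul_left_cancel₀ Complex.I_ne_zero ?_
    linear_combination -h1
  subst hA
  -- What remains is that D commutes with the points of the half space; one diagonal and one
  -- off-diagonal perturbation of i · 1 force D to be scalar.
  have c01 : D 0 1 = 0 := by
    have h1 := entries 1 0 0 0 1 one_pos 0 1
    simp [Matrix.mul_apply, Fin.sum_univ_two, psiMat] at h1
    linear_combination -h1
  have c10 : D 1 0 = 0 := by
    have h1 := entries 1 0 0 0 1 one_pos 1 0
    simp [Matrix.mul_apply, Fin.sum_univ_two, psiMat] at h1
    linear_combination h1
  have c11 : D 1 1 = D 0 0 := by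
    have h1 := entries 0 0 1 0 1 one_pos 0 1
    simp [Matrix.mul_apply, Fin.sum_univ_two, psiMat, c01] at h1
    exact h1.symm
  have hn : star (D 0 0) * D 0 0 = 1 := by
    have h1 := congrFun (congrFun H.eq₁₂ 0) 0
    simpa [Matrix.mul_apply, Fin.sum_univ_two, c10] using h1
  obtain ⟨a, b, hab⟩ := mem_EisSub_iff.1 (H.memD 0 0)
  obtain ⟨D', hD', hD⟩ := H.exists_A
  obtain ⟨_, hb⟩ := parity_of_eq (hD' 0 0) (hab.symm.trans (by
    conv_lhs => rw [hD]
    simp))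
  rcases eq_one_or_neg_one_of_norm (H.memD 0 0) hab hb hn with h1 | h1
  · left
    apply toGLC_injective
    apply Units.ext
    rw [e, map_one, Units.val_one, ← Matrix.fromBlocks_one]
    have : D = 1 := by
      ext i j
      fin_cases i <;> fin_cases j <;> simp [c01, c10, c11, h1]
    rw [this]
  · right
    apply toGLC_injective
    apply Units.ext
    have h2 : (toGLC (-1)).1 = -1 := by
      ext i j
      simp [toGLC, Matrix.GeneralLinearGroup.map_apply, Matrix.one_apply, apply_ite]
    rw [e, h2, ← Matrix.fromBlocks_one, Matrix.fromBlocks_neg]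
    have : D = -1 := by
      ext i j
      fin_cases i <;> fin_cases j <;> simp [c01, c10, c11, h1]
    rw [this]
    simp

theorem actHGamma1ModPm_injective : Function.Injective actHGamma1ModPm := by
  rw [injective_iff_map_eq_one]
  intro x hx
  induction x using QuotientGroup.induction_on with
  | H h =>
    rw [QuotientGroup.eq_one_iff]
    refine eq_one_of_block h.2 fun τ hτ => ?_
    exact congrArg (fun f : Equiv.Perm H2 => (f ⟨τ, hτ⟩).1) hx

/-- Points with Gaussian integer coordinates are v + iw with v, w integral. Eliminating the
proportionality factor, which is the first coordinate of the image, and taking real parts gives an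
equation over ℤ. -/
theorem mulVec_eq_of_projAct {g : GL (Fin 6) ℤ} (hg : ∀ p ∈ DMPlus, projAct g p = p)
    (a d x y t : ℤ) (ht : 0 < t) (j : Fin 6) :
      (g.1 *ᵥ ![1, -2 * (a * d - t ^ 2 - x ^ 2 + x * y - y ^ 2), a, d, x, y]) j =
        (g.1 *ᵥ ![1, -2 * (a * d - t ^ 2 - x ^ 2 + x * y - y ^ 2), a, d, x, y]) 0 *
          ![1, -2 * (a * d - t ^ 2 - x ^ 2 + x * y - y ^ 2), a, d, x, y] j -
        (g.1 *ᵥ ![0, -2 * t * (a + d), t, t, 0, 0]) 0 * ![0, -2 * t * (a + d), t, t, 0, 0] j := by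
  set v := ![1, -2 * (a * d - t ^ 2 - x ^ 2 + x * y - y ^ 2), a, d, x, y] with hv
  set w := ![0, -2 * t * (a + d), t, t, 0, 0] with hw
  have ht' : (0 : ℝ) < t := by exact_mod_cast ht
  have e : quadVec (a + t * Complex.I) (d + t * Complex.I) x y
      = (fun i => (v i : ℂ)) + Complex.I • (fun i => (w i : ℂ)) := by
    ext i
    fin_cases i <;> simp [quadVec, hv, hw]
    · linear_combination (-2 * t ^ 2) * Complex.I_sq
    · ring
    · ring
  have hmem : Projectivization.mk ℂ (quadVec (a + t * Complex.I) (d + t * Complex.I) x y)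
      (quadVec_ne _ _ _ _) ∈ DMPlus := by
    refine (mem_DMPlus_mk _ _ rfl).2 ⟨rfl, ?_, ?_⟩
    · simp [quadVec]
      positivity
    · simpa [quadVec] using ht'
  have h1 := hg _ hmem
  rw [projAct_mk, Projectivization.mk_eq_mk_iff'] at h1
  obtain ⟨c, hc⟩ := h1
  have hadd : ∀ a b, onC g (a + b) = onC g a + onC g b := fun a b => Matrix.mulVec_add _ _ _
  have h2 : onC g (quadVec (a + t * Complex.I) (d + t * Complex.I) x y) =
      (fun i => ((g.1 *ᵥ v) i : ℂ)) + Complex.I • (fun i => ((g.1 *ᵥ w) i : ℂ)) := by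
    rw [e, hadd, onC_smul, onC_intCast, onC_intCast]
  rw [h2, e] at hc
  have hc0 := congrFun hc 0
  have hcj := congrFun hc j
  simp only [Pi.add_apply, Pi.smul_apply, smul_eq_mul] at hc0 hcj
  have v0 : v 0 = 1 := rfl
  have w0 : w 0 = 0 := rfl
  rw [v0, w0] at hc0
  have h3 : ((g.1 *ᵥ v) j : ℂ) + Complex.I * (g.1 *ᵥ w) j =
      ((g.1 *ᵥ v) 0 + Complex.I * (g.1 *ᵥ w) 0) * (v j + Complex.I * w j) := by
    rw [← hcj, ← hc0]
    simp
  have h4 := congrArg Complex.re h3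
  simp at h4
  exact_mod_cast h4

theorem eq_smul_one_of_mulVec {A : Matrix (Fin 6) (Fin 6) ℤ}
    (key : ∀ a d x y t : ℤ, 0 < t → ∀ j,
      (A *ᵥ ![1, -2 * (a * d - t ^ 2 - x ^ 2 + x * y - y ^ 2), a, d, x, y]) j =
        (A *ᵥ ![1, -2 * (a * d - t ^ 2 - x ^ 2 + x * y - y ^ 2), a, d, x, y]) 0 *
          ![1, -2 * (a * d - t ^ 2 - x ^ 2 + x * y - y ^ 2), a, d, x, y] j -
        (A *ᵥ ![0, -2 * t * (a + d), t, t, 0, 0]) 0 * ![0, -2 * t * (a + d), t, t, 0, 0] j) :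
    A = A 0 0 • 1 := by
  have row : ∀ a d x y t : ℤ, ∀ j, (A *ᵥ ![1, -2 * (a * d - t ^ 2 - x ^ 2 + x * y - y ^ 2), a, d,
      x, y]) j = A j 0 - 2 * (a * d - t ^ 2 - x ^ 2 + x * y - y ^ 2) * A j 1 + a * A j 2 +
        d * A j 3 + x * A j 4 + y * A j 5 := by
    intro a d x y t j
    simp [Matrix.mulVec, dotProduct, Fin.sum_univ_succ]
    ring
  have row' : ∀ a d t : ℤ, (A *ᵥ ![0, -2 * t * (a + d), t, t, 0, 0]) 0 =
      - 2 * t * (a + d) * A 0 1 + t * A 0 2 + t * A 0 3 := by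
    intro a d t
    simp [Matrix.mulVec, dotProduct, Fin.sum_univ_succ]
    ring
  simp only [row, row'] at key
  -- Each choice of the parameters makes the hypothesis a linear equation in the entries of A. For j
  -- = 4, 5 the last product vanishes, which is why these rows start the elimination.
  have k1 := fun j => key 0 0 0 0 1 (by norm_num) j
  have k2 := fun j => key 0 0 0 0 2 (by norm_num) j
  have k3 := fun j => key 0 0 0 0 3 (by norm_num) j
  have k4 := fun j => key 1 0 0 0 1 (by norm_num) j
  have k5 := fun j => key 0 1 0 0 1 (by norm_num) j
  have k6 := fun j => key 0 0 1 0 1 (by norm_num) j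
  have k7 := fun j => key 0 0 (-1) 0 1 (by norm_num) j
  have k8 := fun j => key 0 0 0 1 1 (by norm_num) j
  have k9 := fun j => key 0 0 0 (-1) 1 (by norm_num) j
  have k10 := key 1 0 1 0 1 (by norm_num) 4
  have k11 := key 0 1 1 0 1 (by norm_num) 4
  simp only [Fin.forall_fin_succ, Fin.succ_zero_eq_one, Fin.succ_one_eq_two, IsEmpty.forall_iff,
    and_true] at k1 k2 k3 k4 k5 k6 k7 k8 k9
  simp at k1 k2 k3 k4 k5 k6 k7 k8 k9 k10 k11
  obtain ⟨a1, a2, a3, a4, a5⟩ := k1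
  obtain ⟨b1, b2, b3, b4, b5⟩ := k2
  obtain ⟨c1, -, -, -, -⟩ := k3
  obtain ⟨d1, d2, d3, d4, d5⟩ := k4
  obtain ⟨e1, e2, e3, e4, e5⟩ := k5
  obtain ⟨f1, f2, f3, f4, f5⟩ := k6
  obtain ⟨-, -, -, g4, g5⟩ := k7
  obtain ⟨h1, h2, h3, h4, h5⟩ := k8
  obtain ⟨-, -, -, -, i5⟩ := k9
  clear key row row'
  have r40 : A 4 0 = 0 := by linarith only [a4, b4]
  have r41 : A 4 1 = 0 := by linarith only [a4, b4]
  have r50 : A 5 0 = 0 := by linarith only [a5, b5]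
  have r51 : A 5 1 = 0 := by linarith only [a5, b5]
  have r01 : A 0 1 = 0 := by linarith only [a1, b1, c1]
  have r04 : A 0 4 = 0 := by linarith only [f4, g4, r40, r41, r01]
  have r05 : A 0 5 = 0 := by linarith only [h5, i5, r50, r51, r01]
  have r42 : A 4 2 = 0 := by linarith only [d4, r40, r41]
  have r43 : A 4 3 = 0 := by linarith only [e4, r40, r41]
  have r44 : A 4 4 = A 0 0 := by linarith only [f4, r40, r41, r01, r04]
  have r45 : A 4 5 = 0 := by linarith only [h4, r40, r41]
  have r52 : A 5 2 = 0 := by linarith only [d5, r50, r51]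
  have r53 : A 5 3 = 0 := by linarith only [e5, r50, r51]
  have r54 : A 5 4 = 0 := by linarith only [f5, r50, r51]
  have r55 : A 5 5 = A 0 0 := by linarith only [h5, r50, r51, r01, r05]
  have r02 : A 0 2 = 0 := by linarith only [k10, r40, r41, r42, r44, r01, r04]
  have r03 : A 0 3 = 0 := by linarith only [k11, r40, r41, r43, r44, r01, r04]
  have r20 : A 2 0 = 0 := by linarith only [a2, b2, r02, r03]
  have r21 : A 2 1 = 0 := by linarith only [a2, b2, r02, r03]
  have r30 : A 3 0 = 0 := by linarith only [a3, b3, r02, r03]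
  have r31 : A 3 1 = 0 := by linarith only [a3, b3, r02, r03]
  have r22 : A 2 2 = A 0 0 := by linarith only [d2, r20, r21, r01, r02, r03]
  have r23 : A 2 3 = 0 := by linarith only [e2, r20, r21, r01, r02, r03]
  have r24 : A 2 4 = 0 := by linarith only [f2, r20, r21, r02, r03]
  have r25 : A 2 5 = 0 := by linarith only [h2, r20, r21, r02, r03]
  have r32 : A 3 2 = 0 := by linarith only [d3, r30, r31, r01, r02, r03]
  have r33 : A 3 3 = A 0 0 := by linarith only [e3, r30, r31, r01, r02, r03]
  have r34 : A 3 4 = 0 := by linarith only [f3, r30, r31, r02, r03]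
  have r35 : A 3 5 = 0 := by linarith only [h3, r30, r31, r02, r03]
  have r10 : A 1 0 = 0 := by linarith only [a1, b1, r01]
  have r11 : A 1 1 = A 0 0 := by linarith only [a1, b1, r01]
  have r12 : A 1 2 = 0 := by linarith only [d1, r10, r11, r01, r02, r03]
  have r13 : A 1 3 = 0 := by linarith only [e1, r10, r11, r01, r02, r03]
  have r14 : A 1 4 = 0 := by linarith only [f1, r10, r11, r01, r04]
  have r15 : A 1 5 = 0 := by linarith only [h1, r10, r11, r01, r05]
  ext i j
  fin_cases i <;> fin_cases j <;> simp [*]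

theorem eq_one_of_projAct {g : GL (Fin 6) ℤ} (hg : ∀ p ∈ DMPlus, projAct g p = p) :
    g = 1 ∨ g = -1 := by
  have hs := eq_smul_one_of_mulVec (mulVec_eq_of_projAct hg)
  have hu : IsUnit (g.1 0 0) := by
    have h7 := congrFun (congrFun (Units.mul_inv g) 0) 0
    rw [hs, Matrix.smul_mul, Matrix.one_mul, Matrix.smul_apply] at h7
    exact IsUnit.of_mul_eq_one _ h7
  rcases Int.isUnit_iff.1 hu with h6 | h6
  · exact Or.inl (Units.ext (by rw [hs, h6]; simp))
  · exact Or.inr (Units.ext (by rw [hs, h6]; simp))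

theorem actH2_injective (G : Subgroup (GL (Fin 6) ℤ)) (hG : G ≤ OPlus) :
    Function.Injective (actH2 G hG) := by
  rw [injective_iff_map_eq_one]
  intro x hx
  induction x using QuotientGroup.induction_on with
  | H g =>
    rw [QuotientGroup.eq_one_iff]
    refine eq_one_of_projAct fun p hp => ?_
    have h1 := congrArg (fun f : Equiv.Perm H2 => f (Psi ⟨p, hp⟩)) hx
    simp only [actH2_mk, Equiv.symm_apply_apply, Equiv.Perm.one_apply,
      EmbeddingLike.apply_eq_iff_eq] at h1
    exact congrArg Subtype.val h1

/-! ### The isometry of `M` inducing `W'` -/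

/-- The isometry that swaps the first two coordinates and changes the sign of the last two. -/
def isoW : GL (Fin 6) ℤ :=
  let A : Matrix (Fin 6) (Fin 6) ℤ :=
    !![0, 1, 0, 0, 0, 0;
       1, 0, 0, 0, 0, 0;
       0, 0, 1, 0, 0, 0;
       0, 0, 0, 1, 0, 0;
       0, 0, 0, 0, -1, 0;
       0, 0, 0, 0, 0, -1]
  ⟨A, A, by decide +kernel, by decide +kernel⟩

theorem isoW_mul_isoW : isoW * isoW = 1 := Units.ext isoW.val_inv

theorem isoW_mulVec (v : Fin 6 → ℤ) : isoW.1 *ᵥ v = ![v 1, v 0, v 2, v 3, -v 4, -v 5] := by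
  ext i
  fin_cases i <;> simp [isoW, Matrix.mulVec, dotProduct, Fin.sum_univ_succ]

theorem onC_isoW (v : Fin 6 → ℂ) : onC isoW v = ![v 1, v 0, v 2, v 3, -v 4, -v 5] := by
  ext i
  fin_cases i <;> simp [onC, isoW, Matrix.mulVec, dotProduct, Fin.sum_univ_succ]

theorem isoW_mem_OM : isoW ∈ OM := by
  rw [mem_OM_iff]
  intro v
  rw [isoW_mulVec]
  simp [quad]
  ring

theorem isoW_mem_Cong : isoW ∈ Cong := by
  intro v h0 h1 i
  rw [isoW_mulVec]
  fin_cases i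
  · exact dvd_sub h1 h0
  · exact dvd_sub h0 h1
  · simp
  · simp
  · exact ⟨-v 4, by simp; ring⟩
  · exact ⟨-v 5, by simp; ring⟩

theorem det_isoW : isoW.det = -1 := by
  ext
  simp [isoW, Matrix.det_succ_row_zero, Fin.sum_univ_succ, Fin.succAbove, Matrix.submatrix]

/-- Up to the scalar, W is the adjugate. Conjugation by the swap exchanges both the diagonal and the
off-diagonal entries, and the transpose restores the order of the latter. -/
theorem W'_apply (τ : H2) : (W' τ).1 =
    ((-2 * τ.1.det)⁻¹ • !![τ.1 0 0, -τ.1 0 1; -τ.1 1 0, τ.1 1 1]) ∧ τ.1.det ≠ 0 := by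
  have h1 : den W.1.1 τ.1 = (2 : ℂ) • τ.1 := by simp [den, W]
  have h2 : num W.1.1 τ.1 = -1 := by simp [num, W]
  have hd : τ.1.det ≠ 0 := by
    have h3 := (Matrix.isUnit_iff_isUnit_det _).1 (den_isUnit W τ.2)
    rw [h1, Matrix.det_smul] at h3
    exact right_ne_zero_of_mul h3.ne_zero
  have h4 : mob W.1.1 τ.1 = (-2 * τ.1.det)⁻¹ • τ.1.adjugate := by
    rw [mob, h1, h2, Matrix.inv_def, Matrix.det_smul, Matrix.adjugate_smul]
    simp only [Fintype.card_fin, Ring.inverse_eq_inv', smul_smul, Matrix.neg_mul, Matrix.one_mul,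
      ← neg_smul]
    congr 1
    simp
    field_simp
  have h5 : ∀ σ, mob (gA swapA).1.1 σ = !![0, 1; 1, 0] * σ * !![0, 1; 1, 0] := by
    intro σ
    have h6 : den (gA swapA).1.1 σ = !![0, 1; 1, 0] := by
      ext i j
      fin_cases i <;> fin_cases j <;> simp [den, gA, swapA, Units.inv_mk]
    have h7 : num (gA swapA).1.1 σ = !![0, 1; 1, 0] * σ := by simp [num, gA, swapA]
    rw [mob, h6, h7]
    congr 1
    exact Matrix.inv_eq_left_inv (by simp [Matrix.one_fin_two])
  refine ⟨?_, hd⟩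
  change (mob (gA swapA).1.1 (mob W.1.1 τ.1))ᵀ = _
  rw [h5, h4, Matrix.adjugate_fin_two]
  ext i j
  fin_cases i <;> fin_cases j <;> simp

/-- On normalized vectors the second coordinate is -2 det τ; after the exchange of the first two
coordinates, normalizing divides by it, which is the scalar in `W'_apply`. -/
theorem projAct_isoW (p : DMPlus) : projAct isoW p.1 = (Psi.symm (W' (Psi p))).1 := by
  obtain ⟨a, d, x, y, hτ, hp⟩ := exists_quadVec p
  set q := Psi.symm (W' (Psi p)) with hq
  obtain ⟨a', d', x', y', hτ', hp'⟩ := exists_quadVec q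
  obtain ⟨h1, h2⟩ := W'_apply (Psi p)
  rw [show W' (Psi p) = Psi q by simp [hq], hτ'] at h1
  rw [hτ] at h1 h2
  set c := -2 * (psiMat a d x y).det with hc
  have hc0 : c ≠ 0 := mul_ne_zero (by norm_num) h2
  have h3 : psiMat a' d' x' y' = psiMat (c⁻¹ * a) (c⁻¹ * d) (c⁻¹ * -x) (c⁻¹ * -y) := by
    rw [h1, ← smul_psiMat]
    congr 1
    ext i j
    fin_cases i <;> fin_cases j <;> simp [psiMat] <;> ring
  obtain ⟨rfl, rfl, rfl, rfl⟩ := psiMat_inj h3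
  rw [hp, hp', projAct_mk, Projectivization.mk_eq_mk_iff', onC_isoW]
  rw [det_psiMat] at hc
  clear_value c
  refine ⟨c, ?_⟩
  ext i
  fin_cases i
  · simp [quadVec, hc]
  · simp [quadVec]
    field_simp
    linear_combination -hc
  all_goals simp [quadVec]; field_simp

theorem isoW_mem_OPlus : isoW ∈ OPlus := by
  have key : ∀ p ∈ DMPlus, projAct isoW p ∈ DMPlus := by
    intro p hp
    rw [projAct_isoW ⟨p, hp⟩]
    exact Subtype.prop _
  refine ⟨isoW_mem_OM, Set.Subset.antisymm (Set.image_subset_iff.2 key) fun p hp => ?_⟩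
  refine ⟨projAct isoW p, key p hp, ?_⟩
  rw [← Equiv.Perm.mul_apply, ← map_mul, isoW_mul_isoW, map_one, Equiv.Perm.one_apply]

theorem isoW_mem_OEnr : isoW ∈ OEnr := (mem_OEnr_iff _).2 ⟨isoW_mem_OPlus, isoW_mem_Cong⟩

theorem actH2_isoW : actH2 OEnr OEnr_le (QuotientGroup.mk ⟨isoW, isoW_mem_OEnr⟩) = W' := by
  ext1 τ
  rw [actH2_mk]
  have h := projAct_isoW (Psi.symm τ)
  rw [Equiv.apply_symm_apply] at h
  rw [← Equiv.eq_symm_apply]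
  exact Subtype.ext h

/-! ### Elements of determinant one lift -/

theorem mem_Lift_of_mem_SOEnr {g : GL (Fin 6) ℤ} (hg : g ∈ SOEnr) : g ∈ Lift := by
  obtain ⟨h1, hdet⟩ := (mem_SOEnr_iff _).1 hg
  obtain ⟨hp, hc⟩ := (mem_OEnr_iff _).1 h1
  by_cases ho : Odd ((g.1 *ᵥ basisVec 0) 0)
  · exact mem_Lift_of_odd hp hc ho
  exfalso
  -- If both entries were even, the congruence for g⁻¹ would make the first basis vector agree
  -- modulo 2 with its image, although its first coordinate is odd.
  have ho' : Odd ((g.1 *ᵥ basisVec 0) 1) := by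
    by_contra h
    rw [Int.not_odd_iff_even, even_iff_two_dvd] at h ho
    have h2 := inv_mem hc _ ho h 0
    rw [inv_mulVec_mulVec] at h2
    have h3 := (Int.dvd_iff_dvd_of_dvd_sub h2).2 ho
    simp [basisVec_apply] at h3
  have h2 : isoW * g ∈ Lift := by
    refine mem_Lift_of_odd (mul_mem isoW_mem_OPlus hp) (mul_mem isoW_mem_Cong hc) ?_
    rw [Units.val_mul, ← Matrix.mulVec_mulVec, isoW_mulVec]
    exact ho'
  obtain ⟨h, H⟩ := h2
  have h3 := H.det
  rw [map_mul, det_isoW, hdet] at h3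
  exact absurd (congrArg Units.val h3) (by norm_num)

theorem range_actHGamma1ModPm :
    actHGamma1ModPm.range = (actH2 SOEnr SOEnr_le).range := by
  apply le_antisymm
  · rintro _ ⟨x, rfl⟩
    induction x using QuotientGroup.induction_on with
    | H h =>
      obtain ⟨g, H⟩ := exists_isLift h.2
      exact ⟨QuotientGroup.mk ⟨g, H.mem_SOEnr⟩, H.actH2_eq _ _ _⟩
  · rintro _ ⟨x, rfl⟩
    induction x using QuotientGroup.induction_on with
    | H g =>
      obtain ⟨h, H⟩ := mem_Lift_of_mem_SOEnr g.2
      exact ⟨_, (H.actH2_eq _ _ g.2).symm⟩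

/-! ### Subgroups acting by conjugation -/

section conj

variable {P N H : Type*} [Group P] [Group N] [Group H]

theorem exists_mulEquiv_of_range_eq {i : N →* P} {j : H →* P} (hi : Function.Injective i)
    (hj : Function.Injective j) (h : i.range = j.range) : ∃ e : H ≃* N, ∀ x, i (e x) = j x := by
  refine ⟨((MonoidHom.ofInjective hj).trans (MulEquiv.subgroupCongr h.symm)).trans
    (MonoidHom.ofInjective hi).symm, fun x => ?_⟩
  rw [MulEquiv.trans_apply, ← MonoidHom.ofInjective_apply hi, MulEquiv.apply_symm_apply]
  rfl

theorem exists_conj_mulAut {i : N →* P} (hi : Function.Injective i) (K : Subgroup P)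
    (h : ∀ k ∈ K, ∀ x, k * i x * k⁻¹ ∈ i.range) :
    ∃ φ : K →* MulAut N, ∀ (k : K) (x : N), i (φ k x) = (k : P) * i x * (k : P)⁻¹ := by
  choose f hf using fun (k : K) (x : N) => h k k.2 x
  have f_mul : ∀ k l x, f (k * l) x = f k (f l x) := by
    intro k l x
    apply hi
    rw [hf, hf, hf]
    push_cast
    group
  have f_one : ∀ x, f 1 x = x := by
    intro x
    apply hi
    rw [hf]
    simp
  refine ⟨{ toFun := fun k =>
              { toFun := f k
                invFun := f k⁻¹
                left_inv := fun x => by rw [← f_mul, inv_mul_cancel, f_one]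
                right_inv := fun x => by rw [← f_mul, mul_inv_cancel, f_one]
                map_mul' := fun x y => hi (by rw [hf, map_mul, map_mul, hf, hf]; group) }
            map_one' := MulEquiv.ext f_one
            map_mul' := fun k l => MulEquiv.ext (f_mul k l) }, hf⟩

/-- The multiplication map from the semidirect product to the ambient group is injective because the
image of N meets K trivially, and its image is that of H; everything takes place inside P, so the
isomorphism respects the actions. -/
theorem exists_mulEquiv_semidirectProduct {i : N →* P} {j : H →* P}
    (hj : Function.Injective j) {K : Subgroup P} {φ : K →* MulAut N}
    (hφ : ∀ (k : K) (x : N), i (φ k x) = (k : P) * i x * (k : P)⁻¹)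
    (hd : ∀ x, i x ∈ K → x = 1) (hij : i.range ≤ j.range) (hK : K ≤ j.range)
    (hjr : ∀ y, ∃ x, ∃ k ∈ K, j y = i x * k) :
    ∃ e : H ≃* N ⋊[φ] K, ∀ y, i (e y).left * ((e y).right : P) = j y := by
  let l : N ⋊[φ] K →* P := SemidirectProduct.lift i K.subtype fun k => by
    ext x
    simpa using hφ k x
  have hl : ∀ z, l z = i z.left * (z.right : P) := fun z => rfl
  have hinj : Function.Injective l := by
    rw [injective_iff_map_eq_one]
    intro z hz
    rw [hl] at hz
    have h1 : z.left = 1 := hd _ (by rw [eq_inv_of_mul_eq_one_left hz]; exact inv_mem z.right.2)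
    rw [h1, map_one, one_mul] at hz
    exact SemidirectProduct.ext h1 (Subtype.ext hz)
  have hr : l.range = j.range := by
    apply le_antisymm
    · rintro _ ⟨z, rfl⟩
      exact mul_mem (hij ⟨_, rfl⟩) (hK z.right.2)
    · rintro _ ⟨y, rfl⟩
      obtain ⟨x, k, hk, e⟩ := hjr y
      exact ⟨⟨x, k, hk⟩, e.symm⟩
  exact exists_mulEquiv_of_range_eq hinj hj hr

end conj

/-! ### The groups of automorphisms of `ℍ₂` -/

theorem mem_range_actHGamma1ModPm_iff (f : Equiv.Perm H2) : f ∈ actHGamma1ModPm.range ↔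
    ∃ (g : GL (Fin 6) ℤ) (hg : g ∈ OEnr), g.det = 1 ∧
      actH2 OEnr OEnr_le (QuotientGroup.mk ⟨g, hg⟩) = f := by
  rw [range_actHGamma1ModPm]
  constructor
  · rintro ⟨x, rfl⟩
    induction x using QuotientGroup.induction_on with
    | H g => exact ⟨g, g.2.1, g.2.2, rfl⟩
  · rintro ⟨g, hg, hd, rfl⟩
    exact ⟨QuotientGroup.mk ⟨g, hg, hd⟩, rfl⟩

theorem W'_mul_W' : W' * W' = 1 := by
  rw [← actH2_isoW, ← map_mul, ← QuotientGroup.mk_mul]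
  exact (congrArg (fun g => actH2 OEnr OEnr_le (QuotientGroup.mk g))
    (Subtype.ext isoW_mul_isoW : (⟨isoW, isoW_mem_OEnr⟩ * ⟨isoW, isoW_mem_OEnr⟩ : OEnr) = 1)).trans
    (map_one _)

theorem eq_one_or_eq_W' {f : Equiv.Perm H2} (hf : f ∈ Subgroup.zpowers W') : f = 1 ∨ f = W' := by
  obtain ⟨n, rfl⟩ := Subgroup.mem_zpowers_iff.1 hf
  have h2 : W' ^ (2 : ℤ) = 1 := by rw [zpow_two, W'_mul_W']
  rcases Int.even_or_odd' n with ⟨k, rfl | rfl⟩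
  · left
    rw [zpow_mul, h2, one_zpow]
  · right
    rw [zpow_add, zpow_mul, h2, one_zpow, one_mul, zpow_one]

theorem W'_conj_mem (x : ModPm HGamma1) : W' * actHGamma1ModPm x * W'⁻¹ ∈ actHGamma1ModPm.range := by
  obtain ⟨g, hg, hd, e⟩ := (mem_range_actHGamma1ModPm_iff _).1 ⟨x, rfl⟩
  rw [← e, ← actH2_isoW, ← map_inv, ← map_mul, ← map_mul, mem_range_actHGamma1ModPm_iff]
  refine ⟨isoW * g * isoW⁻¹, mul_mem (mul_mem isoW_mem_OEnr hg) (inv_mem isoW_mem_OEnr), ?_, rfl⟩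
  rw [map_mul, map_mul, hd, mul_one, map_inv, mul_inv_cancel]

/-- Two isometries with the same action differ by ±1, and -1 has determinant 1 in rank six, so the
determinant is well defined on the action and separates W' from HΓ₁(2). -/
theorem W'_notMem : W' ∉ actHGamma1ModPm.range := by
  rw [mem_range_actHGamma1ModPm_iff]
  rintro ⟨g, hg, hd, e⟩
  rw [← actH2_isoW] at e
  have h1 := QuotientGroup.eq.1 (actH2_injective OEnr OEnr_le e)
  have h2 : (g⁻¹ * isoW).det = -1 := by rw [map_mul, map_inv, hd, det_isoW, inv_one, one_mul]
  have h3 : (g⁻¹ * isoW).det = 1 := by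
    rcases h1 with h | h
    · have h' : g⁻¹ * isoW = 1 := h
      rw [h', map_one]
    · have h' : g⁻¹ * isoW = -1 := h
      rw [h', det_neg_six, map_one]
  rw [h2] at h3
  exact absurd (congrArg Units.val h3) (by norm_num)

theorem exists_actH2_OEnr_eq (y : ModPm OEnr) : ∃ x, ∃ k ∈ Subgroup.zpowers W',
    actH2 OEnr OEnr_le y = actHGamma1ModPm x * k := by
  induction y using QuotientGroup.induction_on with
  | H g =>
    obtain ⟨g, hg⟩ := g
    rcases Int.units_eq_one_or g.det with hd | hd
    · obtain ⟨x, e⟩ := (mem_range_actHGamma1ModPm_iff _).2 ⟨g, hg, hd, rfl⟩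
      exact ⟨x, 1, one_mem _, by rw [e, mul_one]⟩
    · obtain ⟨x, e⟩ := (mem_range_actHGamma1ModPm_iff _).2
        ⟨g * isoW, mul_mem hg isoW_mem_OEnr, by rw [map_mul, hd, det_isoW]; rfl, rfl⟩
      refine ⟨x, W', Subgroup.mem_zpowers _, ?_⟩
      rw [e, ← actH2_isoW, ← map_mul, ← QuotientGroup.mk_mul]
      congr 2
      ext1
      exact (by rw [mul_assoc, isoW_mul_isoW, mul_one] : g = g * isoW * isoW)

theorem exists_conj_W' : ∃ φ : Subgroup.zpowers W' →* MulAut (ModPm HGamma1),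
    (∀ w x, actHGamma1ModPm (φ w x) =
      (w : Equiv.Perm H2) * actHGamma1ModPm x * (w : Equiv.Perm H2)⁻¹) ∧
    ∃ e : ModPm OEnr ≃* (ModPm HGamma1 ⋊[φ] Subgroup.zpowers W'),
      ∀ x, actHGamma1ModPm (e x).left * ((e x).right : Equiv.Perm H2) =
        actH2 OEnr OEnr_le x := by
  obtain ⟨φ, hφ⟩ := exists_conj_mulAut actHGamma1ModPm_injective (Subgroup.zpowers W') <| by
    intro k hk x
    rcases eq_one_or_eq_W' hk with rfl | rfl
    · simp
    · exact W'_conj_mem x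
  refine ⟨φ, hφ, exists_mulEquiv_semidirectProduct
    (actH2_injective _ _) hφ ?_ ?_ ?_ exists_actH2_OEnr_eq⟩
  · intro x hx
    rcases eq_one_or_eq_W' hx with h | h
    · exact actHGamma1ModPm_injective (h.trans (map_one _).symm)
    · exact absurd ⟨x, h⟩ W'_notMem
  · intro f hf
    obtain ⟨g, hg, -, e⟩ := (mem_range_actHGamma1ModPm_iff f).1 hf
    exact ⟨_, e⟩
  · rw [Subgroup.zpowers_le]
    exact ⟨_, actH2_isoW⟩

end HessianK3

end

theorem theorem4 :
    -- the target of `O⁺(M) → S₅` is the symmetric group of a set with five elements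
    Nat.card HessianK3.isoTwo = 5 ∧
    -- its kernel consists of the elements acting trivially on the 2-torsion of `M^∨ / M`
    (∀ g : GL (Fin 6) ℤ, g ∈ HessianK3.OEnr ↔
      ∃ h : g ∈ HessianK3.OPlus, ∀ x : HessianK3.Discr, (2 : ℤ) • x = 0 →
        (HessianK3.discrAct ⟨g, h.1⟩).1 x = x) ∧
    -- the groups modulo `±1` are groups of automorphisms of `ℍ₂`
    Function.Injective (HessianK3.actH2 HessianK3.OEnr HessianK3.OEnr_le) ∧
    Function.Injective HessianK3.actHGamma1ModPm ∧
    -- `SO⁺_Enr(M) / {±1} ≅ HΓ₁(2) / {±1}`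
    (∃ e : HessianK3.ModPm HessianK3.SOEnr ≃* HessianK3.ModPm HessianK3.HGamma1,
      ∀ x, HessianK3.actHGamma1ModPm (e x) =
        HessianK3.actH2 HessianK3.SOEnr HessianK3.SOEnr_le x) ∧
    -- `O⁺_Enr(M) / {±1} ≅ HΓ₁(2) / {±1} ⋊ ⟨W'⟩`, where `⟨W'⟩` acts by conjugation
    (∃ φ : Subgroup.zpowers HessianK3.W' →* MulAut (HessianK3.ModPm HessianK3.HGamma1),
      (∀ w x, HessianK3.actHGamma1ModPm (φ w x) =
        (w : Equiv.Perm HessianK3.H2) * HessianK3.actHGamma1ModPm x *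
          (w : Equiv.Perm HessianK3.H2)⁻¹) ∧
      ∃ e : HessianK3.ModPm HessianK3.OEnr ≃*
          (HessianK3.ModPm HessianK3.HGamma1 ⋊[φ] Subgroup.zpowers HessianK3.W'),
        ∀ x, HessianK3.actHGamma1ModPm (e x).left *
            ((e x).right : Equiv.Perm HessianK3.H2) =
          HessianK3.actH2 HessianK3.OEnr HessianK3.OEnr_le x) := by
  open HessianK3 in
  exact ⟨card_isoTwo, mem_OEnr_iff_discr, actH2_injective _ _, actHGamma1ModPm_injective,
    exists_mulEquiv_of_range_eq actHGamma1ModPm_injective (actH2_injective _ _)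
      range_actHGamma1ModPm, exists_conj_W'⟩
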